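/- **Setting.** Let $m,n\ge 1$, $d\ge 0$, and let $f_{i,j}:\mathbb R^d\to\mathbb R$ ($1\le i\le m$, $1\le j\le n$) be differentiable, convex and $L$-smooth, i.e. $f_{i,j}(y)-f_{i,j}(x)\le\langle\nabla f_{i,j}(x),y-x\rangle+\frac L2\|y-x\|^2$. Put $f_i=\frac1n\sum_j f_{i,j}$, $f=\frac1m\sum_i f_i$, and assume that $f$ is $\mu$-strongly convex, i.e. $f(y)-f(x)\ge\langle\nabla f(x),y-x\rangle+\frac\mu2\|y-x\|^2$, with $L,\mu>0$ and $\kappa=L/\mu$. Let $r:\mathbb R^d\to\mathbb R$ be convex, and let $x^*$ be the minimizer of $f+r$. Let $W\in\mathbb R^{m\times m}$ be symmetric with $0\preceq W\preceq I$, $W\mathbf 1=\mathbf 1$ and $\operatorname{null}(I-W)=\operatorname{span}(\mathbf 1)$, and let $\lambda_2(W)$ be its second-largest singular value ($0$ if $m=1$). For $\mathbf x\in\mathbb R^{m\times d}$ with rows $\mathbf x_i$ put $\bar x=\frac1m\sum_i\mathbf x_i$ and $\mathbf 1\bar x$ for the matrix all of whose rows are $\bar x$; matrix norms are Frobenius norms.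 $\mathrm{FastMix}(\mathbf x,K)$ is the $K$-th term $\mathbf y^K$ of $\mathbf y^{0}=\mathbf y^{-1}=\mathbf x$, $\mathbf y^{k+1}=(1+\eta_w)W\mathbf y^k-\eta_w\mathbf y^{k-1}$, $\eta_w=\frac{1-\sqrt{1-\lambda_2(W)^2}}{1+\sqrt{1-\lambda_2(W)^2}}$; it uses $K$ communication steps. With $\eta=\frac1{12L}$ let $\mathbf{prox}(\mathbf x)=\operatorname{argmin}_{\mathbf z\in\mathbb R^{m\times d}}\big(\frac1m\sum_i r(\mathbf z_i)+\frac1{2m\eta}\|\mathbf z-\mathbf x\|^2\big)$. **Algorithms.** All agents start from the same point $\mathbf x^0_i=x^0$, and $\mathbf v^{-1}_i=\mathbf s^{-1}_i=\nabla f(x^0)$. For $t=0,1,\dots$ each agent $i$ picks $j_i$ uniformly from $\{1,\dots,n\}$, forms $\mathbf v_i^t$, and then $$\mathbf s^t=\mathrm{FastMix}(\mathbf s^{t-1}+\mathbf v^t-\mathbf v^{t-1},K),\qquad \mathbf x^{t+1}=\mathrm{FastMix}(\mathbf{prox}(\mathbf x^t-\eta\mathbf s^t),K).$$ *PMGT-SAGA*: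 $\phi^0_{i,j}=x^0$; $\phi^{t+1}_{i,j_i}=\mathbf x_i^t$ and $\phi^{t+1}_{i,j}=\phi^t_{i,j}$ for $j\ne j_i$; $\mathbf v_i^t=\nabla f_{i,j_i}(\phi^{t+1}_{i,j_i})-\nabla f_{i,j_i}(\phi^{t}_{i,j_i})+\frac1n\sum_j\nabla f_{i,j}(\phi^t_{i,j})$. Put $\Delta^t=\frac1{mn}\sum_{i,j}\|\nabla f_{i,j}(\phi^t_{i,j})-\nabla f_{i,j}(x^*)\|^2$. *PMGT-LSVRG*: $\mathbf w_i^0=x^0$; $\mathbf v_i^t=\nabla f_{i,j_i}(\mathbf x_i^t)-\nabla f_{i,j_i}(\mathbf w_i^t)+\nabla f_i(\mathbf w_i^t)$; $\mathbf w_i^{t+1}=\mathbf x_i^t$ with probability $p=\frac1n$ and $\mathbf w_i^{t+1}=\mathbf w_i^t$ otherwise. Put $\Delta^t=\frac1{mn}\sum_{i,j}\|\nabla f_{i,j}(\mathbf w^t_i)-\nabla f_{i,j}(x^*)\|^2$. All random choices are independent. Put $V^t=\|\bar x^t-x^*\|^2+4n\eta^2\Delta^t$ and $\mathbf z^t=\big(\frac1m\|\mathbf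 x^t-\mathbf 1\bar x^t\|^2,\ \frac{\eta^2}m\|\mathbf s^t-\mathbf 1\bar s^t\|^2\big)\in\mathbb R^2$ (Euclidean norm); $V^0$ and $\mathbf z^0$ are deterministic. **Theorem.** Let $0<\rho\le\frac1{41}\min\big(\frac1{24\kappa},\frac1{4n}\big)$ and $K=\Big\lceil\frac1{\sqrt{1-\lambda_2(W)}}\log\frac1\rho\Big\rceil$. Then, for both PMGT-SAGA and PMGT-LSVRG and all $t\ge0$, $$\mathbb E[V^t]\le\max\Big(1-\frac1{24\kappa},1-\frac1{4n}\Big)^t\big(V^0+\|\mathbf z^0\|\big)$$ and $$\mathbb E\Big[\max\Big(\tfrac1m\|\mathbf x^t-\mathbf 1\bar x^t\|^2,\tfrac1{144mL^2}\|\mathbf s^t-\mathbf 1\bar s^t\|^2\Big)\Big]\le\Big(\tfrac1{45387}\min\big(\tfrac1{36\kappa^2},\tfrac1{n^2}\big)+2^{-t}\Big)\max\Big(1-\tfrac1{24\kappa},1-\tfrac1{4n}\Big)^t\big(V^0+\|\mathbf z^0\|\big).$$ Moreover there is an absolute constant $C$, independent of the problem, such that for every $0<\epsilon\le\frac12$ with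 $\epsilon\,(V^0+\|\mathbf z^0\|)\le1$ there is $t_0$ with $\mathbb E\big[\max\big(\frac1m\|\mathbf x^t-\mathbf 1\bar x^t\|^2,\|\bar x^t-x^*\|^2\big)\big]<\epsilon$ for all $t\ge t_0$, for which the expected number of component gradients that each agent evaluates to produce $\mathbf x^{t_0}$ is at most $$C\max(\kappa,n)\log\tfrac1\epsilon ,$$ and, if $\rho=\frac1{41}\min\big(\frac1{24\kappa},\frac1{4n}\big)$, the number of communication steps used to produce $\mathbf x^{t_0}$ is at most $$C\max\big(1,\,n\log n,\,\kappa\log\kappa\big)\frac1{\sqrt{1-\lambda_2(W)}}\log\tfrac1\epsilon .$$ Here PMGT-SAGA evaluates $n$ component gradients per agent at the start and one in each iteration; PMGT-LSVRG evaluates $n$ at the start, two in each iteration, and $n$ more whenever $\mathbf w_i$ is replaced. -/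

import Mathlib

open MeasureTheory ProbabilityTheory

noncomputable section

namespace PMGT

/-- `ℝ^d` with the Euclidean norm. -/
abbrev Vec (d : ℕ) : Type := EuclideanSpace ℝ (Fin d)

/-- An aggregated variable in `ℝ^{m × d}`, given by its rows. -/
abbrev Agg (m d : ℕ) : Type := Fin m → Vec d

/-- The squared Frobenius norm. -/
def frobSq {m d : ℕ} (x : Agg m d) : ℝ := ∑ i, ‖x i‖ ^ 2

/-- The average of the rows, `(1/m) 1ᵀ x`. -/
def avg {m d : ℕ} (x : Agg m d) : Vec d := (1 / (m : ℝ)) • ∑ i, x i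

/-- The squared consensus error `‖x - 1 x̄‖²` (Frobenius norm). -/
def consensusSq {m d : ℕ} (x : Agg m d) : ℝ := frobSq (fun i => x i - avg x)

/-- A global minimizer of `g`; an arbitrary point if there is none. -/
def argmin {X : Type*} [Nonempty X] (g : X → ℝ) : X :=
  Classical.epsilon fun z => ∀ y, g z ≤ g y

/-- One gossip communication step, `x ↦ W x`. -/
def gossip {m d : ℕ} (W : Matrix (Fin m) (Fin m) ℝ) (x : Agg m d) : Agg m d :=
  fun i => ∑ j, W i j • x j

/-- The second-largest singular value of `W` (singular values are indexed from `0`, in decreasing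
order, with multiplicity; it is `0` for a `1 × 1` matrix). -/
def lambda2 {m : ℕ} (W : Matrix (Fin m) (Fin m) ℝ) : ℝ :=
  (Matrix.toEuclideanLin W).singularValues 1

/-- The momentum parameter of FastMix. -/
def etaW {m : ℕ} (W : Matrix (Fin m) (Fin m) ℝ) : ℝ :=
  (1 - √(1 - lambda2 W ^ 2)) / (1 + √(1 - lambda2 W ^ 2))

/-- The pair `(x^k, x^{k-1})` of FastMix iterates, with `x^0 = x^{-1} = x` and
`x^{k+1} = (1 + η_w) W x^k - η_w x^{k-1}`. -/
def fastMixPair {m d : ℕ} (W : Matrix (Fin m) (Fin m) ℝ) (x : Agg m d) : ℕ → Agg m d × Agg m d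
  | 0 => (x, x)
  | k + 1 =>
    let y := fastMixPair W x k
    ((1 + etaW W) • gossip W y.1 - etaW W • y.2, y.1)

/-- The output `x^K` of FastMix; it uses `K` communication steps. -/
def fastMix {m d : ℕ} (W : Matrix (Fin m) (Fin m) ℝ) (x : Agg m d) (K : ℕ) : Agg m d :=
  (fastMixPair W x K).1

/-- The data of a decentralized composite problem: `m` agents, `n` component functions
`f i j` per agent, a common regularizer `r`, a gossip matrix `W`, constants `L` and `μ`, and the
common starting point of the agents. -/
structure Problem (m n d : ℕ) where
  f : Fin m → Fin n → Vec d → ℝ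
  r : Vec d → ℝ
  W : Matrix (Fin m) (Fin m) ℝ
  L : ℝ
  μ : ℝ
  xinit : Vec d

namespace Problem

variable {m n d : ℕ} (P : Problem m n d)

/-- `f_i = (1/n) ∑_j f_{i,j}`. -/
def fi (i : Fin m) (x : Vec d) : ℝ := (1 / (n : ℝ)) * ∑ j, P.f i j x

/-- `f = (1/m) ∑_i f_i`. -/
def fbar (x : Vec d) : ℝ := (1 / (m : ℝ)) * ∑ i, P.fi i x

/-- The objective `h = f + r`. -/
def h (x : Vec d) : ℝ := P.fbar x + P.r x

/-- The minimizer of the objective. -/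
def xstar : Vec d := argmin P.h

/-- The condition number. -/
def κ : ℝ := P.L / P.μ

/-- The step size `1 / (12 L)`. -/
def η : ℝ := 1 / (12 * P.L)

/-- The aggregated proximal operator `prox_{mη,R}` with `R(z) = (1/m) ∑_i r(z_i)`. -/
def proxAgg (x : Agg m d) : Agg m d :=
  argmin fun z : Agg m d =>
    (1 / (m : ℝ)) * ∑ i, P.r (z i) + 1 / (2 * (m : ℝ) * P.η) * frobSq (z - x)

/-- The standing assumptions. -/
structure Assumptions : Prop where
  m_pos : 0 < m
  n_pos : 0 < n
  L_pos : 0 < P.L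
  μ_pos : 0 < P.μ
  differentiable : ∀ i j, Differentiable ℝ (P.f i j)
  convex : ∀ i j, ConvexOn ℝ Set.univ (P.f i j)
  smooth : ∀ i j x y,
    P.f i j y - P.f i j x ≤ inner ℝ (gradient (P.f i j) x) (y - x) + P.L / 2 * ‖y - x‖ ^ 2
  strongly_convex : ∀ x y,
    inner ℝ (gradient P.fbar x) (y - x) + P.μ / 2 * ‖y - x‖ ^ 2 ≤ P.fbar y - P.fbar x
  r_convex : ConvexOn ℝ Set.univ P.r
  W_symm : P.W.IsSymm
  W_nonneg : P.W.PosSemidef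
  W_le_one : (1 - P.W).PosSemidef
  W_one : P.W.mulVec 1 = 1
  W_null : LinearMap.ker (1 - P.W).mulVecLin = Submodule.span ℝ {(1 : Fin m → ℝ)}

/-- The state of an algorithm at the beginning of iteration `t`. The memory `mem i` of agent `i` is
the table `φ_{i,·}^t` for PMGT-SAGA and the reference point `w_i^t` for PMGT-LSVRG. -/
structure State (m d : ℕ) (M : Type) where
  /-- `x^t` -/
  x : Agg m d
  /-- the memory of the local gradient estimators -/
  mem : Fin m → M
  /-- `s^{t-1}` -/
  sPrev : Agg m d
  /-- `v^{t-1}` -/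
  vPrev : Agg m d
  /-- the number of component gradients evaluated so far by each agent -/
  gradEvals : Fin m → ℕ
  /-- the number of communication steps performed so far -/
  comms : ℕ

/-- The initial state: equal starting points and `v^{-1} = s^{-1} = ∇F(x^0)`. Setting up the local
estimator costs `n` component gradients per agent. -/
def init {M : Type} (mem0 : M) : State m d M where
  x := fun _ => P.xinit
  mem := fun _ => mem0
  sPrev := fun _ => gradient P.fbar P.xinit
  vPrev := fun _ => gradient P.fbar P.xinit
  gradEvals := fun _ => n
  comms := 0

/-- One iteration of the PMGT-VR framework, given the new local gradient estimators `v = v^t`, the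
new memory, and the number of component gradients that each agent evaluates in the iteration. -/
def step {M : Type} (K : ℕ) (S : State m d M) (v : Agg m d) (mem' : Fin m → M)
    (cost : Fin m → ℕ) : State m d M :=
  let s := fastMix P.W (S.sPrev + v - S.vPrev) K
  { x := fastMix P.W (P.proxAgg (S.x - P.η • s)) K
    mem := mem'
    sPrev := s
    vPrev := v
    gradEvals := S.gradEvals + cost
    comms := S.comms + K + K }

/-- One iteration of PMGT-SAGA in which agent `i` picks the index `j i`. One new component gradient
is evaluated per agent. -/
def sagaStep (K : ℕ) (S : State m d (Fin n → Vec d)) (j : Fin m → Fin n) :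
    State m d (Fin n → Vec d) :=
  let φ' : Fin m → Fin n → Vec d := fun i => Function.update (S.mem i) (j i) (S.x i)
  P.step K S
    (fun i => gradient (P.f i (j i)) (φ' i (j i)) - gradient (P.f i (j i)) (S.mem i (j i))
      + (1 / (n : ℝ)) • ∑ k, gradient (P.f i k) (S.mem i k))
    φ' (fun _ => 1)

/-- The states of PMGT-SAGA along a sequence of picks. -/
def sagaState (K : ℕ) (j : ℕ → Fin m → Fin n) : ℕ → State m d (Fin n → Vec d)
  | 0 => P.init (fun _ => P.xinit)
  | t + 1 => P.sagaStep K (sagaState K j t) (j t)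

/-- One iteration of PMGT-LSVRG in which agent `i` picks the index `j i` and replaces its reference
point iff `c i` is true. Two component gradients are evaluated per agent, and `n` more to get the
full local gradient when the reference point is replaced. -/
def lsvrgStep (K : ℕ) (S : State m d (Vec d)) (j : Fin m → Fin n) (c : Fin m → Bool) :
    State m d (Vec d) :=
  P.step K S
    (fun i => gradient (P.f i (j i)) (S.x i) - gradient (P.f i (j i)) (S.mem i)
      + gradient (P.fi i) (S.mem i))
    (fun i => if c i then S.x i else S.mem i)
    (fun i => 2 + if c i then n else 0)

/-- The states of PMGT-LSVRG along a sequence of picks and coin flips. -/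
def lsvrgState (K : ℕ) (j : ℕ → Fin m → Fin n) (c : ℕ → Fin m → Bool) : ℕ → State m d (Vec d)
  | 0 => P.init P.xinit
  | t + 1 => P.lsvrgStep K (lsvrgState K j c t) (j t) (c t)

/-- The quantities of a run of one of the two algorithms that enter the convergence result. -/
structure Run (m d : ℕ) where
  /-- `x^t` -/
  x : ℕ → Agg m d
  /-- `s^t` -/
  s : ℕ → Agg m d
  /-- the gradient learning quantity `Δ^t` -/
  Δ : ℕ → ℝ
  /-- component gradients evaluated by each agent to produce `x^t` -/
  gradEvals : ℕ → Fin m → ℕ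
  /-- communication steps performed to produce `x^t` -/
  comms : ℕ → ℕ

/-- The run of PMGT-SAGA along a sequence of picks. -/
def sagaRun (K : ℕ) (j : ℕ → Fin m → Fin n) : Run m d where
  x t := (P.sagaState K j t).x
  s t := (P.sagaState K j (t + 1)).sPrev
  Δ t := 1 / ((m : ℝ) * n) * ∑ i, ∑ k,
    ‖gradient (P.f i k) ((P.sagaState K j t).mem i k) - gradient (P.f i k) P.xstar‖ ^ 2
  gradEvals t := (P.sagaState K j t).gradEvals
  comms t := (P.sagaState K j t).comms

/-- The run of PMGT-LSVRG along a sequence of picks and coin flips. -/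
def lsvrgRun (K : ℕ) (j : ℕ → Fin m → Fin n) (c : ℕ → Fin m → Bool) : Run m d where
  x t := (P.lsvrgState K j c t).x
  s t := (P.lsvrgState K j c (t + 1)).sPrev
  Δ t := 1 / ((m : ℝ) * n) * ∑ i, ∑ k,
    ‖gradient (P.f i k) ((P.lsvrgState K j c t).mem i) - gradient (P.f i k) P.xstar‖ ^ 2
  gradEvals t := (P.lsvrgState K j c t).gradEvals
  comms t := (P.lsvrgState K j c t).comms

/-- The Lyapunov function `V^t = ‖x̄^t - x*‖² + 4 n η² Δ^t`. -/
def V (R : Run m d) (t : ℕ) : ℝ :=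
  ‖avg (R.x t) - P.xstar‖ ^ 2 + 4 * (n : ℝ) * P.η ^ 2 * R.Δ t

/-- The vector `z^t` of consensus errors. -/
def z (R : Run m d) (t : ℕ) : EuclideanSpace ℝ (Fin 2) :=
  !₂[1 / (m : ℝ) * consensusSq (R.x t), P.η ^ 2 / (m : ℝ) * consensusSq (R.s t)]

/-- `R` is a random run of PMGT-SAGA with `K` communication steps per FastMix call: the picks are
uniform on `Fin n` and independent over all iterations and agents. -/
def IsSaga {Ω : Type*} [MeasurableSpace Ω] (Pr : Measure Ω) (K : ℕ) (R : Ω → Run m d) : Prop :=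
  ∃ J : ℕ × Fin m → Ω → Fin n,
    (∀ q, Measurable (J q)) ∧
    (∀ q k, Pr.real {ω | J q ω = k} = 1 / (n : ℝ)) ∧
    iIndepFun J Pr ∧
    ∀ ω, R ω = P.sagaRun K (fun t i => J (t, i) ω)

/-- `R` is a random run of PMGT-LSVRG with replacement probability `p` and `K` communication steps
per FastMix call: the picks are uniform on `Fin n`, the coins are Bernoulli with parameter `p`, and
all picks and coins are independent. -/
def IsLsvrg {Ω : Type*} [MeasurableSpace Ω] (Pr : Measure Ω) (p : ℝ) (K : ℕ) (R : Ω → Run m d) :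
    Prop :=
  ∃ (J : ℕ × Fin m → Ω → Fin n) (c : ℕ × Fin m → Ω → Bool),
    (∀ q, Measurable (J q)) ∧ (∀ q, Measurable (c q)) ∧
    (∀ q k, Pr.real {ω | J q ω = k} = 1 / (n : ℝ)) ∧
    (∀ q, Pr.real {ω | c q ω = true} = p) ∧
    (∀ q, IndepFun (J q) (c q) Pr) ∧
    iIndepFun (fun q ω => (J q ω, c q ω)) Pr ∧
    ∀ ω, R ω = P.lsvrgRun K (fun t i => J (t, i) ω) (fun t i => c (t, i) ω)

end Problem

end PMGT

end

/-! The analysis sees only two facts about an agent's random pick: it selects a component uniformly,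
and each reference point is replaced by the current iterate with probability `1/n`. `Estimator`
records these facts, the convergence theory is carried out for it, and PMGT-SAGA and PMGT-LSVRG are
the instances `sagaEst` and `lsvrgEst`.

Communication: along an eigenvector of `W`, FastMix is a scalar two-term recursion solved by
Chebyshev polynomials. Orthogonally to `1` it decays like `q^K` times a factor linear in `K`, with
`q ≤ exp(-(7/5)√(1-λ₂))`. The surplus of `7/5` over `1` absorbs that factor, so `K` rounds shrink
the consensus error by the full factor `ρ` (`consensusSq_fastMix_le`).

Optimization: FastMix preserves averages and gradient tracking keeps `s̄ = v̄`, so `x̄` nearly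
performs a centralized proximal variance-reduced step. Firm nonexpansiveness of the prox limits the
price of averaging after it to half a consensus error (`norm_avg_sq_le_of_firm`). With `δ =
min(1/(24κ), 1/(4n))`, and `X`, `Y` the expected scaled consensus errors of `x^t`, `s^t`, smoothness
and strong convexity give `E V^{t+1} ≤ (1-2δ) E V^t + (3/4) Y + (19/12) X` (`lyap_estStep_le`,
`mean_sum_wt_driftTerm_le`). The errors `X`, `Y` obey recursions carrying a factor `σ = ρ² ≤
(δ/41)²` and fed by `V` through the variance and the drift of the local gradients.

Coupling: one of the two `δ` pays for the consensus errors, so `V + Y + 2X` contracts by `1-δ`.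
Inserting the resulting bound for `V` into the recursions of `X` and `Y` shows that these are
smaller than `V`'s bound by a factor of order `δ²`, up to a transient `2^{-t}`
(`coupled_recursion_bound`). The complexity claims follow with about `δ⁻¹ log(4/ε²)` iterations. -/

noncomputable section
namespace PMGT

/-! ### Chebyshev analysis of the scalar FastMix recursion -/

/-- The Chebyshev pair `(T_k(c), U_{k-1}(c))`. -/
def chebPair (c : ℝ) : ℕ → ℝ × ℝ
  | 0 => (1, 0)
  | k + 1 =>
    (c * (chebPair c k).1 - (1 - c ^ 2) * (chebPair c k).2, c * (chebPair c k).2 + (chebPair c k).1)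

/-- For `c = cos θ` the pair is `(cos kθ, sin kθ / sin θ)`, and this is Pythagoras. -/
lemma chebPair_pell (c : ℝ) (k : ℕ) :
    (chebPair c k).1 ^ 2 + (1 - c ^ 2) * (chebPair c k).2 ^ 2 = 1 := by
  induction k with
  | zero => simp [chebPair]
  | succ k ih => simp only [chebPair]; linear_combination ih

lemma abs_chebPair_fst_le {c : ℝ} (h0 : 0 ≤ c) (h1 : c ≤ 1) (k : ℕ) : |(chebPair c k).1| ≤ 1 := by
  rw [← sq_le_one_iff_abs_le_one]
  have := chebPair_pell c k
  nlinarith [mul_nonneg (show (0 : ℝ) ≤ 1 - c ^ 2 by nlinarith) (sq_nonneg (chebPair c k).2)]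

lemma abs_chebPair_snd_le {c : ℝ} (h0 : 0 ≤ c) (h1 : c ≤ 1) (k : ℕ) : |(chebPair c k).2| ≤ k := by
  induction k with
  | zero => simp [chebPair]
  | succ k ih =>
    simp only [chebPair]
    push_cast
    refine (abs_add_le _ _).trans (add_le_add ?_ (abs_chebPair_fst_le h0 h1 k))
    rw [abs_mul, abs_of_nonneg h0]
    nlinarith [abs_nonneg (chebPair c k).2]

/-- The scalar FastMix recursion `a_{k+1} = (1 + η) w a_k - η a_{k-1}`, `a_0 = a_{-1} = 1`. -/
def mixPair (η w : ℝ) : ℕ → ℝ × ℝ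
  | 0 => (1, 1)
  | k + 1 => ((1 + η) * w * (mixPair η w k).1 - η * (mixPair η w k).2, (mixPair η w k).1)

/-- For `c = cos θ` the characteristic roots are `q e^{±iθ}`. The second identity is the first one
step back, with `T_{k-1}` and `U_{k-2}` expressed through `T_k` and `U_{k-1}`; the factor `q` on its
left avoids a negative power and keeps `q = 0` admissible. -/
lemma mixPair_eq_chebPair {η w q c : ℝ} (hη : η = q ^ 2) (hw : (1 + η) * w = 2 * q * c) (k : ℕ) :
    (mixPair η w k).1 = q ^ k * ((chebPair c k).1 + (c - q) * (chebPair c k).2) ∧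
    q * (mixPair η w k).2 = q ^ k *
      (c * (chebPair c k).1 + (1 - c ^ 2) * (chebPair c k).2 +
        (c - q) * (c * (chebPair c k).2 - (chebPair c k).1)) := by
  induction k with
  | zero => simp [mixPair, chebPair]
  | succ k ih =>
    obtain ⟨h1, h2⟩ := ih
    simp only [mixPair, chebPair]
    have h2' : η * (mixPair η w k).2 = q * (q * (mixPair η w k).2) := by rw [hη]; ring
    rw [hw, h2', h2, h1]
    constructor <;> ring

/-- If `q ≤ c`, the bound `|U_{k-1}| ≤ k` gives the linear term. If `c < q`, the second term is at
most `1`, because `(1-c)² U² ≤ (1-c²) U² ≤ 1` by the Pell identity. -/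
lemma abs_mixPair_le {η w q c : ℝ} (hη : η = q ^ 2) (hw : (1 + η) * w = 2 * q * c)
    (hq0 : 0 ≤ q) (hq1 : q ≤ 1) (hc0 : 0 ≤ c) (hc1 : c ≤ 1) (k : ℕ) :
    |(mixPair η w k).1| ≤ q ^ k * (2 + (1 - q) * k) := by
  rw [(mixPair_eq_chebPair hη hw k).1, abs_mul, abs_of_nonneg (pow_nonneg hq0 k)]
  refine mul_le_mul_of_nonneg_left ?_ (pow_nonneg hq0 k)
  refine (abs_add_le _ _).trans ?_
  have hT := abs_chebPair_fst_le hc0 hc1 k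
  have hU := abs_chebPair_snd_le hc0 hc1 k
  have hP := chebPair_pell c k
  have hk : (0 : ℝ) ≤ k := Nat.cast_nonneg k
  rw [abs_mul]
  rcases le_total q c with h | h
  · rw [abs_of_nonneg (sub_nonneg.2 h)]
    have : (c - q) * |(chebPair c k).2| ≤ (1 - q) * k :=
      mul_le_mul (by linarith) hU (abs_nonneg _) (by linarith)
    linarith
  · rw [abs_of_nonpos (sub_nonpos.2 h)]
    have h1 : -(c - q) * |(chebPair c k).2| ≤ (1 - c) * |(chebPair c k).2| :=
      mul_le_mul_of_nonneg_right (by linarith) (abs_nonneg _)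
    have h2 : (1 - c) * |(chebPair c k).2| ≤ 1 := by
      refine abs_le_one_iff_mul_self_le_one.2 ?_ |> le_of_abs_le
      have : |(chebPair c k).2| ^ 2 = (chebPair c k).2 ^ 2 := sq_abs _
      nlinarith [sq_nonneg (chebPair c k).1, mul_nonneg (mul_nonneg hc0 (sub_nonneg.2 hc1))
        (sq_nonneg (chebPair c k).2)]
    have h3 : 0 ≤ (1 - q) * k := mul_nonneg (by linarith) hk
    linarith

lemma atanh_lower {s : ℝ} (h0 : 0 ≤ s) (h1 : s < 1) :
    2 * (s + s ^ 3 / 3 + s ^ 5 / 5) ≤ Real.log (1 + s) - Real.log (1 - s) := by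
  have h := Real.hasSum_log_sub_log_of_abs_lt_one (x := s) (by rwa [abs_of_nonneg h0])
  have := sum_le_hasSum (Finset.range 3) (fun i _ => by positivity) h
  refine le_trans (le_of_eq ?_) this
  simp [Finset.sum_range_succ]
  ring

/-- The asymptotic rate `λ / (1 + √(1 - λ²))` of FastMix. -/
lemma rate_le_exp {l : ℝ} (h0 : 0 ≤ l) (h1 : l < 1) :
    l / (1 + √(1 - l ^ 2)) ≤ Real.exp (-(7 / 5) * √(1 - l)) := by
  rcases h0.eq_or_lt with rfl | h0
  · simpa using (Real.exp_pos _).le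
  set u := √(1 - l) with hu
  set s := √(1 - l ^ 2) with hs
  have hu2 : u ^ 2 = 1 - l := Real.sq_sqrt (by linarith)
  have hs2 : s ^ 2 = 1 - l ^ 2 := Real.sq_sqrt (by nlinarith)
  have hu0 : 0 ≤ u := Real.sqrt_nonneg _
  have hs0 : 0 ≤ s := Real.sqrt_nonneg _
  have hs1 : s < 1 := by nlinarith
  have hu1 : u < 1 := by nlinarith
  -- The rate is `exp(-artanh s)`, so `artanh s` must dominate `(7/5)√(1-l)`. Three terms of its
  -- series suffice. As `l → 1` the ratio tends to `√2`, and `7/5` is a rational just below; `e3` is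
  -- where the bound `2 = √2²` appears.
  have key : 7 / 5 * u ≤ s + s ^ 3 / 3 + s ^ 5 / 5 := by
    refine abs_le_of_sq_le_sq' ?_ (by positivity) |>.2
    set a := u ^ 2 with ha
    have hsa : s ^ 2 = a * (2 - a) := by rw [hs2, hu2]; ring
    have ha0 : 0 ≤ a := sq_nonneg _
    have ha1 : a ≤ 1 := by nlinarith
    set b := a * (2 - a) with hb
    have hb0 : 0 ≤ b := mul_nonneg ha0 (by linarith)
    have hb1 : b ≤ 1 := by nlinarith
    have e1 : (s + s ^ 3 / 3 + s ^ 5 / 5) ^ 2 = s ^ 2 * (1 + s ^ 2 / 3 + (s ^ 2) ^ 2 / 5) ^ 2 := by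
      ring
    rw [e1, hsa, mul_pow, ← ha]
    have e2 : 1 + 2 * b / 3 + b ^ 2 / 2 ≤ (1 + b / 3 + b ^ 2 / 5) ^ 2 := by
      nlinarith [pow_nonneg hb0 2, pow_nonneg hb0 3, pow_nonneg hb0 4]
    have e3 : 2 ≤ (2 - a) * (1 + 2 * b / 3 + b ^ 2 / 2) := by
      have : a ≤ b := by nlinarith
      have h4 : 1 + a * (2 - a) * (2/3) + b ^ 2 / 2 ≥ 1 + a * (2 - a) * (2/3) + a ^ 2 / 2 := by
        nlinarith
      have : (2 - a) * (1 + a * (2 - a) * (2/3) + a ^ 2 / 2) - 2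
          = a * (5 / 3 - 5 / 3 * a + a ^ 2 / 6) := by ring
      have h5 : 0 ≤ a * (5 / 3 - 5 / 3 * a + a ^ 2 / 6) := mul_nonneg ha0 (by nlinarith)
      nlinarith
    calc (7 / 5) ^ 2 * a ≤ a * 2 := by nlinarith
      _ ≤ a * ((2 - a) * (1 + 2 * b / 3 + b ^ 2 / 2)) := mul_le_mul_of_nonneg_left e3 ha0
      _ = b * (1 + 2 * b / 3 + b ^ 2 / 2) := by rw [hb]; ring
      _ ≤ b * (1 + b / 3 + b ^ 2 / 5) ^ 2 := mul_le_mul_of_nonneg_left e2 hb0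
  have hlog := atanh_lower hs0 hs1
  -- From `(1+s)(1-s) = l²` one gets `log (l/(1+s)) = -(log (1+s) - log (1-s))/2`.
  have hl2 : 2 * Real.log l = Real.log (1 + s) + Real.log (1 - s) := by
    rw [← Real.log_mul (by linarith) (by linarith), show (1 + s) * (1 - s) = l ^ 2 by nlinarith,
      Real.log_pow]; norm_num
  rw [← Real.log_le_iff_le_exp (by positivity), Real.log_div h0.ne' (by linarith)]
  linarith

lemma two_add_mul_exp_neg_antitone {x y : ℝ} (hx : 0 ≤ x) (hxy : x ≤ y) :
    (2 + y) * Real.exp (-y) ≤ (2 + x) * Real.exp (-x) := by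
  have h : Real.exp (-x) = Real.exp (-y) * Real.exp (y - x) := by rw [← Real.exp_add]; ring_nf
  rw [h]
  have := Real.add_one_le_exp (y - x)
  have h2 : 2 + y ≤ (2 + x) * Real.exp (y - x) := by nlinarith
  nlinarith [Real.exp_pos (-y)]

/-- `984 = 41 · 24` is the least possible value of `1/ρ` once `κ ≥ 1`. -/
lemma exp_le_984 : Real.exp (55 / 8) ≤ 984 := by
  have h : Real.exp (55 / 8) ^ 8 ≤ 984 ^ 8 := by
    rw [← Real.exp_nat_mul, show ((8 : ℕ) : ℝ) * (55 / 8) = ((55 : ℕ) : ℝ) * 1 by norm_num,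
      Real.exp_nat_mul]
    calc Real.exp 1 ^ 55 ≤ 2.7182818286 ^ 55 :=
          pow_le_pow_left₀ (Real.exp_pos _).le Real.exp_one_lt_d9.le _
      _ ≤ 984 ^ 8 := by norm_num
  exact le_of_pow_le_pow_left₀ (by norm_num) (by norm_num) h

lemma log_one_div_ge {ρ : ℝ} (h0 : 0 < ρ) (h1 : ρ ≤ 1 / 984) : 55 / 8 ≤ Real.log (1 / ρ) := by
  rw [Real.le_log_iff_exp_le (by positivity)]
  refine exp_le_984.trans ?_
  rw [le_div_iff₀ h0]; linarith

/-- This is `2 + (7/5) l ≤ exp((2/5) l)`: the surplus `2/5` in the exponent pays for the linear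
prefactor as soon as `l ≥ 55/8`. -/
lemma two_add_mul_exp_le {l : ℝ} (hl : 55 / 8 ≤ l) :
    (2 + 7 / 5 * l) * Real.exp (-(7 / 5 * l)) ≤ Real.exp (-l) := by
  have h : Real.exp (-l) = Real.exp (-(7 / 5 * l)) * Real.exp (2 / 5 * l) := by
    rw [← Real.exp_add]; ring_nf
  rw [h, mul_comm]
  refine mul_le_mul_of_nonneg_left ?_ (Real.exp_pos _).le
  obtain ⟨x, hx⟩ : ∃ x, x = 2 / 5 * l := ⟨_, rfl⟩
  have hx1 : 11 / 4 ≤ x := by linarith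
  have := Real.sum_le_exp_of_nonneg (x := x) (by linarith) 5
  simp only [Finset.sum_range_succ, Finset.sum_range_zero, Nat.factorial] at this
  norm_num at this
  rw [← hx]
  refine le_trans ?_ this
  have : l = 5 / 2 * x := by linarith
  rw [this]
  obtain ⟨y, rfl⟩ : ∃ y, x = 11 / 4 + y := ⟨x - 11 / 4, by ring⟩
  have hy : 0 ≤ y := by linarith
  nlinarith [pow_nonneg hy 2, pow_nonneg hy 3, pow_nonneg hy 4]

/-- The contraction factor of FastMix on the eigenspaces orthogonal to the consensus space. -/
lemma abs_mixPair_le_of_rounds {l w ρ : ℝ} {K : ℕ} (hl0 : 0 ≤ l) (hl1 : l < 1) (hw0 : 0 ≤ w)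
    (hwl : w ≤ l) (hρ0 : 0 < ρ) (hρ : ρ ≤ 1 / 984)
    (hK : 1 / √(1 - l) * Real.log (1 / ρ) ≤ K) :
    |(mixPair ((1 - √(1 - l ^ 2)) / (1 + √(1 - l ^ 2))) w K).1| ≤ ρ := by
  set s := √(1 - l ^ 2) with hs
  have hs2 : s ^ 2 = 1 - l ^ 2 := Real.sq_sqrt (by nlinarith)
  have hs0 : 0 ≤ s := Real.sqrt_nonneg _
  set q := l / (1 + s) with hq
  have hq0 : 0 ≤ q := by positivity
  have hq1 : q < 1 := by rw [hq, div_lt_one (by linarith)]; linarith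
  have hη : (1 - s) / (1 + s) = q ^ 2 := by
    rw [hq, div_pow, div_eq_div_iff (by positivity) (by positivity)]
    linear_combination (-(1 + s)) * hs2
  have hη1 : 1 + (1 - s) / (1 + s) = 2 / (1 + s) := by field_simp; ring
  have hL := log_one_div_ge hρ0 hρ
  have hu : 0 < √(1 - l) := Real.sqrt_pos.2 (by linarith)
  have huK : Real.log (1 / ρ) ≤ √(1 - l) * K := by
    rw [one_div, inv_mul_le_iff₀ hu] at hK; linarith
  have hK0 : K ≠ 0 := by
    rintro rfl
    simp at huK; simp at hL; linarith
  -- For `l = 0` the quotient `w / l` is `0` by the division convention, which is the right value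
  -- since then `w = 0`.
  have hw : (1 + (1 - s) / (1 + s)) * w = 2 * q * (w / l) := by
    rw [hη1, hq]
    rcases hl0.eq_or_lt with h | h
    · have : w = 0 := by linarith
      simp [this]
    · field_simp
  have hc0 : 0 ≤ w / l := by positivity
  have hc1 : w / l ≤ 1 := div_le_one_of_le₀ hwl hl0
  refine (abs_mixPair_le hη hw hq0 hq1.le hc0 hc1 K).trans ?_
  -- When `q = 0` the logarithm below is unusable, but `q ^ K` vanishes because `K ≠ 0`.
  rcases hq0.eq_or_lt with h | h
  · rw [← h, zero_pow hK0, zero_mul]; exact hρ0.le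
  set y := -Real.log q with hy
  have hqe : q = Real.exp (-y) := by rw [hy, neg_neg, Real.exp_log h]
  have hyu : 7 / 5 * √(1 - l) ≤ y := by
    have := rate_le_exp hl0 hl1
    rw [← hs, ← hq, hqe, Real.exp_le_exp] at this
    linarith
  have h1q : 1 - q ≤ y := by
    have := Real.add_one_le_exp (-y)
    rw [hqe]; linarith
  have hKp : (0 : ℝ) ≤ K := Nat.cast_nonneg K
  have hbig : 7 / 5 * Real.log (1 / ρ) ≤ y * K := by nlinarith
  calc q ^ K * (2 + (1 - q) * K) ≤ q ^ K * (2 + y * K) := by gcongr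
    _ = (2 + y * K) * Real.exp (-(y * K)) := by
        rw [hqe, ← Real.exp_nat_mul, mul_comm]; ring_nf
    _ ≤ (2 + 7 / 5 * Real.log (1 / ρ)) * Real.exp (-(7 / 5 * Real.log (1 / ρ))) :=
        two_add_mul_exp_neg_antitone (by linarith) hbig
    _ ≤ Real.exp (-Real.log (1 / ρ)) := two_add_mul_exp_le hL
    _ = ρ := by rw [one_div, Real.log_inv, neg_neg, Real.exp_log hρ0]

/-! ### Spectral theory of the gossip matrix -/

/-- A nonnegative symmetric square root of `s²` on an eigenvector: if `T` is positive and
`T² v = s² v` with `s ≥ 0`, then `T v = s v`. -/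
lemma apply_eq_smul_of_sq {E : Type*} [NormedAddCommGroup E] [InnerProductSpace ℝ E]
    {T : E →ₗ[ℝ] E} (hT : T.IsSymmetric) (hpos : ∀ v, 0 ≤ inner ℝ v (T v)) {v : E} {s : ℝ}
    (hs : 0 ≤ s) (h : T (T v) = (s ^ 2) • v) : T v = s • v := by
  rcases hs.eq_or_lt with rfl | hs
  · have h0 : inner ℝ (T v) (T v) = 0 := by rw [hT, h]; simp
    simpa using h0
  · have he : T (T v - s • v) = -s • (T v - s • v) := by
      rw [map_sub, h, map_smul]; module
    have h1 := hpos (T v - s • v)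
    rw [he, inner_smul_right, real_inner_self_eq_norm_sq] at h1
    have h2 : ‖T v - s • v‖ ^ 2 = 0 :=
      le_antisymm (by nlinarith [sq_nonneg ‖T v - s • v‖]) (sq_nonneg _)
    exact sub_eq_zero.1 (norm_eq_zero.1 (pow_eq_zero_iff (two_ne_zero) |>.1 h2))

/-- Spectral decomposition of a gossip matrix relative to the consensus direction. -/
lemma exists_gossip_basis {m : ℕ} (hm : 0 < m) {W : Matrix (Fin m) (Fin m) ℝ}
    (hpos : W.PosSemidef) (hle : (1 - W).PosSemidef)
    (hone : W.mulVec 1 = 1)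
    (hnull : LinearMap.ker (1 - W).mulVecLin = Submodule.span ℝ {(1 : Fin m → ℝ)}) :
    lambda2 W < 1 ∧ 0 ≤ lambda2 W ∧
    ∃ (b : OrthonormalBasis (Fin m) ℝ (EuclideanSpace ℝ (Fin m))) (s : Fin m → ℝ),
      (∀ k y, inner ℝ (b k) (Matrix.toEuclideanLin W y) = s k * inner ℝ (b k) y) ∧
      (∀ k, k ≠ ⟨0, hm⟩ → 0 ≤ s k ∧ s k ≤ lambda2 W ∧
        inner ℝ (b k) (WithLp.toLp 2 (1 : Fin m → ℝ)) = 0) ∧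
      (∀ y, inner ℝ (WithLp.toLp 2 (1 : Fin m → ℝ)) y = 0 → inner ℝ (b ⟨0, hm⟩) y = 0) := by
  set T := Matrix.toEuclideanLin W with hT
  set o : EuclideanSpace ℝ (Fin m) := WithLp.toLp 2 (1 : Fin m → ℝ) with ho
  have hTp : T.IsPositive := Matrix.isPositive_toEuclideanLin_iff.2 hpos
  have hTs : T.IsSymmetric := hTp.isSymmetric
  have hTpos : ∀ v, 0 ≤ inner ℝ v (T v) := fun v => by
    simpa using hTp.re_inner_nonneg_right v
  have hTo : T o = o := by
    rw [hT, ho]; apply WithLp.ofLp_injective; simpa using hone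
  have hadj : LinearMap.adjoint T = T := LinearMap.isSelfAdjoint_iff'.1 hTp.isSelfAdjoint
  have hrank : Module.finrank ℝ (EuclideanSpace ℝ (Fin m)) = m := by simp
  set b := T.isSymmetric_adjoint_comp_self.eigenvectorBasis hrank with hb
  set s : Fin m → ℝ := fun k => T.singularValues k with hs
  have hs0 : ∀ k, 0 ≤ s k := fun k => T.singularValues_nonneg k
  have hTb : ∀ k, T (b k) = s k • b k := by
    intro k
    refine apply_eq_smul_of_sq hTs hTpos (hs0 k) ?_
    have := T.isSymmetric_adjoint_comp_self.apply_eigenvectorBasis hrank k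
    rw [← T.sq_singularValues_fin hrank k, ← hb, LinearMap.comp_apply, hadj] at this
    exact this
  have hbT : ∀ k y, inner ℝ (b k) (T y) = s k * inner ℝ (b k) y := by
    intro k y
    rw [← hTs, hTb, inner_smul_left]; simp
  have hno : ∀ k, ‖b k‖ = 1 := fun k => b.orthonormal.1 k
  have hs1 : ∀ k, s k ≤ 1 := by
    intro k
    have h1 := (Matrix.isPositive_toEuclideanLin_iff.2 hle).re_inner_nonneg_right (b k)
    have h2 : Matrix.toEuclideanLin (1 - W) (b k) = b k - T (b k) := by
      rw [hT, map_sub, LinearMap.sub_apply]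
      congr 1
      apply WithLp.ofLp_injective; simp
    rw [h2, hTb, inner_sub_right, inner_smul_right, real_inner_self_eq_norm_sq, hno] at h1
    simp at h1; linarith
  have hperp : ∀ k, s k ≠ 1 → inner ℝ (b k) o = 0 := by
    intro k hk
    have := hbT k o
    rw [hTo] at this
    have h2 : (s k - 1) * inner ℝ (b k) o = 0 := by linarith
    exact (mul_eq_zero.1 h2).resolve_left (sub_ne_zero.2 hk)
  have hpar : ∀ k, s k = 1 → ∃ a : ℝ, b k = a • o := by
    intro k hk
    have h1 : (b k).ofLp ∈ LinearMap.ker (1 - W).mulVecLin := by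
      rw [LinearMap.mem_ker, Matrix.mulVecLin_apply, Matrix.sub_mulVec, Matrix.one_mulVec]
      have h3 : T (b k) = b k := by rw [hTb, hk, one_smul]
      have := congrArg WithLp.ofLp h3
      rw [hT] at this
      simp at this
      rw [this, sub_self]
    rw [hnull, Submodule.mem_span_singleton] at h1
    obtain ⟨a, ha⟩ := h1
    refine ⟨a, ?_⟩
    apply WithLp.ofLp_injective
    rw [← ha]; rfl
  have ho0 : o ≠ 0 := by
    intro h
    have := congrArg (fun y : EuclideanSpace ℝ (Fin m) => y ⟨0, hm⟩) h
    simp [ho] at this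
  have hlt : lambda2 W < 1 := by
    unfold lambda2
    by_cases h2 : 1 < m
    -- If `s_1 = 1`, then `s_0 = 1` by monotonicity, and two orthonormal vectors would both be
    -- multiples of `1`.
    · refine lt_of_le_of_ne (hs1 ⟨1, h2⟩) fun h => ?_
      have e1 : s ⟨1, h2⟩ = 1 := h
      have e0 : s ⟨0, hm⟩ = 1 := by
        refine le_antisymm (hs1 _) ?_
        rw [← e1]; exact T.singularValues_antitone (by norm_num)
      obtain ⟨a, ha⟩ := hpar _ e0
      obtain ⟨c, hc⟩ := hpar _ e1
      have h01 : inner ℝ (b ⟨0, hm⟩) (b ⟨1, h2⟩) = 0 := b.orthonormal.2 (by simp)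
      rw [ha, hc, inner_smul_left, inner_smul_right, real_inner_self_eq_norm_sq] at h01
      have n0 := hno ⟨0, hm⟩
      have n1 := hno ⟨1, h2⟩
      rw [ha, norm_smul] at n0
      rw [hc, norm_smul] at n1
      have : (‖o‖ : ℝ) ≠ 0 := norm_ne_zero_iff.2 ho0
      simp [this] at h01
      rcases h01 with h | h <;> simp [h] at n0 n1
    · rw [T.singularValues_of_finrank_le (by rw [hrank]; omega)]; norm_num
  have hl : ∀ k, k ≠ ⟨0, hm⟩ → s k ≤ lambda2 W := by
    intro k hk
    refine T.singularValues_antitone ?_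
    rw [Nat.one_le_iff_ne_zero]
    intro h; exact hk (Fin.ext h)
  have hk1 : ∀ k, k ≠ ⟨0, hm⟩ → inner ℝ (b k) o = 0 := fun k hk =>
    hperp k ((hl k hk).trans_lt hlt).ne
  refine ⟨hlt, T.singularValues_nonneg 1, b, s, hbT, fun k hk => ⟨hs0 k, hl k hk, hk1 k hk⟩, ?_⟩
  intro y hy
  -- The vector `1` has only its `b_0` coordinate, so orthogonality to `1` and to `b_0` coincide.
  have hsum : ∀ z, inner ℝ o z = inner ℝ o (b ⟨0, hm⟩) * inner ℝ (b ⟨0, hm⟩) z := by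
    intro z
    rw [← b.sum_inner_mul_inner o z, Finset.sum_eq_single ⟨0, hm⟩]
    · intro k _ hk
      rw [real_inner_comm, hk1 k hk, zero_mul]
    · simp
  have h1 := hsum y
  have h2 := hsum o
  rw [hy] at h1
  refine (mul_eq_zero.1 h1.symm).resolve_left fun h => ?_
  rw [h, zero_mul] at h2
  exact ho0 (inner_self_eq_zero.1 h2)

/-! ### FastMix on aggregated variables -/

section Columns
variable {m d : ℕ}

/-- The `c`-th column of an aggregated variable. -/
def col (x : Agg m d) (c : Fin d) : EuclideanSpace ℝ (Fin m) := WithLp.toLp 2 fun i => x i c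

lemma frobSq_eq_sum_col (x : Agg m d) : frobSq x = ∑ c, ‖col x c‖ ^ 2 := by
  simp only [frobSq, EuclideanSpace.norm_sq_eq, col]
  exact Finset.sum_comm

lemma col_gossip (W : Matrix (Fin m) (Fin m) ℝ) (x : Agg m d) (c : Fin d) :
    col (gossip W x) c = Matrix.toEuclideanLin W (col x c) := by
  ext i
  simp [col, gossip, Matrix.mulVec, dotProduct]

lemma avg_add (x y : Agg m d) : avg (x + y) = avg x + avg y := by
  simp [avg, Finset.sum_add_distrib]

lemma avg_sub (x y : Agg m d) : avg (x - y) = avg x - avg y := by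
  simp [avg, Finset.sum_sub_distrib, smul_sub]

lemma avg_smul (a : ℝ) (x : Agg m d) : avg (a • x) = a • avg x := by
  simp [avg, ← Finset.smul_sum, smul_comm a]

lemma avg_gossip {W : Matrix (Fin m) (Fin m) ℝ} (hs : W.IsSymm) (hone : W.mulVec 1 = 1)
    (x : Agg m d) : avg (gossip W x) = avg x := by
  unfold avg gossip
  congr 1
  rw [Finset.sum_comm]
  refine Finset.sum_congr rfl fun j _ => ?_
  rw [← Finset.sum_smul]
  have h := congrFun hone j
  simp only [Matrix.mulVec, dotProduct, Pi.one_apply, mul_one] at h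
  have : ∑ i, W i j = 1 := by
    rw [← h]; exact Finset.sum_congr rfl fun i _ => hs.apply j i
  rw [this, one_smul]

lemma avg_fastMixPair {W : Matrix (Fin m) (Fin m) ℝ} (hs : W.IsSymm) (hone : W.mulVec 1 = 1)
    (x : Agg m d) (k : ℕ) :
    avg (fastMixPair W x k).1 = avg x ∧ avg (fastMixPair W x k).2 = avg x := by
  induction k with
  | zero => exact ⟨rfl, rfl⟩
  | succ k ih =>
    refine ⟨?_, ih.1⟩
    simp only [fastMixPair]
    rw [avg_sub, avg_smul, avg_smul, avg_gossip hs hone, ih.1, ih.2]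
    module

lemma avg_fastMix {W : Matrix (Fin m) (Fin m) ℝ} (hs : W.IsSymm) (hone : W.mulVec 1 = 1)
    (x : Agg m d) (k : ℕ) : avg (fastMix W x k) = avg x :=
  (avg_fastMixPair hs hone x k).1

/-- In an eigendirection the matrix recursion decouples, column by column, into the scalar one. -/
lemma inner_col_fastMixPair {W : Matrix (Fin m) (Fin m) ℝ} {b : EuclideanSpace ℝ (Fin m)} {s : ℝ}
    (hb : ∀ y, inner ℝ b (Matrix.toEuclideanLin W y) = s * inner ℝ b y)
    (x : Agg m d) (c : Fin d) (k : ℕ) :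
    inner ℝ b (col (fastMixPair W x k).1 c) = (mixPair (etaW W) s k).1 * inner ℝ b (col x c) ∧
    inner ℝ b (col (fastMixPair W x k).2 c) = (mixPair (etaW W) s k).2 * inner ℝ b (col x c) := by
  induction k with
  | zero => simp [fastMixPair, mixPair]
  | succ k ih =>
    refine ⟨?_, ih.1⟩
    have hc : col (fastMixPair W x (k + 1)).1 c = (1 + etaW W) • col (gossip W (fastMixPair W x k).1) c
        - etaW W • col (fastMixPair W x k).2 c := by
      ext i; simp [col, fastMixPair]
    rw [hc, inner_sub_right, inner_smul_right, inner_smul_right, col_gossip, hb, ih.1, ih.2]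
    simp only [mixPair]; ring

lemma col_sub_avg (x : Agg m d) (c : Fin d) :
    col (fun i => x i - avg x) c = col x c - (avg x c) • WithLp.toLp 2 (1 : Fin m → ℝ) := by
  ext i; simp [col]

lemma inner_one_col_sub_avg (hm : 0 < m) (x : Agg m d) (c : Fin d) :
    inner ℝ (WithLp.toLp 2 (1 : Fin m → ℝ)) (col (fun i => x i - avg x) c) = 0 := by
  have : (m : ℝ) ≠ 0 := by positivity
  simp [col, avg, PiLp.inner_apply]
  field_simp
  simp

/-- `K` rounds of FastMix contract the consensus error by the factor `ρ`. -/
theorem consensusSq_fastMix_le (hm : 0 < m) {W : Matrix (Fin m) (Fin m) ℝ}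
    (hpos : W.PosSemidef) (hle : (1 - W).PosSemidef) (hone : W.mulVec 1 = 1)
    (hnull : LinearMap.ker (1 - W).mulVecLin = Submodule.span ℝ {(1 : Fin m → ℝ)})
    {ρ : ℝ} (hρ0 : 0 < ρ) (hρ : ρ ≤ 1 / 984) {K : ℕ}
    (hK : 1 / √(1 - lambda2 W) * Real.log (1 / ρ) ≤ K) (x : Agg m d) :
    consensusSq (fastMix W x K) ≤ ρ ^ 2 * consensusSq x := by
  obtain ⟨hl1, hl0, b, s, hb, hbk, hb0⟩ := exists_gossip_basis hm hpos hle hone hnull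
  unfold consensusSq
  rw [frobSq_eq_sum_col, frobSq_eq_sum_col, Finset.mul_sum]
  refine Finset.sum_le_sum fun c _ => ?_
  rw [← b.sum_sq_inner_right, ← b.sum_sq_inner_right, Finset.mul_sum]
  refine Finset.sum_le_sum fun k _ => ?_
  -- The consensus direction carries no error on either side. In the others, subtracting the average
  -- changes nothing and FastMix multiplies the coordinate by a scalar of modulus at most `ρ`.
  by_cases hk : k = ⟨0, hm⟩
  · rw [hk, hb0 _ (inner_one_col_sub_avg hm _ c), hb0 _ (inner_one_col_sub_avg hm _ c)]
    simp
  · obtain ⟨h0, h1, h2⟩ := hbk k hk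
    rw [col_sub_avg, col_sub_avg, inner_sub_right, inner_sub_right, inner_smul_right,
      inner_smul_right, h2, mul_zero, mul_zero, sub_zero, sub_zero, fastMix,
      (inner_col_fastMixPair (hb k) x c K).1, mul_pow]
    refine mul_le_mul_of_nonneg_right ?_ (sq_nonneg _)
    rw [← sq_abs]
    exact pow_le_pow_left₀ (abs_nonneg _) (abs_mixPair_le_of_rounds hl0 hl1 h0 h1 hρ0 hρ hK) 2

end Columns

/-! ### Convex analysis -/

section Convex
open Filter Topology

lemma deriv_le_of_forall_sub_le {g : ℝ → ℝ} {g' c : ℝ} (hg : HasDerivAt g g' 0)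
    (h : ∀ t, 0 < t → t < 1 → g t - g 0 ≤ t * c) : g' ≤ c := by
  have ht := hg.tendsto_slope_zero_right
  refine le_of_tendsto ht ?_
  filter_upwards [Ioo_mem_nhdsGT (zero_lt_one (α := ℝ))] with t ht
  rw [zero_add, smul_eq_mul, inv_mul_le_iff₀ ht.1]
  exact h t ht.1 ht.2

variable {E : Type*} [NormedAddCommGroup E] [InnerProductSpace ℝ E]

lemma le_of_convexOn_line {r : E → ℝ} (hr : ConvexOn ℝ Set.univ r) (x z : E) {t : ℝ} (h0 : 0 < t)
    (h1 : t < 1) : r (x + t • (z - x)) ≤ (1 - t) * r x + t * r z := by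
  have := hr.2 (Set.mem_univ x) (Set.mem_univ z) (sub_nonneg.2 h1.le) h0.le (by ring)
  rw [smul_eq_mul, smul_eq_mul] at this
  rwa [show (1 - t) • x + t • z = x + t • (z - x) by module] at this

section Complete
variable [CompleteSpace E]

lemma hasDerivAt_line {f : E → ℝ} {g x : E} (hf : HasGradientAt f g x) (v : E) :
    HasDerivAt (fun t : ℝ => f (x + t • v)) (inner ℝ g v) 0 := by
  have h1 : HasDerivAt (fun t : ℝ => x + t • v) v 0 := by
    simpa using ((hasDerivAt_id (0 : ℝ)).smul_const v).const_add x
  have h2 : HasFDerivAt f (InnerProductSpace.toDual ℝ E g) (x + (0 : ℝ) • v) := by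
    simpa using hf.hasFDerivAt
  have h3 := h2.comp_hasDerivAt (0 : ℝ) h1
  rw [InnerProductSpace.toDual_apply_apply] at h3
  exact h3

lemma convex_first_order {f : E → ℝ} (hf : ConvexOn ℝ Set.univ f) {x : E}
    (hd : DifferentiableAt ℝ f x) (y : E) : f x + inner ℝ (gradient f x) (y - x) ≤ f y := by
  have := deriv_le_of_forall_sub_le (c := f y - f x) (hasDerivAt_line hd.hasGradientAt (y - x)) ?_
  · linarith
  intro t h0 h1
  have := le_of_convexOn_line hf x y h0 h1
  simp only [zero_smul, add_zero]
  linarith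

/-- First-order optimality for the sum of a differentiable and a convex function. -/
lemma variational_inequality {g r : E → ℝ} {g' p : E} (hg : HasGradientAt g g' p)
    (hr : ConvexOn ℝ Set.univ r) (hmin : ∀ y, g p + r p ≤ g y + r y) (z : E) :
    r p - r z ≤ inner ℝ g' (z - p) := by
  have := deriv_le_of_forall_sub_le (c := r z - r p) (hasDerivAt_line hg (z - p)).neg ?_
  · linarith
  intro t h0 h1
  have h2 := le_of_convexOn_line hr p z h0 h1
  have h3 := hmin (p + t • (z - p))
  simp only [Pi.neg_apply, zero_smul, add_zero]
  linarith

/-- Compare at the point reached from `y` by the step `-(1/L)(∇f y - ∇f x)`: convexity from `x`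
bounds `f` there from below, smoothness from `y` bounds it from above. -/
lemma smooth_convex_lower_bound {f : E → ℝ} {L : ℝ} (hL : 0 < L) (hd : Differentiable ℝ f)
    (hc : ConvexOn ℝ Set.univ f)
    (hs : ∀ x y, f y - f x ≤ inner ℝ (gradient f x) (y - x) + L / 2 * ‖y - x‖ ^ 2) (x y : E) :
    f x + inner ℝ (gradient f x) (y - x) + 1 / (2 * L) * ‖gradient f x - gradient f y‖ ^ 2
      ≤ f y := by
  set a := gradient f x with ha
  set b := gradient f y with hb
  have h1 := convex_first_order hc (hd x) (y - (1 / L) • (b - a))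
  have h2 := hs y (y - (1 / L) • (b - a))
  rw [← ha] at h1
  rw [← hb] at h2
  have e1 : inner ℝ a (y - (1 / L) • (b - a) - x) = inner ℝ a (y - x) - 1 / L * inner ℝ a (b - a) := by
    rw [← inner_smul_right, ← inner_sub_right]; congr 1; module
  have e2 : y - (1 / L) • (b - a) - y = -((1 / L) • (b - a)) := by module
  rw [e1] at h1
  rw [e2, inner_neg_right, norm_neg, norm_smul, inner_smul_right, mul_pow, Real.norm_eq_abs,
    sq_abs] at h2
  have e3 : ‖b - a‖ ^ 2 = inner ℝ b (b - a) - inner ℝ a (b - a) := by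
    rw [← inner_sub_left, real_inner_self_eq_norm_sq]
  rw [norm_sub_rev a b]
  have e4 : L / 2 * ((1 / L) ^ 2 * ‖b - a‖ ^ 2) = 1 / (2 * L) * ‖b - a‖ ^ 2 := by
    field_simp
  have e5 : 1 / L * inner ℝ b (b - a) - 1 / L * inner ℝ a (b - a)
      = 2 * (1 / (2 * L) * ‖b - a‖ ^ 2) := by
    rw [e3]; field_simp
  linarith

lemma gradient_lipschitz_sq {f : E → ℝ} {L : ℝ} (hL : 0 < L) (hd : Differentiable ℝ f)
    (hc : ConvexOn ℝ Set.univ f)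
    (hs : ∀ x y, f y - f x ≤ inner ℝ (gradient f x) (y - x) + L / 2 * ‖y - x‖ ^ 2) (x y : E) :
    ‖gradient f x - gradient f y‖ ^ 2 ≤ L ^ 2 * ‖x - y‖ ^ 2 := by
  have h1 := smooth_convex_lower_bound hL hd hc hs x y
  have h2 := smooth_convex_lower_bound hL hd hc hs y x
  rw [norm_sub_rev (gradient f y)] at h2
  set a := gradient f x
  set b := gradient f y
  have e1 : inner ℝ a (y - x) + inner ℝ b (x - y) = -inner ℝ (a - b) (x - y) := by
    rw [← neg_sub x y, inner_neg_right, inner_sub_left]; ring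
  have h3 := real_inner_le_norm (a - b) (x - y)
  have h4 : 1 / L * ‖a - b‖ ^ 2 ≤ ‖a - b‖ * ‖x - y‖ := by
    have : 1 / L * ‖a - b‖ ^ 2 = 2 * (1 / (2 * L) * ‖a - b‖ ^ 2) := by field_simp
    linarith
  have h5 : ‖a - b‖ ≤ L * ‖x - y‖ := by
    rcases (norm_nonneg (a - b)).eq_or_lt with h | h
    · rw [← h]; positivity
    · rw [one_div, inv_mul_le_iff₀ hL] at h4
      nlinarith
  calc ‖a - b‖ ^ 2 ≤ (L * ‖x - y‖) ^ 2 := pow_le_pow_left₀ (norm_nonneg _) h5 2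
    _ = _ := by ring

lemma hasGradientAt_mul_norm_sub_sq (c : ℝ) (x p : E) :
    HasGradientAt (fun y => c * ‖y - x‖ ^ 2) ((2 * c) • (p - x)) p := by
  rw [hasGradientAt_iff_hasFDerivAt]
  have h := (((hasFDerivAt_id (𝕜 := ℝ) p).sub_const x).norm_sq).const_mul c
  refine h.congr_fderiv ?_
  ext v
  simp
  ring

end Complete

/-- A finite convex function is continuous here and bounded below by a function decreasing linearly
in the distance, so the quadratic term makes `g` coercive. This serves both the objective `f + r`
and the prox subproblem. -/
lemma exists_minimizer [FiniteDimensional ℝ E] {g φ : E → ℝ} {c : ℝ} (hc : 0 < c) (x₀ : E)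
    (hg : Continuous g) (hφ : ConvexOn ℝ Set.univ φ)
    (h : ∀ y, φ y + c * ‖y - x₀‖ ^ 2 ≤ g y) : ∃ z, ∀ y, g z ≤ g y := by
  have hφc : Continuous φ := continuousOn_univ.1 (hφ.continuousOn isOpen_univ)
  obtain ⟨w, hw, hβ⟩ := (isCompact_closedBall x₀ 1).exists_isMinOn
    ⟨x₀, Metric.mem_closedBall_self zero_le_one⟩ hφc.continuousOn
  set β := φ w with hβdef
  have hβ' : ∀ y, ‖y - x₀‖ ≤ 1 → β ≤ φ y := fun y hy => hβ (by simpa [dist_eq_norm] using hy)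
  have ha : 0 ≤ φ x₀ - β := sub_nonneg.2 (hβ' x₀ (by simp))
  -- Outside the unit ball, convexity along the segment from `x₀` is applied at its point of the
  -- unit sphere, where `φ ≥ β`.
  have hlow : ∀ y, β - (φ x₀ - β) * ‖y - x₀‖ ≤ φ y := by
    intro y
    rcases le_or_gt ‖y - x₀‖ 1 with h1 | h1
    · have := hβ' y h1
      nlinarith [norm_nonneg (y - x₀)]
    · have hR : 0 < ‖y - x₀‖ := by linarith
      have h2 := le_of_convexOn_line hφ x₀ y (inv_pos.2 hR) (inv_lt_one_of_one_lt₀ h1)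
      have h3 := hβ' (x₀ + ‖y - x₀‖⁻¹ • (y - x₀)) (by simp [norm_smul, hR.ne'])
      have h4 := mul_le_mul_of_nonneg_left (h3.trans h2) hR.le
      have h5 : ‖y - x₀‖ * ((1 - ‖y - x₀‖⁻¹) * φ x₀ + ‖y - x₀‖⁻¹ * φ y)
          = (‖y - x₀‖ - 1) * φ x₀ + φ y := by field_simp
      rw [h5] at h4
      linarith
  refine hg.exists_forall_le ?_
  have hT : Tendsto (fun y => ‖y - x₀‖ + (β - (φ x₀ - β + 1) ^ 2 / (4 * c))) (cocompact E) atTop := by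
    refine tendsto_atTop_add_const_right _ _ ?_
    simpa [dist_eq_norm] using tendsto_dist_right_cocompact_atTop x₀
  refine tendsto_atTop_mono (fun y => ?_) hT
  have h1 := hlow y
  have h2 := h y
  set R := ‖y - x₀‖
  set a := φ x₀ - β
  have h3 : (a + 1) * R - c * R ^ 2 ≤ (a + 1) ^ 2 / (4 * c) := by
    rw [le_div_iff₀ (by positivity)]
    nlinarith [sq_nonneg (2 * c * R - (a + 1))]
  linarith

lemma argmin_spec {X : Type*} [Nonempty X] {g : X → ℝ} (h : ∃ z, ∀ y, g z ≤ g y) (y : X) :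
    g (argmin g) ≤ g y :=
  Classical.epsilon_spec h y

end Convex

/-! ### Averages and consensus errors -/

section Averages
variable {m d : ℕ}

lemma frobSq_nonneg (x : Agg m d) : 0 ≤ frobSq x := Finset.sum_nonneg fun _ _ => sq_nonneg _

lemma consensusSq_nonneg (x : Agg m d) : 0 ≤ consensusSq x := frobSq_nonneg _

lemma sum_sub_avg (hm : 0 < m) (x : Agg m d) : ∑ i, (x i - avg x) = 0 := by
  have : (m : ℝ) ≠ 0 := by positivity
  simp only [avg, Finset.sum_sub_distrib, Finset.sum_const, Finset.card_univ, Fintype.card_fin]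
  rw [← Nat.cast_smul_eq_nsmul ℝ, smul_smul, mul_one_div_cancel this, one_smul, sub_self]

/-- The bias–variance identity. It is applied both to agents and, with `n` rows, to the values of an
estimator over its picks, so that `consensusSq` also plays the role of a variance. -/
lemma frobSq_sub_const (hm : 0 < m) (x : Agg m d) (c : Vec d) :
    frobSq (fun i => x i - c) = consensusSq x + m * ‖avg x - c‖ ^ 2 := by
  have h : ∀ i, ‖x i - c‖ ^ 2 = ‖x i - avg x‖ ^ 2 + 2 * inner ℝ (x i - avg x) (avg x - c)
      + ‖avg x - c‖ ^ 2 := fun i => by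
    rw [← norm_add_sq_real]; congr 2; abel
  simp only [frobSq, consensusSq, h, Finset.sum_add_distrib, ← Finset.mul_sum]
  rw [← sum_inner, sum_sub_avg hm]
  simp

lemma consensusSq_le_frobSq_sub (hm : 0 < m) (x : Agg m d) (c : Vec d) :
    consensusSq x ≤ frobSq (fun i => x i - c) := by
  rw [frobSq_sub_const hm]
  have : 0 ≤ (m : ℝ) * ‖avg x - c‖ ^ 2 := by positivity
  linarith

lemma frobSq_eq (hm : 0 < m) (x : Agg m d) : frobSq x = consensusSq x + m * ‖avg x‖ ^ 2 := by
  simpa using frobSq_sub_const hm x 0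

lemma norm_avg_sq_le (hm : 0 < m) (x : Agg m d) : ‖avg x‖ ^ 2 ≤ 1 / (m : ℝ) * frobSq x := by
  have h := frobSq_eq hm x
  have h2 := consensusSq_nonneg x
  have : (0 : ℝ) < m := by positivity
  rw [one_div, inv_mul_eq_div, le_div_iff₀ this]
  linarith

lemma consensusSq_le_frobSq (hm : 0 < m) (x : Agg m d) : consensusSq x ≤ frobSq x := by
  simpa using consensusSq_le_frobSq_sub hm x 0

lemma norm_add_sq_le {E : Type*} [SeminormedAddCommGroup E] [InnerProductSpace ℝ E] (a b : E)
    {t : ℝ} (ht : 0 < t) : ‖a + b‖ ^ 2 ≤ (1 + t) * ‖a‖ ^ 2 + (1 + t⁻¹) * ‖b‖ ^ 2 := by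
  have h := norm_add_sq_real a b
  have h2 := real_inner_le_norm a b
  have h3 : 2 * (‖a‖ * ‖b‖) ≤ t * ‖a‖ ^ 2 + t⁻¹ * ‖b‖ ^ 2 := by
    have : t * ‖a‖ ^ 2 + t⁻¹ * ‖b‖ ^ 2 - 2 * (‖a‖ * ‖b‖) = t⁻¹ * (t * ‖a‖ - ‖b‖) ^ 2 := by
      field_simp; ring
    have : 0 ≤ t⁻¹ * (t * ‖a‖ - ‖b‖) ^ 2 := by positivity
    linarith
  linarith

lemma frobSq_add_le (x y : Agg m d) {t : ℝ} (ht : 0 < t) :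
    frobSq (x + y) ≤ (1 + t) * frobSq x + (1 + t⁻¹) * frobSq y := by
  simp only [frobSq, Finset.mul_sum, ← Finset.sum_add_distrib]
  exact Finset.sum_le_sum fun i _ => norm_add_sq_le _ _ ht

lemma consensusSq_add_le (x y : Agg m d) {t : ℝ} (ht : 0 < t) :
    consensusSq (x + y) ≤ (1 + t) * consensusSq x + (1 + t⁻¹) * consensusSq y := by
  have : (fun i => (x + y) i - avg (x + y)) = (fun i => x i - avg x) + fun i => y i - avg y := by
    funext i; rw [avg_add]; simp only [Pi.add_apply]; abel
  unfold consensusSq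
  rw [this]
  exact frobSq_add_le _ _ ht

lemma consensusSq_smul (a : ℝ) (x : Agg m d) : consensusSq (a • x) = a ^ 2 * consensusSq x := by
  unfold consensusSq frobSq
  rw [avg_smul, Finset.mul_sum]
  refine Finset.sum_congr rfl fun i _ => ?_
  change ‖a • x i - a • avg x‖ ^ 2 = _
  rw [← smul_sub, norm_smul, mul_pow, Real.norm_eq_abs, sq_abs]

lemma avg_sub_const (hm : 0 < m) (x : Agg m d) (c : Vec d) :
    avg (fun i => x i - c) = avg x - c := by
  have : (m : ℝ) ≠ 0 := by positivity
  simp only [avg, Finset.sum_sub_distrib, Finset.sum_const, Finset.card_univ, Fintype.card_fin]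
  rw [← Nat.cast_smul_eq_nsmul ℝ, smul_sub, smul_smul, one_div_mul_cancel this, one_smul]

lemma consensusSq_sub_const (hm : 0 < m) (x : Agg m d) (c : Vec d) :
    consensusSq (fun i => x i - c) = consensusSq x := by
  unfold consensusSq
  rw [avg_sub_const hm]
  congr 1
  funext i
  exact sub_sub_sub_cancel_right _ _ _

/-- The average of firmly nonexpansive displacements. -/
lemma norm_avg_sq_le_of_firm (hm : 0 < m) {u e : Agg m d}
    (h : ∀ i, ‖u i‖ ^ 2 ≤ inner ℝ (e i) (u i)) :
    ‖avg u‖ ^ 2 ≤ ‖avg e‖ ^ 2 + 1 / 2 * (1 / (m : ℝ) * consensusSq e) := by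
  -- Firmness says that the reflection `2u - e` is no longer than `e`. Writing `ū` as the midpoint
  -- of the averaged reflection and `ē` then costs only half of the consensus error of `e`.
  have h1 : frobSq ((2 : ℝ) • u - e) ≤ frobSq e := by
    refine Finset.sum_le_sum fun i _ => ?_
    rw [Pi.sub_apply, Pi.smul_apply, norm_sub_sq_real, norm_smul, inner_smul_left, real_inner_comm]
    have := h i
    simp
    nlinarith
  have h2 := norm_avg_sq_le hm ((2 : ℝ) • u - e)
  rw [avg_sub, avg_smul] at h2
  have h3 : ‖avg u‖ ^ 2 ≤ 1 / 2 * ‖(2 : ℝ) • avg u - avg e‖ ^ 2 + 1 / 2 * ‖avg e‖ ^ 2 := by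
    have e1 : avg u = (1 / 2 : ℝ) • ((2 : ℝ) • avg u - avg e) + (1 / 2 : ℝ) • avg e := by module
    have := norm_add_sq_le ((1 / 2 : ℝ) • ((2 : ℝ) • avg u - avg e)) ((1 / 2 : ℝ) • avg e)
      zero_lt_one
    rw [← e1, norm_smul, norm_smul] at this
    norm_num at this
    nlinarith
  have hm' : (0 : ℝ) < m := by positivity
  have h4 : 1 / (m : ℝ) * frobSq e = 1 / (m : ℝ) * consensusSq e + ‖avg e‖ ^ 2 := by
    rw [frobSq_eq hm]; field_simp
  have h5 := mul_le_mul_of_nonneg_left h1 (one_div_pos.2 hm').le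
  linarith

end Averages

/-! ### Optimality conditions and the proximal step -/

namespace Problem
variable {m n d : ℕ} {P : Problem m n d}

lemma η_pos (hP : P.Assumptions) : 0 < P.η := by
  have := hP.L_pos; unfold η; positivity

lemma hasGradientAt_fi (hP : P.Assumptions) (i : Fin m) (x : Vec d) :
    HasGradientAt (P.fi i) ((1 / (n : ℝ)) • ∑ j, gradient (P.f i j) x) x := by
  rw [hasGradientAt_iff_hasFDerivAt, map_smulₛₗ, map_sum]
  exact (HasFDerivAt.fun_sum fun j _ =>
    (hP.differentiable i j x).hasGradientAt.hasFDerivAt).const_mul (1 / (n : ℝ))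

lemma gradient_fi (hP : P.Assumptions) (i : Fin m) (x : Vec d) :
    gradient (P.fi i) x = (1 / (n : ℝ)) • ∑ j, gradient (P.f i j) x :=
  (hasGradientAt_fi hP i x).gradient

lemma hasGradientAt_fbar (hP : P.Assumptions) (x : Vec d) :
    HasGradientAt P.fbar (avg fun i => gradient (P.fi i) x) x := by
  rw [hasGradientAt_iff_hasFDerivAt, avg, map_smulₛₗ, map_sum]
  exact (HasFDerivAt.fun_sum fun i _ =>
    (hasGradientAt_fi hP i x).differentiableAt.hasGradientAt.hasFDerivAt).const_mul (1 / (m : ℝ))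

lemma gradient_fbar (hP : P.Assumptions) (x : Vec d) :
    gradient P.fbar x = avg fun i => gradient (P.fi i) x :=
  (hasGradientAt_fbar hP x).gradient

lemma r_continuous (hP : P.Assumptions) : Continuous P.r :=
  continuousOn_univ.1 (hP.r_convex.continuousOn isOpen_univ)

lemma xstar_min (hP : P.Assumptions) (y : Vec d) : P.h P.xstar ≤ P.h y := by
  refine argmin_spec ?_ y
  have hc : Continuous P.fbar :=
    continuous_iff_continuousAt.2 fun x => (hasGradientAt_fbar hP x).continuousAt
  have hlin : ConvexOn ℝ Set.univ
      (fun y => P.r y + (inner ℝ (gradient P.fbar 0) y + P.fbar 0)) :=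
    hP.r_convex.add (((innerₗ (Vec d) (gradient P.fbar 0)).convexOn convex_univ).add
      (convexOn_const (P.fbar 0) convex_univ))
  refine exists_minimizer (c := P.μ / 2) (by linarith [hP.μ_pos]) 0
    (hc.add (r_continuous hP)) hlin fun y => ?_
  have := hP.strongly_convex 0 y
  simp only [sub_zero, h] at this ⊢
  linarith

/-- The optimality condition at the minimizer. -/
lemma xstar_optimality (hP : P.Assumptions) (z : Vec d) :
    P.r P.xstar - P.r z ≤ inner ℝ (gradient P.fbar P.xstar) (z - P.xstar) :=
  variational_inequality (hasGradientAt_fbar hP _).differentiableAt.hasGradientAt hP.r_convex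
    (xstar_min hP) z

lemma proxAgg_min (hP : P.Assumptions) (x : Agg m d) (z : Agg m d) :
    (1 / (m : ℝ)) * ∑ i, P.r (P.proxAgg x i) + 1 / (2 * (m : ℝ) * P.η) * frobSq (P.proxAgg x - x) ≤
      (1 / (m : ℝ)) * ∑ i, P.r (z i) + 1 / (2 * (m : ℝ) * P.η) * frobSq (z - x) := by
  refine argmin_spec (g := fun z : Agg m d => (1 / (m : ℝ)) * ∑ i, P.r (z i)
    + 1 / (2 * (m : ℝ) * P.η) * frobSq (z - x)) ?_ z
  have hη := η_pos hP
  have hm : (0 : ℝ) < m := Nat.cast_pos.2 hP.m_pos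
  -- The aggregated objective is `1/m` times a sum over rows, so rowwise minimizers assemble into a
  -- global one.
  have h1 : ∀ i, ∃ z, ∀ y, P.r z + 1 / (2 * P.η) * ‖z - x i‖ ^ 2 ≤
      P.r y + 1 / (2 * P.η) * ‖y - x i‖ ^ 2 := fun i =>
    exists_minimizer (c := 1 / (2 * P.η)) (by positivity) (x i)
      ((r_continuous hP).add (by fun_prop)) hP.r_convex fun y => le_rfl
  choose w hw using h1
  have key : ∀ z : Agg m d, (1 / (m : ℝ)) * ∑ i, P.r (z i) + 1 / (2 * (m : ℝ) * P.η) * frobSq (z - x)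
      = 1 / (m : ℝ) * ∑ i, (P.r (z i) + 1 / (2 * P.η) * ‖z i - x i‖ ^ 2) := by
    intro z
    rw [Finset.sum_add_distrib, ← Finset.mul_sum, frobSq]
    simp only [Pi.sub_apply]
    field_simp
  refine ⟨w, fun y => ?_⟩
  simp only [key]
  exact mul_le_mul_of_nonneg_left (Finset.sum_le_sum fun i _ => hw i (y i)) (by positivity)

/-- Changing only row `i` in the minimality of the aggregate isolates the ordinary prox problem of
that row, with step size `η`. -/
lemma proxAgg_optimality (hP : P.Assumptions) (x : Agg m d) (i : Fin m) (z : Vec d) :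
    P.r (P.proxAgg x i) - P.r z ≤ P.η⁻¹ * inner ℝ (P.proxAgg x i - x i) (z - P.proxAgg x i) := by
  classical
  have hη := η_pos hP
  have hm : (0 : ℝ) < m := Nat.cast_pos.2 hP.m_pos
  set p := P.proxAgg x with hp
  have hmin : ∀ y, 1 / (2 * P.η) * ‖p i - x i‖ ^ 2 + P.r (p i) ≤
      1 / (2 * P.η) * ‖y - x i‖ ^ 2 + P.r y := by
    intro y
    have h := proxAgg_min hP x (Function.update p i y)
    rw [← hp] at h
    simp only [frobSq, Pi.sub_apply] at h
    rw [← Finset.add_sum_erase _ _ (Finset.mem_univ i),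
      ← Finset.add_sum_erase _ (fun j => P.r (Function.update p i y j)) (Finset.mem_univ i),
      ← Finset.add_sum_erase _ (fun j => ‖p j - x j‖ ^ 2) (Finset.mem_univ i),
      ← Finset.add_sum_erase _ (fun j => ‖Function.update p i y j - x j‖ ^ 2)
        (Finset.mem_univ i)] at h
    have e1 : ∑ j ∈ Finset.univ.erase i, P.r (Function.update p i y j)
        = ∑ j ∈ Finset.univ.erase i, P.r (p j) :=
      Finset.sum_congr rfl fun j hj => by rw [Function.update_of_ne (Finset.ne_of_mem_erase hj)]
    have e2 : ∑ j ∈ Finset.univ.erase i, ‖Function.update p i y j - x j‖ ^ 2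
        = ∑ j ∈ Finset.univ.erase i, ‖p j - x j‖ ^ 2 :=
      Finset.sum_congr rfl fun j hj => by rw [Function.update_of_ne (Finset.ne_of_mem_erase hj)]
    rw [e1, e2, Function.update_self] at h
    have h2 := mul_le_mul_of_nonneg_left h hm.le
    have e3 : ∀ a b : ℝ, (m : ℝ) * (1 / m * a + 1 / (2 * m * P.η) * b) = a + 1 / (2 * P.η) * b := by
      intro a b; field_simp
    rw [e3, e3] at h2
    linarith
  have := variational_inequality (hasGradientAt_mul_norm_sub_sq (1 / (2 * P.η)) (x i) (p i))
    hP.r_convex hmin z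
  rw [inner_smul_left] at this
  have e : 2 * (1 / (2 * P.η)) = P.η⁻¹ := by field_simp
  rw [e] at this
  simpa using this

lemma firm_of_optimality {r : Vec d → ℝ} {η : ℝ} (hη : 0 < η) {p p' x x' : Vec d}
    (h : r p - r p' ≤ η⁻¹ * inner ℝ (p - x) (p' - p))
    (h' : r p' - r p ≤ η⁻¹ * inner ℝ (p' - x') (p - p')) :
    ‖p - p'‖ ^ 2 ≤ inner ℝ (x - x') (p - p') := by
  have h1 : 0 ≤ η⁻¹ * (inner ℝ (p - x) (p' - p) + inner ℝ (p' - x') (p - p')) := by linarith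
  have h2 : 0 ≤ inner ℝ (p - x) (p' - p) + inner ℝ (p' - x') (p - p') :=
    nonneg_of_mul_nonneg_right h1 (inv_pos.2 hη)
  have e : inner ℝ (p - x) (p' - p) + inner ℝ (p' - x') (p - p')
      = inner ℝ (x - x') (p - p') - ‖p - p'‖ ^ 2 := by
    rw [← real_inner_self_eq_norm_sq, ← inner_sub_left, ← neg_sub p p', inner_neg_right,
      ← inner_neg_left, ← inner_add_left]
    congr 1; abel
  linarith

/-- Stationarity of `xstar` is the prox optimality condition at input `x* - η ∇f(x*)`: it is a fixed
point of the exact proximal gradient step. -/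
lemma proxAgg_firm_xstar (hP : P.Assumptions) (x : Agg m d) (i : Fin m) :
    ‖P.proxAgg x i - P.xstar‖ ^ 2 ≤
      inner ℝ (x i - (P.xstar - P.η • gradient P.fbar P.xstar)) (P.proxAgg x i - P.xstar) := by
  have hη := η_pos hP
  refine firm_of_optimality hη (proxAgg_optimality hP x i _) ?_
  refine (xstar_optimality hP _).trans (le_of_eq ?_)
  rw [sub_sub_cancel, inner_smul_left, ← mul_assoc]
  simp [hη.ne']

lemma proxAgg_firm (hP : P.Assumptions) (x y : Agg m d) (i j : Fin m) :
    ‖P.proxAgg x i - P.proxAgg y j‖ ^ 2 ≤ inner ℝ (x i - y j) (P.proxAgg x i - P.proxAgg y j) :=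
  firm_of_optimality (η_pos hP) (proxAgg_optimality hP x i _) (proxAgg_optimality hP y j _)

/-- The average minimizes the sum of squared distances, so it may be replaced by the prox of `avg
x`; nonexpansiveness does the rest. -/
lemma consensusSq_proxAgg_le (hP : P.Assumptions) (x : Agg m d) :
    consensusSq (P.proxAgg x) ≤ consensusSq x := by
  refine (consensusSq_le_frobSq_sub hP.m_pos _
    (P.proxAgg (fun _ => avg x) ⟨0, hP.m_pos⟩)).trans ?_
  refine Finset.sum_le_sum fun i _ => ?_
  have h := proxAgg_firm hP x (fun _ => avg x) i ⟨0, hP.m_pos⟩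
  have h2 := real_inner_le_norm (x i - avg x) (P.proxAgg x i - P.proxAgg (fun _ => avg x) ⟨0, hP.m_pos⟩)
  set a := ‖P.proxAgg x i - P.proxAgg (fun _ => avg x) ⟨0, hP.m_pos⟩‖
  have ha : 0 ≤ a := norm_nonneg _
  have hb : 0 ≤ ‖x i - avg x‖ := norm_nonneg _
  nlinarith [sq_nonneg (a - ‖x i - avg x‖)]

end Problem

/-! ### Variance-reduced gradient estimators -/

namespace Problem
variable {m n d : ℕ} {P : Problem m n d}

/-- The variance-reduced gradient estimator of agent `i` at `x` with reference points `p`, for the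
pick `k`. -/
def vEst (P : Problem m n d) (i : Fin m) (x : Vec d) (p : Fin n → Vec d) (k : Fin n) : Vec d :=
  gradient (P.f i k) x - gradient (P.f i k) (p k) + (1 / (n : ℝ)) • ∑ l, gradient (P.f i l) (p l)

/-- Mean squared distance of the component gradients at `p` from those at the minimizer. -/
def gradDist (P : Problem m n d) (i : Fin m) (p : Fin n → Vec d) : ℝ :=
  1 / (n : ℝ) * ∑ k, ‖gradient (P.f i k) (p k) - gradient (P.f i k) P.xstar‖ ^ 2

lemma gradDist_nonneg (i : Fin m) (p : Fin n → Vec d) : 0 ≤ P.gradDist i p := by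
  unfold gradDist; positivity

lemma gradient_fi_eq_avg (hP : P.Assumptions) (i : Fin m) (x : Vec d) :
    gradient (P.fi i) x = avg fun k => gradient (P.f i k) x := gradient_fi hP i x

lemma avg_const {m d : ℕ} (hm : 0 < m) (c : Vec d) : avg (fun _ : Fin m => c) = c := by
  have h := avg_sub_const hm (fun _ : Fin m => c) c
  simp only [sub_self] at h
  have h0 : avg (fun _ : Fin m => (0 : Vec d)) = 0 := by simp [avg]
  rw [h0] at h
  exact (sub_eq_zero.1 h.symm)

lemma avg_vEst (hP : P.Assumptions) (i : Fin m) (x : Vec d) (p : Fin n → Vec d) :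
    avg (P.vEst i x p) = gradient (P.fi i) x := by
  have h : P.vEst i x p = (fun k => gradient (P.f i k) x) - (fun k => gradient (P.f i k) (p k))
      + fun _ => avg fun k => gradient (P.f i k) (p k) := by funext k; rfl
  rw [h, avg_add, avg_sub, avg_const hP.n_pos, gradient_fi_eq_avg hP]
  abel

lemma frobSq_neg {m d : ℕ} (x : Agg m d) : frobSq (-x) = frobSq x := by simp [frobSq]

/-- The error is the gradient difference at `x` minus a centered gradient difference at the
reference points, and centering only lowers the second moment. -/
lemma mean_sq_vEst_sub_star_le (hP : P.Assumptions) (i : Fin m) (x : Vec d) (p : Fin n → Vec d) :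
    1 / (n : ℝ) * frobSq (fun k => P.vEst i x p k - gradient (P.fi i) P.xstar) ≤
      2 * P.gradDist i (fun _ => x) + 2 * P.gradDist i p := by
  set A : Agg n d := fun k => gradient (P.f i k) x - gradient (P.f i k) P.xstar with hA
  set B : Agg n d := fun k => gradient (P.f i k) (p k) - gradient (P.f i k) P.xstar with hB
  have hn := hP.n_pos
  have h : (fun k => P.vEst i x p k - gradient (P.fi i) P.xstar)
      = A + -(fun k => B k - avg B) := by
    have hBa : avg B = avg (fun k => gradient (P.f i k) (p k)) - gradient (P.fi i) P.xstar := by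
      rw [gradient_fi_eq_avg hP, ← avg_sub]; rfl
    funext k
    change _ = A k + -(B k - avg B)
    rw [hBa]
    simp only [hA, hB]
    change gradient (P.f i k) x - gradient (P.f i k) (p k)
      + avg (fun l => gradient (P.f i l) (p l)) - _ = _
    abel
  rw [h]
  have h1 := frobSq_add_le A (-(fun k => B k - avg B)) zero_lt_one
  rw [frobSq_neg] at h1
  have h2 : frobSq (fun k => B k - avg B) ≤ frobSq B := consensusSq_le_frobSq hn B
  have h3 : frobSq (A + -(fun k => B k - avg B)) ≤ 2 * frobSq A + 2 * frobSq B := by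
    norm_num at h1; linarith
  have hn' : (0 : ℝ) ≤ 1 / n := by positivity
  have h4 := mul_le_mul_of_nonneg_left h3 hn'
  refine h4.trans (le_of_eq ?_)
  unfold gradDist frobSq
  ring

/-- The left side is the variance over the pick. Young's weight `10` keeps the coefficient of the
memory term near `1`, at the expense of the term at `x`, for which `η² L² = 1/144` leaves room. -/
lemma consensus_vEst_le (hP : P.Assumptions) (i : Fin m) (x : Vec d) (p : Fin n → Vec d) :
    1 / (n : ℝ) * consensusSq (P.vEst i x p) ≤
      11 * P.gradDist i (fun _ => x) + 11 / 10 * P.gradDist i p := by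
  set A : Agg n d := fun k => gradient (P.f i k) x - gradient (P.f i k) P.xstar with hA
  set B : Agg n d := fun k => gradient (P.f i k) (p k) - gradient (P.f i k) P.xstar with hB
  have hn := hP.n_pos
  have h : A + -B = fun k => P.vEst i x p k - avg (fun l => gradient (P.f i l) (p l)) := by
    funext k
    simp only [Pi.add_apply, Pi.neg_apply, hA, hB]
    change _ = gradient (P.f i k) x - gradient (P.f i k) (p k)
      + avg (fun l => gradient (P.f i l) (p l)) - _
    abel
  have h1 := frobSq_add_le A (-B) (show (0 : ℝ) < 10 by norm_num)
  rw [h, frobSq_neg] at h1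
  have h2 := (consensusSq_le_frobSq_sub hn (P.vEst i x p) _).trans h1
  have hn' : (0 : ℝ) ≤ 1 / n := by positivity
  refine (mul_le_mul_of_nonneg_left h2 hn').trans (le_of_eq ?_)
  unfold gradDist frobSq
  ring

lemma consensus_vEst_eq_zero (h : n = 1) (i : Fin m) (x : Vec d) (p : Fin n → Vec d) :
    consensusSq (P.vEst i x p) = 0 := by
  subst h
  simp [consensusSq, frobSq, avg]

lemma η_sq_mul_L_sq (hP : P.Assumptions) : P.η ^ 2 * P.L ^ 2 = 1 / 144 := by
  have := hP.L_pos
  unfold η; field_simp; norm_num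

lemma gradDist_const_le (hP : P.Assumptions) (i : Fin m) (x : Vec d) :
    P.gradDist i (fun _ => x) ≤ P.L ^ 2 * ‖x - P.xstar‖ ^ 2 := by
  have hn : (0 : ℝ) < n := Nat.cast_pos.2 hP.n_pos
  unfold gradDist
  rw [one_div, inv_mul_le_iff₀ hn]
  calc _ ≤ ∑ k : Fin n, P.L ^ 2 * ‖x - P.xstar‖ ^ 2 := Finset.sum_le_sum fun k _ =>
        gradient_lipschitz_sq hP.L_pos (hP.differentiable i k) (hP.convex i k) (hP.smooth i k) _ _
    _ = _ := by simp

lemma gradient_fi_lipschitz_sq (hP : P.Assumptions) (i : Fin m) (x y : Vec d) :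
    ‖gradient (P.fi i) x - gradient (P.fi i) y‖ ^ 2 ≤ P.L ^ 2 * ‖x - y‖ ^ 2 := by
  have hn : (0 : ℝ) < n := Nat.cast_pos.2 hP.n_pos
  rw [gradient_fi_eq_avg hP, gradient_fi_eq_avg hP, ← avg_sub]
  refine (norm_avg_sq_le hP.n_pos _).trans ?_
  rw [one_div, inv_mul_le_iff₀ hn]
  calc _ ≤ ∑ k : Fin n, P.L ^ 2 * ‖x - y‖ ^ 2 := Finset.sum_le_sum fun k _ =>
        gradient_lipschitz_sq hP.L_pos (hP.differentiable i k) (hP.convex i k) (hP.smooth i k) _ _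
    _ = _ := by simp

lemma inner_avg_right {m d : ℕ} (a : Vec d) (x : Agg m d) :
    inner ℝ a (avg x) = 1 / (m : ℝ) * ∑ i, inner ℝ a (x i) := by
  rw [avg, inner_smul_right, inner_sum]

lemma inner_avg_left {m d : ℕ} (a : Vec d) (x : Agg m d) :
    inner ℝ (avg x) a = 1 / (m : ℝ) * ∑ i, inner ℝ (x i) a := by
  rw [real_inner_comm, inner_avg_right]
  simp only [real_inner_comm a]

/-- Per component, add smoothness from `x` to `y` to the cocoercive lower bound from `x` to `xstar`.
With `y` the averaged iterate this shows the cost `(L/2)‖y - x‖²` of evaluating gradients at local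
points; the `gradDist` gain later absorbs the variance. -/
lemma fi_descent (hP : P.Assumptions) (i : Fin m) (x y : Vec d) :
    P.fi i y - P.fi i P.xstar - P.L / 2 * ‖y - x‖ ^ 2
      + 1 / (2 * P.L) * P.gradDist i (fun _ => x) ≤
      inner ℝ (gradient (P.fi i) x) (y - P.xstar) := by
  have hn : (0 : ℝ) < n := Nat.cast_pos.2 hP.n_pos
  have hk : ∀ k, P.f i k y - P.f i k P.xstar - P.L / 2 * ‖y - x‖ ^ 2
      + 1 / (2 * P.L) * ‖gradient (P.f i k) x - gradient (P.f i k) P.xstar‖ ^ 2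
      ≤ inner ℝ (gradient (P.f i k) x) (y - P.xstar) := by
    intro k
    have h1 := smooth_convex_lower_bound hP.L_pos (hP.differentiable i k) (hP.convex i k)
      (hP.smooth i k) x P.xstar
    have h2 := hP.smooth i k x y
    have e : inner ℝ (gradient (P.f i k) x) (y - P.xstar) = inner ℝ (gradient (P.f i k) x) (y - x)
        - inner ℝ (gradient (P.f i k) x) (P.xstar - x) := by
      rw [← inner_sub_right]; congr 1; abel
    linarith
  have hs := mul_le_mul_of_nonneg_left (Finset.sum_le_sum fun k (_ : k ∈ Finset.univ) => hk k)
    (one_div_pos.2 hn).le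
  rw [gradient_fi_eq_avg hP, inner_avg_left]
  refine le_trans (le_of_eq ?_) hs
  simp only [Finset.sum_add_distrib, Finset.sum_sub_distrib, ← Finset.mul_sum, fi, gradDist,
    Finset.sum_const, Finset.card_univ, Fintype.card_fin, nsmul_eq_mul]
  field_simp

/-- The inexact strong monotonicity inequality at the averaged iterate. -/
lemma inner_grad_lower_bound (hP : P.Assumptions) (x : Agg m d) :
    P.μ / 2 * ‖avg x - P.xstar‖ ^ 2 - P.L / 2 * (1 / (m : ℝ) * consensusSq x)
      + 1 / (2 * P.L) * (1 / (m : ℝ) * ∑ i, P.gradDist i (fun _ => x i)) ≤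
    1 / (m : ℝ) * ∑ i, inner ℝ (avg x - P.xstar)
      (gradient (P.fi i) (x i) - gradient (P.fi i) P.xstar) := by
  have hm : (0 : ℝ) < m := Nat.cast_pos.2 hP.m_pos
  have hs := mul_le_mul_of_nonneg_left (Finset.sum_le_sum fun i (_ : i ∈ Finset.univ) =>
    fi_descent hP i (x i) (avg x)) (one_div_pos.2 hm).le
  have hsc := hP.strongly_convex P.xstar (avg x)
  rw [gradient_fbar hP, inner_avg_left] at hsc
  have e1 : 1 / (m : ℝ) * ∑ i, inner ℝ (avg x - P.xstar)
      (gradient (P.fi i) (x i) - gradient (P.fi i) P.xstar)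
      = 1 / (m : ℝ) * ∑ i, inner ℝ (gradient (P.fi i) (x i)) (avg x - P.xstar)
        - 1 / (m : ℝ) * ∑ i, inner ℝ (gradient (P.fi i) P.xstar) (avg x - P.xstar) := by
    rw [← mul_sub, ← Finset.sum_sub_distrib]
    congr 1
    refine Finset.sum_congr rfl fun i _ => ?_
    rw [← inner_sub_left, real_inner_comm]
  have e2 : 1 / (m : ℝ) * ∑ i, (P.fi i (avg x) - P.fi i P.xstar - P.L / 2 * ‖avg x - x i‖ ^ 2
      + 1 / (2 * P.L) * P.gradDist i (fun _ => x i))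
      = P.fbar (avg x) - P.fbar P.xstar - P.L / 2 * (1 / (m : ℝ) * consensusSq x)
      + 1 / (2 * P.L) * (1 / (m : ℝ) * ∑ i, P.gradDist i (fun _ => x i)) := by
    simp only [Finset.sum_add_distrib, Finset.sum_sub_distrib, ← Finset.mul_sum, fbar, consensusSq,
      frobSq, norm_sub_rev (avg x)]
    ring
  rw [e2] at hs
  rw [e1]
  linarith

end Problem

/-! ### The common estimator and its one-step inequalities -/

/-- A variance-reduced local gradient estimator: the memory `a : M` of an agent stores the reference
points `pt a`, a random pick `e : E` of probability `wt e` selects the component `idx e`, the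
memory is then replaced by `upd a x e`, and `cost e` component gradients are evaluated. -/
structure Estimator (n d : ℕ) (M E : Type) [Fintype E] where
  wt : E → ℝ
  idx : E → Fin n
  pt : M → Fin n → Vec d
  upd : M → Vec d → E → M
  cost : E → ℕ
  sum_idx : ∀ F : Fin n → ℝ, ∑ e, wt e * F (idx e) = 1 / (n : ℝ) * ∑ k, F k
  -- Only the marginal law of each entry matters: a SAGA entry is overwritten when its index is
  -- picked, the LSVRG entries all together with probability `1/n`.
  sum_upd : ∀ (g : Vec d → ℝ) (a : M) (x : Vec d) (k : Fin n),
    ∑ e, wt e * g (pt (upd a x e) k) = (1 - 1 / (n : ℝ)) * g (pt a k) + 1 / (n : ℝ) * g x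
  -- The value `3 = 2 + n · (1/n)` comes from LSVRG.
  sum_cost : ∑ e, wt e * (cost e : ℝ) ≤ 3

namespace Problem
variable {m n d : ℕ} {M E : Type} [Fintype E] {P : Problem m n d}

/-- One iteration with a general estimator. -/
def estStep (P : Problem m n d) (𝒜 : Estimator n d M E) (K : ℕ) (S : State m d M) (e : Fin m → E) :
    State m d M :=
  P.step K S (fun i => P.vEst i (S.x i) (𝒜.pt (S.mem i)) (𝒜.idx (e i)))
    (fun i => 𝒜.upd (S.mem i) (S.x i) (e i)) (fun i => 𝒜.cost (e i))

/-- The consensus error of the iterates. -/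
def xErr (S : State m d M) : ℝ := 1 / (m : ℝ) * consensusSq S.x

/-- The scaled consensus error of the tracked gradients. -/
def sErr (P : Problem m n d) (S : State m d M) : ℝ := P.η ^ 2 / (m : ℝ) * consensusSq S.sPrev

/-- The scaled distance of the last estimators from the local gradients at the new iterate. -/
def vErr (P : Problem m n d) (S : State m d M) : ℝ :=
  P.η ^ 2 * (1 / (m : ℝ) * ∑ i, ‖gradient (P.fi i) (S.x i) - S.vPrev i‖ ^ 2)

/-- The Lyapunov function of a state. -/
def lyap (P : Problem m n d) (𝒜 : Estimator n d M E) (S : State m d M) : ℝ :=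
  ‖avg S.x - P.xstar‖ ^ 2
    + 4 * (n : ℝ) * P.η ^ 2 * (1 / (m : ℝ) * ∑ i, P.gradDist i (𝒜.pt (S.mem i)))

/-- The scaled conditional variance of the next estimators. -/
def noise (P : Problem m n d) (𝒜 : Estimator n d M E) (S : State m d M) : ℝ :=
  P.η ^ 2 * (1 / (m : ℝ) *
    ∑ i, 1 / (n : ℝ) * consensusSq (P.vEst i (S.x i) (𝒜.pt (S.mem i))))

lemma xErr_nonneg (S : State m d M) : 0 ≤ xErr S :=
  mul_nonneg (by positivity) (consensusSq_nonneg _)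

lemma sErr_nonneg (S : State m d M) : 0 ≤ P.sErr S :=
  mul_nonneg (by positivity) (consensusSq_nonneg _)

lemma lyap_nonneg (𝒜 : Estimator n d M E) (S : State m d M) : 0 ≤ P.lyap 𝒜 S := by
  have : 0 ≤ ∑ i, P.gradDist i (𝒜.pt (S.mem i)) :=
    Finset.sum_nonneg fun i _ => gradDist_nonneg i _
  unfold lyap; positivity

lemma norm_sq_le_lyap (𝒜 : Estimator n d M E) (S : State m d M) :
    ‖avg S.x - P.xstar‖ ^ 2 ≤ P.lyap 𝒜 S := by
  have : 0 ≤ ∑ i, P.gradDist i (𝒜.pt (S.mem i)) :=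
    Finset.sum_nonneg fun i _ => gradDist_nonneg i _
  unfold lyap
  have : 0 ≤ 4 * (n : ℝ) * P.η ^ 2 * (1 / (m : ℝ) * ∑ i, P.gradDist i (𝒜.pt (S.mem i))) := by
    positivity
  linarith

lemma mean_sq_dist_xstar (hP : P.Assumptions) (S : State m d M) :
    1 / (m : ℝ) * ∑ i, ‖S.x i - P.xstar‖ ^ 2 = xErr S + ‖avg S.x - P.xstar‖ ^ 2 := by
  have hm : (m : ℝ) ≠ 0 := (Nat.cast_pos.2 hP.m_pos).ne'
  have h := frobSq_sub_const hP.m_pos S.x P.xstar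
  rw [frobSq] at h
  rw [h, xErr]; field_simp

lemma mean_gradDist_le (hP : P.Assumptions) (S : State m d M) :
    P.η ^ 2 * (1 / (m : ℝ) * ∑ i, P.gradDist i (fun _ => S.x i)) ≤
      1 / 144 * (xErr S + ‖avg S.x - P.xstar‖ ^ 2) := by
  rw [← mean_sq_dist_xstar hP, ← η_sq_mul_L_sq hP]
  have h : ∑ i, P.gradDist i (fun _ => S.x i) ≤ P.L ^ 2 * ∑ i, ‖S.x i - P.xstar‖ ^ 2 := by
    rw [Finset.mul_sum]; exact Finset.sum_le_sum fun i _ => gradDist_const_le hP i _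
  have h2 := mul_le_mul_of_nonneg_left h (show 0 ≤ P.η ^ 2 * (1 / (m : ℝ)) by positivity)
  calc _ = P.η ^ 2 * (1 / (m : ℝ)) * ∑ i, P.gradDist i (fun _ => S.x i) := by ring
    _ ≤ _ := h2
    _ = _ := by ring

/-- For `n = 1` the variance vanishes. For `n ≥ 2` the weight `4n ≥ 8` of the memory term in `lyap`
turns `11/10` into `11/80`. -/
lemma noise_le (hP : P.Assumptions) (𝒜 : Estimator n d M E) (S : State m d M) :
    P.noise 𝒜 S ≤ 11 / 80 * P.lyap 𝒜 S + 11 / 144 * xErr S := by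
  have hl := lyap_nonneg (P := P) 𝒜 S
  have hx := xErr_nonneg S
  by_cases hn1 : n = 1
  · have : P.noise 𝒜 S = 0 := by
      unfold noise
      simp only [consensus_vEst_eq_zero hn1, mul_zero, Finset.sum_const_zero]
    rw [this]; positivity
  have hn2 : (2 : ℝ) ≤ n := by exact_mod_cast (show 2 ≤ n by have := hP.n_pos; omega)
  have h1 : P.noise 𝒜 S ≤ 11 * (P.η ^ 2 * (1 / (m : ℝ) * ∑ i, P.gradDist i (fun _ => S.x i)))
      + 11 / 10 * (P.η ^ 2 * (1 / (m : ℝ) * ∑ i, P.gradDist i (𝒜.pt (S.mem i)))) := by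
    have := mul_le_mul_of_nonneg_left (Finset.sum_le_sum fun i (_ : i ∈ Finset.univ) =>
      consensus_vEst_le hP i (S.x i) (𝒜.pt (S.mem i)))
      (show 0 ≤ P.η ^ 2 * (1 / (m : ℝ)) by positivity)
    refine le_of_eq_of_le ?_ (this.trans (le_of_eq ?_))
    · unfold noise; ring
    · simp only [Finset.sum_add_distrib, ← Finset.mul_sum]; ring
  have h2 := mean_gradDist_le hP S
  set D := P.η ^ 2 * (1 / (m : ℝ) * ∑ i, P.gradDist i (𝒜.pt (S.mem i))) with hD
  have hD0 : 0 ≤ D := by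
    have : 0 ≤ ∑ i, P.gradDist i (𝒜.pt (S.mem i)) :=
      Finset.sum_nonneg fun i _ => gradDist_nonneg i _
    positivity
  have hl : P.lyap 𝒜 S = ‖avg S.x - P.xstar‖ ^ 2 + 4 * n * D := by
    rw [hD]; unfold lyap; ring
  rw [hl]
  nlinarith [sq_nonneg ‖avg S.x - P.xstar‖]

section Step
variable (𝒜 : Estimator n d M E) (K : ℕ) (S : State m d M) (e : Fin m → E)

/-- The gradient-tracking invariant: mixing preserves averages, so `s̄ = v̄` propagates. -/
lemma avg_estStep (hP : P.Assumptions) (h : avg S.sPrev = avg S.vPrev) :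
    avg (P.estStep 𝒜 K S e).sPrev = avg (P.estStep 𝒜 K S e).vPrev := by
  simp only [estStep, step]
  rw [avg_fastMix hP.W_symm hP.W_one, avg_sub, avg_add, h]
  abel

/-- The contribution of one agent to the bound for the next value of the Lyapunov function. -/
def driftTerm (P : Problem m n d) (𝒜 : Estimator n d M E) (S : State m d M) (i : Fin m) (a : E) :
    ℝ :=
  (‖avg S.x - P.xstar‖ ^ 2
    - 2 * P.η * inner ℝ (avg S.x - P.xstar)
        (P.vEst i (S.x i) (𝒜.pt (S.mem i)) (𝒜.idx a) - gradient (P.fi i) P.xstar)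
    + P.η ^ 2 * ‖P.vEst i (S.x i) (𝒜.pt (S.mem i)) (𝒜.idx a) - gradient (P.fi i) P.xstar‖ ^ 2)
    + 4 * (n : ℝ) * P.η ^ 2 * P.gradDist i (𝒜.pt (𝒜.upd (S.mem i) (S.x i) a))

/-- By tracking, the mean prox input is `x̄ - η v̄`. The last two terms are half the consensus error
of the prox input, split by Young with weight `2`. -/
lemma lyap_estStep_le (hP : P.Assumptions) (h : avg S.sPrev = avg S.vPrev) :
    P.lyap 𝒜 (P.estStep 𝒜 K S e) ≤ 1 / (m : ℝ) * ∑ i, driftTerm P 𝒜 S i (e i)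
      + 3 / 4 * P.sErr (P.estStep 𝒜 K S e) + 3 / 2 * xErr S := by
  have hs := avg_estStep 𝒜 K S e hP h
  set S' := P.estStep 𝒜 K S e with hS'
  set v : Agg m d := fun i => P.vEst i (S.x i) (𝒜.pt (S.mem i)) (𝒜.idx (e i)) with hv
  have hv' : S'.vPrev = v := rfl
  have hx' : avg S'.x = avg (P.proxAgg (S.x - P.η • S'.sPrev)) := by
    rw [hS']; simp only [estStep, step]; rw [avg_fastMix hP.W_symm hP.W_one]
  have hm : (0 : ℝ) < m := Nat.cast_pos.2 hP.m_pos
  set y := S.x - P.η • S'.sPrev with hy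
  have h1 := norm_avg_sq_le_of_firm hP.m_pos (u := fun i => P.proxAgg y i - P.xstar)
    (e := fun i => y i - (P.xstar - P.η • gradient P.fbar P.xstar))
    (fun i => proxAgg_firm_xstar hP y i)
  rw [avg_sub_const hP.m_pos, avg_sub_const hP.m_pos, consensusSq_sub_const hP.m_pos] at h1
  have h2 : consensusSq y ≤ 3 * consensusSq S.x + 3 / 2 * (P.η ^ 2 * consensusSq S'.sPrev) := by
    have := consensusSq_add_le S.x ((-P.η) • S'.sPrev) (show (0 : ℝ) < 2 by norm_num)
    rw [consensusSq_smul, neg_smul, ← sub_eq_add_neg, ← hy] at this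
    norm_num at this
    linarith
  set w : Agg m d := fun i => v i - gradient (P.fi i) P.xstar with hw
  have h3 : avg y - (P.xstar - P.η • gradient P.fbar P.xstar)
      = (avg S.x - P.xstar) - P.η • avg w := by
    have : avg w = avg v - gradient P.fbar P.xstar := by
      rw [gradient_fbar hP, ← avg_sub]; rfl
    rw [this, hy, avg_sub, avg_smul, hs, hv']; module
  -- Jensen's inequality makes the bound a sum over agents, so that its expectation needs only the
  -- law of each agent's own pick.
  have h4 : ‖(avg S.x - P.xstar) - P.η • avg w‖ ^ 2 ≤ 1 / (m : ℝ) * ∑ i,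
      (‖avg S.x - P.xstar‖ ^ 2 - 2 * P.η * inner ℝ (avg S.x - P.xstar) (w i)
        + P.η ^ 2 * ‖w i‖ ^ 2) := by
    rw [norm_sub_sq_real, inner_smul_right, norm_smul, mul_pow, Real.norm_eq_abs, sq_abs,
      inner_avg_right, Finset.sum_add_distrib, Finset.sum_sub_distrib, ← Finset.mul_sum,
      ← Finset.mul_sum]
    have h5 := mul_le_mul_of_nonneg_left (norm_avg_sq_le hP.m_pos w) (sq_nonneg P.η)
    rw [frobSq] at h5
    simp only [Finset.sum_const, Finset.card_univ, Fintype.card_fin, nsmul_eq_mul]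
    have h6 : 1 / (m : ℝ) * (m * ‖avg S.x - P.xstar‖ ^ 2) = ‖avg S.x - P.xstar‖ ^ 2 := by
      field_simp
    rw [mul_add, mul_sub, h6]
    linarith
  have h7 : 1 / (m : ℝ) * consensusSq y ≤ 3 * xErr S + 3 / 2 * P.sErr S' := by
    have := mul_le_mul_of_nonneg_left h2 (one_div_pos.2 hm).le
    refine this.trans (le_of_eq ?_)
    unfold xErr sErr; ring
  have h8 : 1 / (m : ℝ) * ∑ i, driftTerm P 𝒜 S i (e i) = 1 / (m : ℝ) * ∑ i,
      (‖avg S.x - P.xstar‖ ^ 2 - 2 * P.η * inner ℝ (avg S.x - P.xstar) (w i)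
        + P.η ^ 2 * ‖w i‖ ^ 2)
      + 4 * (n : ℝ) * P.η ^ 2 * (1 / (m : ℝ) * ∑ i, P.gradDist i (𝒜.pt (S'.mem i))) := by
    simp only [driftTerm]
    rw [Finset.sum_add_distrib, mul_add, ← Finset.mul_sum]
    congr 1
    rw [mul_left_comm]; rfl
  rw [h8, lyap, hx']
  rw [h3] at h1
  linarith

lemma xErr_estStep_le (hP : P.Assumptions) {σ : ℝ}
    (hσ : ∀ x : Agg m d, consensusSq (fastMix P.W x K) ≤ σ * consensusSq x) (hσ0 : 0 ≤ σ) :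
    xErr (P.estStep 𝒜 K S e) ≤ σ * (2 * xErr S + 2 * P.sErr (P.estStep 𝒜 K S e)) := by
  set S' := P.estStep 𝒜 K S e with hS'
  have h1 : consensusSq S'.x ≤ σ * consensusSq (S.x - P.η • S'.sPrev) :=
    (hσ _).trans (mul_le_mul_of_nonneg_left (consensusSq_proxAgg_le hP _) hσ0)
  have h2 : consensusSq (S.x - P.η • S'.sPrev) ≤
      2 * consensusSq S.x + 2 * (P.η ^ 2 * consensusSq S'.sPrev) := by
    have := consensusSq_add_le S.x ((-P.η) • S'.sPrev) (show (0 : ℝ) < 1 by norm_num)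
    rw [consensusSq_smul, neg_smul, ← sub_eq_add_neg] at this
    norm_num at this
    linarith
  have h3 := h1.trans (mul_le_mul_of_nonneg_left h2 hσ0)
  have h4 := mul_le_mul_of_nonneg_left h3 (show 0 ≤ 1 / (m : ℝ) by positivity)
  refine h4.trans (le_of_eq ?_)
  unfold xErr sErr; ring

/-- Tracking adds `v^t - v^{t-1}` before mixing. Young's weight `10` puts the large constant on the
old error, which `σ` suppresses, and keeps the forcing term nearly unscaled. -/
lemma sErr_estStep_le (hP : P.Assumptions) {σ : ℝ}
    (hσ : ∀ x : Agg m d, consensusSq (fastMix P.W x K) ≤ σ * consensusSq x) (hσ0 : 0 ≤ σ) :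
    P.sErr (P.estStep 𝒜 K S e) ≤ σ * (11 * P.sErr S + 11 / 10 * (1 / (m : ℝ) * ∑ i,
      P.η ^ 2 * ‖P.vEst i (S.x i) (𝒜.pt (S.mem i)) (𝒜.idx (e i)) - S.vPrev i‖ ^ 2)) := by
  set S' := P.estStep 𝒜 K S e with hS'
  have h1 : consensusSq S'.sPrev ≤ σ * consensusSq (S.sPrev + S'.vPrev - S.vPrev) := hσ _
  have h2 : consensusSq (S.sPrev + S'.vPrev - S.vPrev) ≤
      11 * consensusSq S.sPrev + 11 / 10 * frobSq (S'.vPrev - S.vPrev) := by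
    have := consensusSq_add_le S.sPrev (S'.vPrev - S.vPrev) (show (0 : ℝ) < 10 by norm_num)
    rw [← add_sub_assoc] at this
    have h3 := consensusSq_le_frobSq hP.m_pos (S'.vPrev - S.vPrev)
    norm_num at this
    linarith
  have h3 := h1.trans (mul_le_mul_of_nonneg_left h2 hσ0)
  have h4 := mul_le_mul_of_nonneg_left h3 (show 0 ≤ P.η ^ 2 / (m : ℝ) by positivity)
  refine h4.trans (le_of_eq ?_)
  have h5 : ∑ i, P.η ^ 2 * ‖P.vEst i (S.x i) (𝒜.pt (S.mem i)) (𝒜.idx (e i)) - S.vPrev i‖ ^ 2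
      = P.η ^ 2 * frobSq (S'.vPrev - S.vPrev) := by
    rw [frobSq, Finset.mul_sum]; rfl
  rw [h5]
  unfold sErr; ring

/-- The old estimator misses the gradient at the new iterate by its own noise plus the drift of the
gradient. Young with weight `1/4` and the triangle inequality through `xstar` give `10 L²`, and
`10/144 = 5/72`. -/
lemma vErr_estStep_le (hP : P.Assumptions) :
    P.vErr (P.estStep 𝒜 K S e) ≤ 5 / 4 * (1 / (m : ℝ) * ∑ i, P.η ^ 2 *
        ‖P.vEst i (S.x i) (𝒜.pt (S.mem i)) (𝒜.idx (e i)) - gradient (P.fi i) (S.x i)‖ ^ 2)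
      + 5 / 72 * (P.lyap 𝒜 S + xErr S
        + (P.lyap 𝒜 (P.estStep 𝒜 K S e) + xErr (P.estStep 𝒜 K S e))) := by
  set S' := P.estStep 𝒜 K S e with hS'
  have hi : ∀ i, ‖gradient (P.fi i) (S'.x i) - S'.vPrev i‖ ^ 2 ≤
      5 / 4 * ‖P.vEst i (S.x i) (𝒜.pt (S.mem i)) (𝒜.idx (e i)) - gradient (P.fi i) (S.x i)‖ ^ 2
      + 10 * P.L ^ 2 * (‖S.x i - P.xstar‖ ^ 2 + ‖S'.x i - P.xstar‖ ^ 2) := by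
    intro i
    have hvi : S'.vPrev i = P.vEst i (S.x i) (𝒜.pt (S.mem i)) (𝒜.idx (e i)) := rfl
    rw [← hvi, norm_sub_rev]
    have h1 := norm_add_sq_le (S'.vPrev i - gradient (P.fi i) (S.x i))
      (gradient (P.fi i) (S.x i) - gradient (P.fi i) (S'.x i)) (show (0 : ℝ) < 1 / 4 by norm_num)
    rw [sub_add_sub_cancel] at h1
    have h2 := gradient_fi_lipschitz_sq hP i (S.x i) (S'.x i)
    have h3 := norm_add_sq_le (S.x i - P.xstar) (-(S'.x i - P.xstar)) zero_lt_one
    rw [norm_neg, ← sub_eq_add_neg, sub_sub_sub_cancel_right] at h3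
    norm_num at h1 h3
    have h4 := mul_le_mul_of_nonneg_left h3 (sq_nonneg P.L)
    linarith
  have hs := mul_le_mul_of_nonneg_left (Finset.sum_le_sum fun i (_ : i ∈ Finset.univ) => hi i)
    (show 0 ≤ P.η ^ 2 * (1 / (m : ℝ)) by positivity)
  rw [Finset.sum_add_distrib, ← Finset.mul_sum, ← Finset.mul_sum, Finset.sum_add_distrib] at hs
  have e1 := mean_sq_dist_xstar hP S
  have e2 := mean_sq_dist_xstar hP S'
  have e3 := η_sq_mul_L_sq hP
  have e4 := norm_sq_le_lyap (P := P) 𝒜 S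
  have e5 := norm_sq_le_lyap (P := P) 𝒜 S'
  rw [← Finset.mul_sum]
  set a := ∑ i, ‖S.x i - P.xstar‖ ^ 2
  set b := ∑ i, ‖S'.x i - P.xstar‖ ^ 2
  have e6 : P.η ^ 2 * (1 / (m : ℝ)) * (10 * P.L ^ 2 * (a + b))
      = 5 / 72 * (1 / (m : ℝ) * a + 1 / (m : ℝ) * b) := by
    linear_combination (10 * (1 / (m : ℝ)) * (a + b)) * e3
  rw [mul_add, e6, e1, e2] at hs
  unfold vErr
  linarith

end Step

/-! ### Conditional expectations of the one-step bounds -/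

section Expectation
variable (𝒜 : Estimator n d M E) (S : State m d M)

/-- The estimator is unbiased, so this is the bias–variance identity over the pick. With `c =
S.vPrev i` it measures the change of the estimator, with `c` the local gradient its variance. -/
lemma sum_wt_tracking (hP : P.Assumptions) (i : Fin m) (c : Vec d) :
    ∑ a, 𝒜.wt a * (P.η ^ 2 * ‖P.vEst i (S.x i) (𝒜.pt (S.mem i)) (𝒜.idx a) - c‖ ^ 2) =
      P.η ^ 2 * (1 / (n : ℝ) * consensusSq (P.vEst i (S.x i) (𝒜.pt (S.mem i)))
        + ‖gradient (P.fi i) (S.x i) - c‖ ^ 2) := by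
  have hn : (n : ℝ) ≠ 0 := (Nat.cast_pos.2 hP.n_pos).ne'
  rw [𝒜.sum_idx (fun k => P.η ^ 2 * ‖P.vEst i (S.x i) (𝒜.pt (S.mem i)) k - c‖ ^ 2),
    ← Finset.mul_sum]
  have h := frobSq_sub_const hP.n_pos (P.vEst i (S.x i) (𝒜.pt (S.mem i))) c
  rw [frobSq, avg_vEst hP] at h
  rw [h]
  field_simp

lemma mean_sum_wt_change (hP : P.Assumptions) :
    1 / (m : ℝ) * ∑ i, ∑ a, 𝒜.wt a *
      (P.η ^ 2 * ‖P.vEst i (S.x i) (𝒜.pt (S.mem i)) (𝒜.idx a) - S.vPrev i‖ ^ 2) =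
      P.noise 𝒜 S + P.vErr S := by
  simp only [sum_wt_tracking 𝒜 S hP]
  rw [← Finset.mul_sum, Finset.sum_add_distrib]
  unfold noise vErr; ring

lemma mean_sum_wt_variance (hP : P.Assumptions) :
    1 / (m : ℝ) * ∑ i, ∑ a, 𝒜.wt a * (P.η ^ 2 *
      ‖P.vEst i (S.x i) (𝒜.pt (S.mem i)) (𝒜.idx a) - gradient (P.fi i) (S.x i)‖ ^ 2) =
      P.noise 𝒜 S := by
  simp only [sum_wt_tracking 𝒜 S hP, sub_self]
  rw [← Finset.mul_sum]
  unfold noise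
  simp
  ring

lemma sum_wt_gradDist (i : Fin m) (b : M) (x : Vec d) :
    ∑ a, 𝒜.wt a * P.gradDist i (𝒜.pt (𝒜.upd b x a)) =
      (1 - 1 / (n : ℝ)) * P.gradDist i (𝒜.pt b) + 1 / (n : ℝ) * P.gradDist i (fun _ => x) := by
  have h : ∀ k, ∑ a, 𝒜.wt a * ‖gradient (P.f i k) (𝒜.pt (𝒜.upd b x a) k)
      - gradient (P.f i k) P.xstar‖ ^ 2 = _ := fun k =>
    𝒜.sum_upd (fun y => ‖gradient (P.f i k) y - gradient (P.f i k) P.xstar‖ ^ 2) b x k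
  have hs := Finset.sum_congr rfl fun k (_ : k ∈ Finset.univ) => h k
  rw [Finset.sum_comm, Finset.sum_add_distrib, ← Finset.mul_sum, ← Finset.mul_sum] at hs
  have h1 : ∑ a, 𝒜.wt a * P.gradDist i (𝒜.pt (𝒜.upd b x a)) = 1 / (n : ℝ) * ∑ a, ∑ k, 𝒜.wt a *
      ‖gradient (P.f i k) (𝒜.pt (𝒜.upd b x a) k) - gradient (P.f i k) P.xstar‖ ^ 2 := by
    rw [Finset.mul_sum]
    refine Finset.sum_congr rfl fun a _ => ?_
    rw [gradDist, mul_left_comm]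
    congr 1
    rw [Finset.mul_sum]
  rw [h1, hs]
  unfold gradDist; ring

/-- The coefficient `6` is `2` from the second moment of the estimator plus `4 = 4n · (1/n)` from
refreshing the memory. -/
lemma sum_wt_driftTerm_le (hP : P.Assumptions) (i : Fin m) :
    ∑ a, 𝒜.wt a * driftTerm P 𝒜 S i a ≤
      ‖avg S.x - P.xstar‖ ^ 2
      - 2 * P.η * inner ℝ (avg S.x - P.xstar)
          (gradient (P.fi i) (S.x i) - gradient (P.fi i) P.xstar)
      + P.η ^ 2 * (6 * P.gradDist i (fun _ => S.x i) + 2 * P.gradDist i (𝒜.pt (S.mem i)))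
      + 4 * (n : ℝ) * P.η ^ 2 * ((1 - 1 / (n : ℝ)) * P.gradDist i (𝒜.pt (S.mem i))) := by
  have hn : (0 : ℝ) < n := Nat.cast_pos.2 hP.n_pos
  set w := P.vEst i (S.x i) (𝒜.pt (S.mem i)) with hw
  set g := gradient (P.fi i) P.xstar with hg
  set a₀ := avg S.x - P.xstar with ha₀
  have e1 : ∑ a, 𝒜.wt a * driftTerm P 𝒜 S i a =
      ∑ a, 𝒜.wt a * (‖a₀‖ ^ 2 - 2 * P.η * inner ℝ a₀ (w (𝒜.idx a) - g)
        + P.η ^ 2 * ‖w (𝒜.idx a) - g‖ ^ 2)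
      + 4 * (n : ℝ) * P.η ^ 2 * ∑ a, 𝒜.wt a * P.gradDist i (𝒜.pt (𝒜.upd (S.mem i) (S.x i) a)) := by
    rw [Finset.mul_sum, ← Finset.sum_add_distrib]
    refine Finset.sum_congr rfl fun a _ => ?_
    simp only [driftTerm]; ring
  rw [e1, 𝒜.sum_idx (fun k => ‖a₀‖ ^ 2 - 2 * P.η * inner ℝ a₀ (w k - g)
        + P.η ^ 2 * ‖w k - g‖ ^ 2), sum_wt_gradDist 𝒜, Finset.sum_add_distrib,
        Finset.sum_sub_distrib, ← Finset.mul_sum, ← Finset.mul_sum]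
  have e2 : 1 / (n : ℝ) * ∑ k, inner ℝ a₀ (w k - g) = inner ℝ a₀ (gradient (P.fi i) (S.x i) - g) := by
    rw [← inner_avg_right, avg_sub_const hP.n_pos, hw, avg_vEst hP]
  have e3 := mul_le_mul_of_nonneg_left
    (mean_sq_vEst_sub_star_le hP i (S.x i) (𝒜.pt (S.mem i))) (sq_nonneg P.η)
  rw [frobSq] at e3
  simp only [Finset.sum_const, Finset.card_univ, Fintype.card_fin, nsmul_eq_mul]
  have e4 : 1 / (n : ℝ) * (n * ‖a₀‖ ^ 2) = ‖a₀‖ ^ 2 := by field_simp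
  have e5 : 4 * (n : ℝ) * P.η ^ 2 * (1 / (n : ℝ) * P.gradDist i (fun _ => S.x i))
      = 4 * P.η ^ 2 * P.gradDist i (fun _ => S.x i) := by field_simp
  rw [mul_add, mul_sub, e4, mul_left_comm, e2, mul_add (4 * (n : ℝ) * P.η ^ 2), e5]
  linarith

lemma mean_linear_combination {m : ℕ} (hm : 0 < m) (a c₁ c₂ c₃ c₄ : ℝ) (I G D : Fin m → ℝ) :
    1 / (m : ℝ) * ∑ i, (a - c₁ * I i + c₂ * (6 * G i + 2 * D i) + c₃ * (c₄ * D i)) =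
      a - c₁ * (1 / (m : ℝ) * ∑ i, I i)
        + c₂ * (6 * (1 / (m : ℝ) * ∑ i, G i) + 2 * (1 / (m : ℝ) * ∑ i, D i))
        + c₃ * (c₄ * (1 / (m : ℝ) * ∑ i, D i)) := by
  have : (m : ℝ) ≠ 0 := by positivity
  simp only [Finset.sum_add_distrib, Finset.sum_sub_distrib, ← Finset.mul_sum,
    Finset.sum_const, Finset.card_univ, Fintype.card_fin, nsmul_eq_mul]
  field_simp

/-- With `η = 1/(12L)` the lower bound `hb` yields `12 η² G`, which beats the `6 η² G` of the noise,
and `a/(12κ) ≥ 2δ a`. The memory loses `4 η² D` to replacement and regains `2 η² D` from noise; the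
net `2 η² D` is at least `2δ · 4ν η² D` because `δ ≤ 1/(4ν)`. -/
lemma drift_combination {L μ ν a X G D I δ : ℝ} (hL : 0 < L) (hν : 0 < ν)
    (ha : 0 ≤ a) (hG : 0 ≤ G) (hD : 0 ≤ D) (h1 : δ ≤ 1 / (24 * (L / μ))) (h2 : δ ≤ 1 / (4 * ν))
    (hb : μ / 2 * a - L / 2 * X + 1 / (2 * L) * G ≤ I) :
    a - 2 * (1 / (12 * L)) * I + (1 / (12 * L)) ^ 2 * (6 * G + 2 * D)
      + 4 * ν * (1 / (12 * L)) ^ 2 * ((1 - 1 / ν) * D) ≤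
    (1 - 2 * δ) * (a + 4 * ν * (1 / (12 * L)) ^ 2 * D) + 1 / 12 * X := by
  have hη : 0 ≤ (1 / (12 * L)) ^ 2 := sq_nonneg _
  have hb' := mul_le_mul_of_nonneg_left hb (show 0 ≤ 2 * (1 / (12 * L)) by positivity)
  have c1 : 2 * (1 / (12 * L)) * (μ / 2 * a - L / 2 * X + 1 / (2 * L) * G)
      = 1 / (12 * (L / μ)) * a - 1 / 12 * X + 12 * (1 / (12 * L)) ^ 2 * G := by
    field_simp
  have c2 : 4 * ν * (1 / (12 * L)) ^ 2 * ((1 - 1 / ν) * D)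
      = 4 * ν * (1 / (12 * L)) ^ 2 * D - 4 * ((1 / (12 * L)) ^ 2 * D) := by field_simp
  have c3 : 2 * δ * a ≤ 1 / (12 * (L / μ)) * a := by
    refine mul_le_mul_of_nonneg_right ?_ ha
    have : 1 / (12 * (L / μ)) = 2 * (1 / (24 * (L / μ))) := by ring
    linarith
  have c4 : 8 * (ν * δ) * ((1 / (12 * L)) ^ 2 * D) ≤ 2 * ((1 / (12 * L)) ^ 2 * D) := by
    refine mul_le_mul_of_nonneg_right ?_ (mul_nonneg hη hD)
    rw [le_div_iff₀ (by positivity)] at h2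
    linarith
  have c5 : 0 ≤ (1 / (12 * L)) ^ 2 * G := mul_nonneg hη hG
  rw [c1] at hb'
  rw [c2]
  generalize (1 / (12 * L)) ^ 2 = η2 at *
  generalize 1 / (12 * L) = η1 at *
  linarith

lemma mean_sum_wt_driftTerm_le (hP : P.Assumptions) {δ : ℝ} (h1 : δ ≤ 1 / (24 * P.κ))
    (h2 : δ ≤ 1 / (4 * (n : ℝ))) :
    1 / (m : ℝ) * ∑ i, ∑ a, 𝒜.wt a * driftTerm P 𝒜 S i a ≤
      (1 - 2 * δ) * P.lyap 𝒜 S + 1 / 12 * xErr S := by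
  have hm : (0 : ℝ) < m := Nat.cast_pos.2 hP.m_pos
  have hn : (0 : ℝ) < n := Nat.cast_pos.2 hP.n_pos
  have hL := hP.L_pos
  have hs := mul_le_mul_of_nonneg_left (Finset.sum_le_sum fun i (_ : i ∈ Finset.univ) =>
    sum_wt_driftTerm_le 𝒜 S hP i) (one_div_pos.2 hm).le
  refine hs.trans ?_
  have hb := inner_grad_lower_bound hP S.x
  have e : P.lyap 𝒜 S = ‖avg S.x - P.xstar‖ ^ 2
    + 4 * (n : ℝ) * P.η ^ 2 * (1 / (m : ℝ) * ∑ i, P.gradDist i (𝒜.pt (S.mem i))) := rfl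
  have hG0 : 0 ≤ ∑ i, P.gradDist i (fun _ => S.x i) :=
    Finset.sum_nonneg fun i _ => gradDist_nonneg i _
  have hD0 : 0 ≤ ∑ i, P.gradDist i (𝒜.pt (S.mem i)) :=
    Finset.sum_nonneg fun i _ => gradDist_nonneg i _
  rw [e]
  rw [mean_linear_combination hP.m_pos]
  exact drift_combination hL hn (sq_nonneg _) (mul_nonneg (one_div_pos.2 hm).le hG0)
    (mul_nonneg (one_div_pos.2 hm).le hD0) h1 h2 hb

end Expectation
end Problem

/-! ### The coupled scalar recursion -/

section Recursion
variable {V X Y : ℕ → ℝ} {σ δ : ℝ}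

/-- Weight `1` on `Y` and `2` on `X` exceed the coefficients `3/4` and `19/12` with which these
enter `V (t+1)`, and the leftover covers `δ Y` and `2δ X`. The new errors satisfy `Y + 2X ≤ 16 σ Ψ`,
negligible against the spare `δ V` and that leftover since `σ ≤ δ/40000`. -/
lemma potential_contraction (hV : ∀ t, 0 ≤ V t) (hX : ∀ t, 0 ≤ X t) (hY : ∀ t, 0 ≤ Y t)
    (hσ0 : 0 ≤ σ) (hδ0 : 0 < δ) (hδ : δ ≤ 1 / 24) (hσ : σ ≤ (δ / 41) ^ 2)
    (h1 : ∀ t, V (t + 1) ≤ (1 - 2 * δ) * V t + 3 / 4 * Y t + 19 / 12 * X t)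
    (h2 : ∀ t, X (t + 1) ≤ σ * (2 * X t + 2 * Y t))
    (h3 : ∀ t, Y (t + 1) ≤ σ * (11 * Y t + 11 / 10 * ((11 / 80 + 5 / 72) * V (t + 1)
      + (11 / 64 + 5 / 72) * V t + 7 / 48 * X (t + 1) + 1 / 6 * X t))) (t : ℕ) :
    V (t + 1) + Y (t + 1) + 2 * X (t + 1) ≤ (1 - δ) * (V t + Y t + 2 * X t) := by
  have hv := hV t; have hx := hX t; have hy := hY t
  have hσ1 : σ ≤ δ / 40000 := by nlinarith
  have hδv := mul_nonneg hδ0.le hv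
  have hδx := mul_nonneg hδ0.le hx
  have hδy := mul_nonneg hδ0.le hy
  have a1 := h1 t
  have a2 := h2 t
  have a3 := h3 t
  set Ψ := V t + Y t + 2 * X t with hΨ
  have hΨ0 : 0 ≤ Ψ := by positivity
  have b1 : V (t + 1) ≤ Ψ := by nlinarith
  have b2 : X (t + 1) ≤ 2 * (σ * Ψ) := by nlinarith [mul_nonneg hσ0 hv, mul_nonneg hσ0 hx]
  have b2' : X (t + 1) ≤ Ψ := by nlinarith
  have b3 : Y (t + 1) ≤ σ * (12 * Ψ) := a3.trans (mul_le_mul_of_nonneg_left (by linarith) hσ0)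
  have b4 : σ * Ψ ≤ δ / 40000 * Ψ := mul_le_mul_of_nonneg_right hσ1 hΨ0
  have b5 : δ / 40000 * Ψ = (δ * V t + δ * Y t + 2 * (δ * X t)) / 40000 := by rw [hΨ]; ring
  have b6 : δ * X t ≤ 1 / 24 * X t := mul_le_mul_of_nonneg_right hδ hx
  have b7 : δ * Y t ≤ 1 / 24 * Y t := mul_le_mul_of_nonneg_right hδ hy
  have b8 : (1 - δ) * Ψ = V t - δ * V t + (Y t - δ * Y t) + 2 * (X t - δ * X t) := by rw [hΨ]; ring
  rw [b8]
  linarith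

/-- The coupled recursion for the Lyapunov function and the two consensus errors. -/
theorem coupled_recursion_bound (hV : ∀ t, 0 ≤ V t) (hX : ∀ t, 0 ≤ X t) (hY : ∀ t, 0 ≤ Y t)
    (hX0 : X 0 = 0)
    (hσ0 : 0 ≤ σ) (hδ0 : 0 < δ) (hδ : δ ≤ 1 / 24) (hσ : σ ≤ (δ / 41) ^ 2)
    (h1 : ∀ t, V (t + 1) ≤ (1 - 2 * δ) * V t + 3 / 4 * Y t + 19 / 12 * X t)
    (h2 : ∀ t, X (t + 1) ≤ σ * (2 * X t + 2 * Y t))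
    (h3 : ∀ t, Y (t + 1) ≤ σ * (11 * Y t + 11 / 10 * ((11 / 80 + 5 / 72) * V (t + 1)
      + (11 / 64 + 5 / 72) * V t + 7 / 48 * X (t + 1) + 1 / 6 * X t))) (t : ℕ) :
    V t ≤ (1 - δ) ^ t * (V 0 + Y 0) ∧
    X t + Y t ≤ (16 * δ ^ 2 / 45387 + (1 / 2) ^ t) * (1 - δ) ^ t * (V 0 + Y 0) := by
  have hγ : 0 ≤ 1 - δ := by linarith
  have hΨ : ∀ t, V t + Y t + 2 * X t ≤ (1 - δ) ^ t * (V 0 + Y 0) := by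
    intro t
    induction t with
    | zero => rw [hX0]; simp
    | succ t ih =>
      refine (potential_contraction hV hX hY hσ0 hδ0 hδ hσ h1 h2 h3 t).trans ?_
      rw [pow_succ', mul_assoc]
      exact mul_le_mul_of_nonneg_left ih hγ
  have hVt : ∀ t, V t ≤ (1 - δ) ^ t * (V 0 + Y 0) := fun t => by
    linarith [hΨ t, hX t, hY t]
  refine ⟨hVt t, ?_⟩
  induction t with
  | zero =>
    have : 0 ≤ 16 * δ ^ 2 / 45387 * (V 0 + Y 0) :=
      mul_nonneg (by positivity) (add_nonneg (hV 0) (hY 0))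
    rw [hX0]; simp only [pow_zero, mul_one]; linarith [hV 0]
  | succ t ih =>
    have hv := hV t; have hx := hX t; have hy := hY t
    have hv1 := hVt t
    have hv2 := hVt (t + 1)
    have a2 := h2 t
    have a3 := h3 t
    have hp : ((1 : ℝ) / 2) ^ (t + 1) = (1 / 2) ^ t / 2 := by rw [pow_succ]; ring
    have hp0 : (0 : ℝ) < (1 / 2) ^ t := by positivity
    rw [hp]
    set h := ((1 : ℝ) / 2) ^ t
    rw [pow_succ (1 - δ) t] at hv2 ⊢
    have hg0 : 0 ≤ (1 - δ) ^ t * (V 0 + Y 0) :=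
      mul_nonneg (pow_nonneg hγ t) (add_nonneg (hV 0) (hY 0))
    set g := (1 - δ) ^ t * (V 0 + Y 0) with hg
    have ih' : X t + Y t ≤ (16 * δ ^ 2 / 45387 + h) * g := by rw [hg, ← mul_assoc]; exact ih
    have e1 : (1 - δ) ^ t * (1 - δ) * (V 0 + Y 0) = (1 - δ) * g := by rw [hg]; ring
    rw [e1] at hv2
    rw [mul_assoc, e1]
    have hδ2 : δ ^ 2 ≤ 1 / 576 := by nlinarith
    have hστ : σ ≤ δ ^ 2 / 1681 := by rw [div_pow] at hσ; linarith
    have hσ2 : σ ≤ 1 / 900000 := by linarith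
    have hv3 : V (t + 1) ≤ g := by nlinarith
    have hx1 : X (t + 1) ≤ X t + Y t := by nlinarith
    -- `987/2000` rounds up `(11/10)(11/80 + 11/64 + 2 · 5/72)`, the total feed from `V`.
    have s1 : X (t + 1) + Y (t + 1) ≤ σ * (14 * (X t + Y t) + 987 / 2000 * g) := by
      have : X (t + 1) + Y (t + 1) ≤ σ * ((2 * X t + 2 * Y t) + (11 * Y t
        + 11 / 10 * ((11 / 80 + 5 / 72) * V (t + 1)
        + (11 / 64 + 5 / 72) * V t + 7 / 48 * X (t + 1) + 1 / 6 * X t))) := by linarith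
      exact this.trans (mul_le_mul_of_nonneg_left (by linarith) hσ0)
    have s2 : σ * (14 * (X t + Y t) + 987 / 2000 * g)
        ≤ σ * ((14 * (16 * δ ^ 2 / 45387 + h) + 987 / 2000) * g) :=
      mul_le_mul_of_nonneg_left (by linarith) hσ0
    -- Here `45387 = 27 · 41²`. The forced level is about `(δ/41)² · (989/2000)`, which after
    -- division by `1-δ ≥ 23/24` stays below `(16/27)(δ/41)²`. The transient is multiplied by at
    -- most `14σ`, far less than `(1-δ)/2`.
    have s3 : σ * (14 * (16 * δ ^ 2 / 45387 + h) + 987 / 2000) ≤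
        (16 * δ ^ 2 / 45387 + h / 2) * (1 - δ) := by
      have t1 : σ * (14 * (16 * δ ^ 2 / 45387) + 987 / 2000) ≤ δ ^ 2 / 1681 * (989 / 2000) :=
        mul_le_mul hστ (by linarith) (by positivity) (by positivity)
      have t2 : σ * (14 * h) ≤ 1 / 900000 * (14 * h) :=
        mul_le_mul_of_nonneg_right hσ2 (by positivity)
      have t3 : (16 * δ ^ 2 / 45387 + h / 2) * (23 / 24) ≤ (16 * δ ^ 2 / 45387 + h / 2) * (1 - δ) :=
        mul_le_mul_of_nonneg_left (by linarith) (by positivity)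
      have t4 : 0 ≤ δ ^ 2 := sq_nonneg _
      linarith
    calc _ ≤ _ := s1
      _ ≤ _ := s2
      _ = σ * (14 * (16 * δ ^ 2 / 45387 + h) + 987 / 2000) * g := by ring
      _ ≤ (16 * δ ^ 2 / 45387 + h / 2) * (1 - δ) * g := mul_le_mul_of_nonneg_right s3 hg0
      _ = _ := by ring

end Recursion

/-! ### Expectations of functions of finitely many picks -/

section FiniteExpectation
variable {Ω A E : Type*} [MeasurableSpace Ω] {Pr : Measure Ω} [IsProbabilityMeasure Pr]

/-- Finite-valued histories make every real function of the state integrable, so no measurable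
structure on states is needed. -/
lemma integrable_comp_finite [Finite A] [MeasurableSpace A] [MeasurableSingletonClass A] {H : Ω → A}
    (hH : Measurable H) (g : A → ℝ) : Integrable (fun ω => g (H ω)) Pr := by
  have : Integrable g (Pr.map H) := by
    have := Measure.isProbabilityMeasure_map (μ := Pr) hH.aemeasurable
    exact Integrable.of_finite
  exact this.comp_measurable hH

lemma integral_comp_finite [Fintype A] [MeasurableSpace A] [MeasurableSingletonClass A] {H : Ω → A}
    (hH : Measurable H) (g : A → ℝ) :
    ∫ ω, g (H ω) ∂Pr = ∑ a, Pr.real (H ⁻¹' {a}) * g a := by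
  have := Measure.isProbabilityMeasure_map (μ := Pr) hH.aemeasurable
  rw [← integral_map hH.aemeasurable (Integrable.of_finite).aestronglyMeasurable,
    integral_fintype Integrable.of_finite]
  refine Finset.sum_congr rfl fun a _ => ?_
  rw [map_measureReal_apply hH (measurableSet_singleton a), smul_eq_mul]

/-- Conditioning on a finite history that is independent of the current pick. -/
lemma integral_indep_finite [Fintype A] [MeasurableSpace A] [MeasurableSingletonClass A]
    [Fintype E] [MeasurableSpace E] [MeasurableSingletonClass E] {H : Ω → A} {ξ : Ω → E}
    (hH : Measurable H) (hξ : Measurable ξ) (hind : IndepFun H ξ Pr) {wt : E → ℝ}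
    (hwt : ∀ e, Pr.real {ω | ξ ω = e} = wt e) (g : A → E → ℝ) :
    ∫ ω, g (H ω) (ξ ω) ∂Pr = ∫ ω, ∑ e, wt e * g (H ω) e ∂Pr := by
  rw [integral_comp_finite (hH.prodMk hξ) (fun p => g p.1 p.2),
    integral_comp_finite hH (fun a => ∑ e, wt e * g a e), Fintype.sum_prod_type]
  refine Finset.sum_congr rfl fun a _ => ?_
  rw [Finset.mul_sum]
  refine Finset.sum_congr rfl fun e _ => ?_
  have h1 : (fun ω => (H ω, ξ ω)) ⁻¹' {(a, e)} = H ⁻¹' {a} ∩ ξ ⁻¹' {e} := by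
    ext ω; simp
  have h2 := hind.measure_inter_preimage_eq_mul {a} {e} (measurableSet_singleton a)
    (measurableSet_singleton e)
  rw [h1, measureReal_def, h2, ENNReal.toReal_mul, ← hwt e, mul_assoc]
  rfl

end FiniteExpectation

/-! ### The recursion in expectation -/

namespace Problem
variable {m n d : ℕ} {M E : Type} [Fintype E] {P : Problem m n d}

/-- The states along a sequence of picks. -/
def estState (P : Problem m n d) (𝒜 : Estimator n d M E) (K : ℕ) (a₀ : M) (e : ℕ → Fin m → E) :
    ℕ → State m d M
  | 0 => P.init a₀
  | t + 1 => P.estStep 𝒜 K (estState P 𝒜 K a₀ e t) (e t)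

lemma estState_congr (𝒜 : Estimator n d M E) (K : ℕ) (a₀ : M) {e e' : ℕ → Fin m → E} {t : ℕ}
    (h : ∀ s < t, e s = e' s) : P.estState 𝒜 K a₀ e t = P.estState 𝒜 K a₀ e' t := by
  induction t with
  | zero => rfl
  | succ t ih =>
    rw [estState, estState, ih fun s hs => h s (hs.trans (Nat.lt_succ_self t)),
      h t (Nat.lt_succ_self t)]

lemma avg_estState (hP : P.Assumptions) (𝒜 : Estimator n d M E) (K : ℕ) (a₀ : M)
    (e : ℕ → Fin m → E) (t : ℕ) :
    avg (P.estState 𝒜 K a₀ e t).sPrev = avg (P.estState 𝒜 K a₀ e t).vPrev := by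
  induction t with
  | zero => rfl
  | succ t ih => exact avg_estStep 𝒜 K _ _ hP ih

/-- The state is a function of the finitely many picks made so far. -/
lemma estState_eq_of_history [Nonempty E] {Ω : Type*} (𝒜 : Estimator n d M E) (K : ℕ) (a₀ : M)
    (ξ : ℕ × Fin m → Ω → E) (t : ℕ) :
    ∃ Φ : ((↥(Finset.range t ×ˢ (Finset.univ : Finset (Fin m)))) → E) → State m d M,
      ∀ ω, P.estState 𝒜 K a₀ (fun s i => ξ (s, i) ω) t = Φ fun q => ξ q ω := by
  classical
  refine ⟨fun h => P.estState 𝒜 K a₀ (fun s i =>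
    if hs : s < t then h ⟨(s, i), by simp [hs]⟩ else Classical.arbitrary E) t, fun ω => ?_⟩
  refine estState_congr 𝒜 K a₀ fun s hs => ?_
  funext i
  simp [hs]

section Random
variable [Nonempty E] [MeasurableSpace E] [MeasurableSingletonClass E]
  {Ω : Type*} [MeasurableSpace Ω] {Pr : Measure Ω} [IsProbabilityMeasure Pr]
  (𝒜 : Estimator n d M E) (K : ℕ) (a₀ : M) {ξ : ℕ × Fin m → Ω → E}


lemma integrable_estState (hξ : ∀ q, Measurable (ξ q)) (t : ℕ) (g : State m d M → ℝ) :
    Integrable (fun ω => g (P.estState 𝒜 K a₀ (fun s i => ξ (s, i) ω) t)) Pr := by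
  obtain ⟨Φ, hΦ⟩ := estState_eq_of_history (P := P) 𝒜 K a₀ ξ t
  simp only [hΦ]
  exact integrable_comp_finite (A := ↥(Finset.range t ×ˢ (Finset.univ : Finset (Fin m))) → E)
    (measurable_pi_lambda _ fun q => hξ q) fun h => g (Φ h)

lemma integrable_estState_pick (hξ : ∀ q, Measurable (ξ q)) (t : ℕ) (q : ℕ × Fin m)
    (g : State m d M → E → ℝ) :
    Integrable (fun ω => g (P.estState 𝒜 K a₀ (fun s i => ξ (s, i) ω) t) (ξ q ω)) Pr := by
  obtain ⟨Φ, hΦ⟩ := estState_eq_of_history (P := P) 𝒜 K a₀ ξ t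
  simp only [hΦ]
  exact integrable_comp_finite (A := (↥(Finset.range t ×ˢ (Finset.univ : Finset (Fin m))) → E) × E)
    (Measurable.prodMk (measurable_pi_lambda _ fun q => hξ q) (hξ q)) fun p => g (Φ p.1) p.2

lemma integral_estState_pick (hξ : ∀ q, Measurable (ξ q)) (hind : iIndepFun ξ Pr)
    (hwt : ∀ q e, Pr.real {ω | ξ q ω = e} = 𝒜.wt e) (t : ℕ) (i : Fin m)
    (g : State m d M → E → ℝ) :
    ∫ ω, g (P.estState 𝒜 K a₀ (fun s i => ξ (s, i) ω) t) (ξ (t, i) ω) ∂Pr =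
    ∫ ω, ∑ e, 𝒜.wt e * g (P.estState 𝒜 K a₀ (fun s i => ξ (s, i) ω) t) e ∂Pr := by
  obtain ⟨Φ, hΦ⟩ := estState_eq_of_history (P := P) 𝒜 K a₀ ξ t
  simp only [hΦ]
  refine integral_indep_finite (A := ↥(Finset.range t ×ˢ (Finset.univ : Finset (Fin m))) → E)
    (measurable_pi_lambda _ fun q => hξ q) (hξ (t, i)) ?_ (hwt (t, i)) fun h e => g (Φ h) e
  -- Picks at times before `t` and the single pick `(t, i)` have disjoint index sets.
  have h := hind.indepFun_finset (Finset.range t ×ˢ Finset.univ) {(t, i)} (by simp) hξ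
  have hev : Measurable fun x : ↥({(t, i)} : Finset (ℕ × Fin m)) → E =>
      x ⟨(t, i), Finset.mem_singleton_self _⟩ := measurable_pi_apply _
  exact h.comp measurable_id hev

lemma integral_mean_pick (hξ : ∀ q, Measurable (ξ q)) (hind : iIndepFun ξ Pr)
    (hwt : ∀ q e, Pr.real {ω | ξ q ω = e} = 𝒜.wt e) (t : ℕ)
    (g : State m d M → Fin m → E → ℝ) :
    ∫ ω, 1 / (m : ℝ) * ∑ i, g (P.estState 𝒜 K a₀ (fun s i => ξ (s, i) ω) t) i (ξ (t, i) ω) ∂Pr =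
    ∫ ω, 1 / (m : ℝ) *
      ∑ i, ∑ e, 𝒜.wt e * g (P.estState 𝒜 K a₀ (fun s i => ξ (s, i) ω) t) i e ∂Pr := by
  rw [integral_const_mul, integral_const_mul, integral_finsetSum, integral_finsetSum]
  · congr 1
    exact Finset.sum_congr rfl fun i _ =>
      integral_estState_pick 𝒜 K a₀ hξ hind hwt t i fun S e => g S i e
  · exact fun i _ => integrable_estState 𝒜 K a₀ hξ t fun S => ∑ e, 𝒜.wt e * g S i e
  · exact fun i _ => integrable_estState_pick 𝒜 K a₀ hξ t (t, i) fun S e => g S i e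

lemma integrable_mean_pick (hξ : ∀ q, Measurable (ξ q)) (t : ℕ)
    (g : State m d M → Fin m → E → ℝ) :
    Integrable (fun ω => 1 / (m : ℝ) *
      ∑ i, g (P.estState 𝒜 K a₀ (fun s i => ξ (s, i) ω) t) i (ξ (t, i) ω)) Pr :=
  (integrable_finsetSum _ fun i _ =>
    integrable_estState_pick 𝒜 K a₀ hξ t (t, i) fun S e => g S i e).const_mul _

/-- Convergence in expectation for a general estimator. -/
theorem estState_bounds (hP : P.Assumptions) (hξ : ∀ q, Measurable (ξ q)) (hind : iIndepFun ξ Pr)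
    (hwt : ∀ q e, Pr.real {ω | ξ q ω = e} = 𝒜.wt e) {σ δ : ℝ}
    (hσ : ∀ x : Agg m d, consensusSq (fastMix P.W x K) ≤ σ * consensusSq x) (hσ0 : 0 ≤ σ)
    (hδ0 : 0 < δ) (hδ : δ ≤ 1 / 24) (hσδ : σ ≤ (δ / 41) ^ 2) (hδκ : δ ≤ 1 / (24 * P.κ))
    (hδn : δ ≤ 1 / (4 * (n : ℝ))) (t : ℕ) :
    let S : ℕ → Ω → State m d M := fun t ω => P.estState 𝒜 K a₀ (fun s i => ξ (s, i) ω) t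
    let B : ℝ := ∫ ω, P.lyap 𝒜 (S 0 ω) ∂Pr + ∫ ω, P.sErr (S 1 ω) ∂Pr
    ∫ ω, P.lyap 𝒜 (S t ω) ∂Pr ≤ (1 - δ) ^ t * B ∧
    ∫ ω, xErr (S t ω) ∂Pr + ∫ ω, P.sErr (S (t + 1) ω) ∂Pr ≤
      (16 * δ ^ 2 / 45387 + (1 / 2) ^ t) * (1 - δ) ^ t * B := by
  intro S B
  have int : ∀ t (g : State m d M → ℝ), Integrable (fun ω => g (S t ω)) Pr := fun t g =>
    integrable_estState 𝒜 K a₀ hξ t g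
  have hstep : ∀ t ω, S (t + 1) ω = P.estStep 𝒜 K (S t ω) (fun i => ξ (t, i) ω) := fun _ _ => rfl
  have noise_bd : ∀ t, ∫ ω, P.noise 𝒜 (S t ω) ∂Pr ≤
      11 / 80 * ∫ ω, P.lyap 𝒜 (S t ω) ∂Pr + 11 / 144 * ∫ ω, xErr (S t ω) ∂Pr := by
    intro t
    rw [← integral_const_mul, ← integral_const_mul,
      ← integral_add ((int t _).const_mul _) ((int t _).const_mul _)]
    exact integral_mono (int t _) (((int t _).const_mul _).add ((int t _).const_mul _))
      fun ω => noise_le hP 𝒜 _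
  have hX : ∀ t, 0 ≤ ∫ ω, xErr (S t ω) ∂Pr := fun t => integral_nonneg fun ω => xErr_nonneg _
  refine coupled_recursion_bound (V := fun t => ∫ ω, P.lyap 𝒜 (S t ω) ∂Pr)
    (X := fun t => ∫ ω, xErr (S t ω) ∂Pr) (Y := fun t => ∫ ω, P.sErr (S (t + 1) ω) ∂Pr)
    (fun t => integral_nonneg fun ω => lyap_nonneg _ _) hX
    (fun t => integral_nonneg fun ω => sErr_nonneg _) ?_ hσ0 hδ0 hδ hσδ ?_ ?_ ?_ t
  -- All agents start at the same point, so there is no initial consensus error in `x`.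
  · have : ∀ ω, xErr (S 0 ω) = 0 := fun ω => by
      simp only [S, estState, init, xErr, consensusSq]
      rw [avg_const hP.m_pos]; simp [frobSq]
    simp [this]
  · intro t
    have h1 : ∫ ω, P.lyap 𝒜 (S (t + 1) ω) ∂Pr ≤ ∫ ω, (1 / (m : ℝ) *
        ∑ i, driftTerm P 𝒜 (S t ω) i (ξ (t, i) ω) + 3 / 4 * P.sErr (S (t + 1) ω)
        + 3 / 2 * xErr (S t ω)) ∂Pr :=
      integral_mono (int _ _) (((integrable_mean_pick 𝒜 K a₀ hξ t (driftTerm P 𝒜)).add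
        ((int (t + 1) _).const_mul _)).add ((int t _).const_mul _)) fun ω => by
          change P.lyap 𝒜 (S (t + 1) ω) ≤ _
          rw [hstep]
          exact lyap_estStep_le 𝒜 K _ _ hP (avg_estState hP 𝒜 K a₀ _ t)
    have i1 : Integrable (fun ω => 1 / (m : ℝ) * ∑ i, driftTerm P 𝒜 (S t ω) i (ξ (t, i) ω)) Pr :=
      integrable_mean_pick 𝒜 K a₀ hξ t (driftTerm P 𝒜)
    have i2 := (int (t + 1) P.sErr).const_mul (3 / 4)
    have e1 := integral_add (μ := Pr) (i1.add i2) ((int t xErr).const_mul (3 / 2))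
    have e2 := integral_add (μ := Pr) i1 i2
    have e3 := integral_mean_pick (P := P) (Pr := Pr) 𝒜 K a₀ hξ hind hwt t (driftTerm P 𝒜)
    simp only [Pi.add_apply] at e1 e2
    rw [e2, integral_const_mul (3 / 4), integral_const_mul (3 / 2), e3] at e1
    rw [e1] at h1
    have h2 : ∫ ω, 1 / (m : ℝ) * ∑ i, ∑ e, 𝒜.wt e * driftTerm P 𝒜 (S t ω) i e ∂Pr ≤
        ∫ ω, ((1 - 2 * δ) * P.lyap 𝒜 (S t ω) + 1 / 12 * xErr (S t ω)) ∂Pr :=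
      integral_mono (int t fun S => 1 / (m : ℝ) * ∑ i, ∑ e, 𝒜.wt e * driftTerm P 𝒜 S i e)
        (((int t _).const_mul _).add ((int t _).const_mul _)) fun ω =>
        mean_sum_wt_driftTerm_le 𝒜 _ hP hδκ hδn
    rw [integral_add ((int t _).const_mul _) ((int t _).const_mul _),
      integral_const_mul (1 - 2 * δ), integral_const_mul (1 / 12)] at h2
    linarith [h1.trans (add_le_add_left (add_le_add_left h2 _) _)]
  · intro t
    have h1 : ∫ ω, xErr (S (t + 1) ω) ∂Pr ≤
        ∫ ω, σ * (2 * xErr (S t ω) + 2 * P.sErr (S (t + 1) ω)) ∂Pr :=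
      integral_mono (int _ _) ((((int t _).const_mul _).add
        ((int (t + 1) _).const_mul _)).const_mul _) fun ω => by
          change xErr (S (t + 1) ω) ≤ σ * (2 * xErr (S t ω) + 2 * P.sErr (S (t + 1) ω))
          rw [hstep]
          exact xErr_estStep_le 𝒜 K _ _ hP hσ hσ0
    rwa [integral_const_mul, integral_add ((int t _).const_mul _) ((int (t + 1) _).const_mul _),
      integral_const_mul, integral_const_mul] at h1
  · intro t
    have hs : ∀ t, ∫ ω, P.sErr (S (t + 1) ω) ∂Pr ≤ σ * (11 * ∫ ω, P.sErr (S t ω) ∂Pr +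
        11 / 10 * (∫ ω, P.noise 𝒜 (S t ω) ∂Pr + ∫ ω, P.vErr (S t ω) ∂Pr)) := by
      intro t
      let g : State m d M → Fin m → E → ℝ := fun S i a =>
        P.η ^ 2 * ‖P.vEst i (S.x i) (𝒜.pt (S.mem i)) (𝒜.idx a) - S.vPrev i‖ ^ 2
      have h1 : ∫ ω, P.sErr (S (t + 1) ω) ∂Pr ≤ ∫ ω, σ * (11 * P.sErr (S t ω)
          + 11 / 10 * (1 / (m : ℝ) * ∑ i, g (S t ω) i (ξ (t, i) ω))) ∂Pr :=
        integral_mono (int _ _) ((((int t _).const_mul _).add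
          ((integrable_mean_pick 𝒜 K a₀ hξ t g).const_mul _)).const_mul _) fun ω => by
            change P.sErr (S (t + 1) ω) ≤ _
            rw [hstep]
            exact sErr_estStep_le 𝒜 K _ _ hP hσ hσ0
      rw [integral_const_mul, integral_add ((int t _).const_mul _)
        ((integrable_mean_pick 𝒜 K a₀ hξ t g).const_mul _), integral_const_mul,
        integral_const_mul, integral_mean_pick 𝒜 K a₀ hξ hind hwt t g] at h1
      simp only [g, mean_sum_wt_change 𝒜 _ hP] at h1
      rwa [integral_add (int t _) (int t _)] at h1
    have hv : ∫ ω, P.vErr (S (t + 1) ω) ∂Pr ≤ 5 / 4 * ∫ ω, P.noise 𝒜 (S t ω) ∂Pr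
        + 5 / 72 * (∫ ω, P.lyap 𝒜 (S t ω) ∂Pr + ∫ ω, xErr (S t ω) ∂Pr
          + (∫ ω, P.lyap 𝒜 (S (t + 1) ω) ∂Pr + ∫ ω, xErr (S (t + 1) ω) ∂Pr)) := by
      let g : State m d M → Fin m → E → ℝ := fun S i a =>
        P.η ^ 2 * ‖P.vEst i (S.x i) (𝒜.pt (S.mem i)) (𝒜.idx a) - gradient (P.fi i) (S.x i)‖ ^ 2
      have i1 := (int t (P.lyap 𝒜)).add (int t xErr)
      have i2 := (int (t + 1) (P.lyap 𝒜)).add (int (t + 1) xErr)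
      have h1 : ∫ ω, P.vErr (S (t + 1) ω) ∂Pr ≤
          ∫ ω, (5 / 4 * (1 / (m : ℝ) * ∑ i, g (S t ω) i (ξ (t, i) ω))
          + 5 / 72 * (P.lyap 𝒜 (S t ω) + xErr (S t ω)
            + (P.lyap 𝒜 (S (t + 1) ω) + xErr (S (t + 1) ω)))) ∂Pr :=
        integral_mono (int _ _) (((integrable_mean_pick 𝒜 K a₀ hξ t g).const_mul _).add
          ((i1.add i2).const_mul _)) fun ω => by
            change P.vErr (S (t + 1) ω) ≤ 5 / 4 * (1 / (m : ℝ) * ∑ i, g (S t ω) i (ξ (t, i) ω))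
              + 5 / 72 * (P.lyap 𝒜 (S t ω) + xErr (S t ω)
                + (P.lyap 𝒜 (S (t + 1) ω) + xErr (S (t + 1) ω)))
            rw [hstep]
            exact vErr_estStep_le 𝒜 K _ _ hP
      have e1 := integral_add (μ := Pr) ((integrable_mean_pick (P := P) 𝒜 K a₀ hξ t g).const_mul (5 / 4))
          ((i1.add i2).const_mul (5 / 72))
      have e2 := integral_add (μ := Pr) i1 i2
      have e3 := integral_add (μ := Pr) (int t (P.lyap 𝒜)) (int t xErr)
      have e4 := integral_add (μ := Pr) (int (t + 1) (P.lyap 𝒜)) (int (t + 1) xErr)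
      have e5 := integral_mean_pick (P := P) (Pr := Pr) 𝒜 K a₀ hξ hind hwt t g
      simp only [g, mean_sum_wt_variance 𝒜 _ hP] at e5
      simp only [Pi.add_apply] at e1 e2 e3 e4
      rw [integral_const_mul (5 / 4), integral_const_mul (5 / 72), e2, e3, e4] at e1
      rw [← e5]
      exact h1.trans e1.le
    -- The index shift matters: `sPrev` at time `t + 1` is `s^t`, so the error of `s^{t+1}` involves
    -- the noise at `t + 1` and, through `vErr`, the noise at `t`. The factor `5/4 · 11/80` gives
    -- `11/64`, and `5/4 · 11/144 + 5/72 = 95/576` is rounded up to `1/6`.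
    refine (hs (t + 1)).trans (mul_le_mul_of_nonneg_left ?_ hσ0)
    have n1 := noise_bd t
    have n2 := noise_bd (t + 1)
    have x0 := hX t
    linarith

end Random
end Problem

/-! ### Linear convergence for the common estimator -/

namespace Problem
variable {m n d : ℕ} {M E : Type} [Fintype E] {P : Problem m n d}

/-- The run of the algorithm with a general estimator along a sequence of picks. -/
def estRun (P : Problem m n d) (𝒜 : Estimator n d M E) (K : ℕ) (a₀ : M) (e : ℕ → Fin m → E) :
    Run m d where
  x t := (P.estState 𝒜 K a₀ e t).x
  s t := (P.estState 𝒜 K a₀ e (t + 1)).sPrev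
  Δ t := 1 / (m : ℝ) * ∑ i, P.gradDist i (𝒜.pt ((P.estState 𝒜 K a₀ e t).mem i))
  gradEvals t := (P.estState 𝒜 K a₀ e t).gradEvals
  comms t := (P.estState 𝒜 K a₀ e t).comms

lemma comms_estState (𝒜 : Estimator n d M E) (K : ℕ) (a₀ : M) (e : ℕ → Fin m → E) (t : ℕ) :
    (P.estState 𝒜 K a₀ e t).comms = 2 * K * t := by
  induction t with
  | zero => rfl
  | succ t ih => simp only [estState, estStep, step, ih]; ring

/-- At the start every reference point equals the iterate, so the first estimator is the exact local
gradient whatever the pick. Hence the initial constant is deterministic and may be read off at any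
sample point. -/
lemma sErr_estState_one (𝒜 : Estimator n d M E) (K : ℕ) {a₀ : M}
    (ha : ∀ k, 𝒜.pt a₀ k = P.xinit) (e e' : ℕ → Fin m → E) :
    P.sErr (P.estState 𝒜 K a₀ e 1) = P.sErr (P.estState 𝒜 K a₀ e' 1) := by
  simp [sErr, estState, estStep, step, init, vEst, ha]

lemma κ_pos (hP : P.Assumptions) : 0 < P.κ := div_pos hP.L_pos hP.μ_pos

/-- Adding strong convexity between `0` and some `y ≠ 0` in both directions and using Lipschitz
gradients gives `μ ≤ L`; a nonzero vector requires `d > 0`. -/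
lemma one_le_κ (hP : P.Assumptions) (hd : 0 < d) : 1 ≤ P.κ := by
  have hL := hP.L_pos
  have hμ := hP.μ_pos
  have : Nonempty (Fin d) := ⟨⟨0, hd⟩⟩
  obtain ⟨y, hy⟩ := exists_ne (0 : Vec d)
  have hy0 : 0 < ‖y‖ := norm_pos_iff.2 hy
  have h1 := hP.strongly_convex 0 y
  have h2 := hP.strongly_convex y 0
  have h3 : ‖gradient P.fbar y - gradient P.fbar 0‖ ^ 2 ≤ P.L ^ 2 * ‖y‖ ^ 2 := by
    have hm : (0 : ℝ) < m := Nat.cast_pos.2 hP.m_pos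
    rw [gradient_fbar hP, gradient_fbar hP, ← avg_sub]
    refine (norm_avg_sq_le hP.m_pos _).trans ?_
    rw [one_div, inv_mul_le_iff₀ hm]
    calc _ ≤ ∑ i : Fin m, P.L ^ 2 * ‖y - 0‖ ^ 2 := Finset.sum_le_sum fun i _ =>
          gradient_fi_lipschitz_sq hP i y 0
      _ = _ := by simp
  rw [sub_zero] at h1
  rw [zero_sub, inner_neg_right, norm_neg] at h2
  have h4 := real_inner_le_norm (gradient P.fbar y - gradient P.fbar 0) y
  rw [inner_sub_left] at h4
  have h5 : ‖gradient P.fbar y - gradient P.fbar 0‖ ≤ P.L * ‖y‖ := by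
    rw [← mul_pow] at h3
    exact le_of_sq_le_sq h3 (by positivity)
  have h6 : P.μ * ‖y‖ ^ 2 ≤ P.L * ‖y‖ ^ 2 := by nlinarith
  rw [κ, one_le_div hμ]
  exact le_of_mul_le_mul_right h6 (by positivity)

section Random
variable [Nonempty E] [MeasurableSpace E] [MeasurableSingletonClass E]
  {Ω : Type*} [MeasurableSpace Ω] {Pr : Measure Ω} [IsProbabilityMeasure Pr]
  (𝒜 : Estimator n d M E) {K : ℕ} {a₀ : M} {ξ : ℕ × Fin m → Ω → E}

/-- The expected number of component gradients evaluated by an agent. -/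
lemma integral_gradEvals_le (hξ : ∀ q, Measurable (ξ q)) (hind : iIndepFun ξ Pr)
    (hwt : ∀ q e, Pr.real {ω | ξ q ω = e} = 𝒜.wt e) (i : Fin m) (t : ℕ) :
    ∫ ω, ((P.estState 𝒜 K a₀ (fun s i => ξ (s, i) ω) t).gradEvals i : ℝ) ∂Pr ≤ n + 3 * t := by
  induction t with
  | zero => simp [estState, init]
  | succ t ih =>
    have h1 : ∀ ω, ((P.estState 𝒜 K a₀ (fun s i => ξ (s, i) ω) (t + 1)).gradEvals i : ℝ) =
        ((P.estState 𝒜 K a₀ (fun s i => ξ (s, i) ω) t).gradEvals i : ℝ) + 𝒜.cost (ξ (t, i) ω) := by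
      intro ω; simp [estState, estStep, step]
    simp only [h1]
    rw [integral_add (integrable_estState 𝒜 K a₀ hξ t fun S => (S.gradEvals i : ℝ))
      (integrable_estState_pick (P := P) 𝒜 K a₀ hξ t (t, i) fun _ e => (𝒜.cost e : ℝ)),
      integral_estState_pick (P := P) 𝒜 K a₀ hξ hind hwt t i fun _ e => (𝒜.cost e : ℝ)]
    have := 𝒜.sum_cost
    simp only [integral_const, probReal_univ, one_smul]
    push_cast
    linarith

/-- Linear convergence in expectation of the Lyapunov function and of the consensus errors. -/
theorem estState_linear_convergence (hP : P.Assumptions) (ha : ∀ k, 𝒜.pt a₀ k = P.xinit)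
    (hξ : ∀ q, Measurable (ξ q))
    (hind : iIndepFun ξ Pr) (hwt : ∀ q e, Pr.real {ω | ξ q ω = e} = 𝒜.wt e) {ρ : ℝ} (hρ0 : 0 < ρ)
    (hρ : ρ ≤ 1 / 41 * min (1 / (24 * P.κ)) (1 / (4 * (n : ℝ))))
    (hK : 1 / √(1 - lambda2 P.W) * Real.log (1 / ρ) ≤ K) (ω₀ : Ω) (t : ℕ) :
    let S : ℕ → Ω → State m d M := fun t ω => P.estState 𝒜 K a₀ (fun s i => ξ (s, i) ω) t
    let δ : ℝ := min (1 / (24 * P.κ)) (1 / (4 * (n : ℝ)))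
    let B : ℝ := P.lyap 𝒜 (S 0 ω₀) + P.sErr (S 1 ω₀)
    ∫ ω, P.lyap 𝒜 (S t ω) ∂Pr ≤ (1 - δ) ^ t * B ∧
    ∫ ω, xErr (S t ω) ∂Pr + ∫ ω, P.sErr (S (t + 1) ω) ∂Pr ≤
      (16 * δ ^ 2 / 45387 + (1 / 2) ^ t) * (1 - δ) ^ t * B := by
  intro S δ B
  have hκ := κ_pos hP
  have hn : (0 : ℝ) < n := Nat.cast_pos.2 hP.n_pos
  have hδ0 : 0 < δ := lt_min (by positivity) (by positivity)
  -- In dimension `0` the bound `κ ≥ 1`, hence `δ ≤ 1/24`, may fail, but all errors vanish.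
  rcases Nat.eq_zero_or_pos d with rfl | hd
  · have hz : ∀ v : Vec 0, v = 0 := fun v => Subsingleton.elim _ _
    have hnorm : ∀ v : Vec 0, ‖v‖ = 0 := fun v => by rw [hz v, norm_zero]
    have e1 : ∀ s, P.lyap 𝒜 s = 0 := fun s => by simp [lyap, gradDist, hnorm]
    have e2 : ∀ s : State m 0 M, xErr s = 0 := fun s => by simp [xErr, consensusSq, frobSq, hnorm]
    have e3 : ∀ s : State m 0 M, P.sErr s = 0 := fun s => by
      simp [sErr, consensusSq, frobSq, hnorm]
    have eB : B = 0 := by simp only [B, e1, e3, add_zero]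
    simp [e1, e2, e3, eB]
  have hδ : δ ≤ 1 / 24 := by
    refine (min_le_left _ _).trans ?_
    exact one_div_le_one_div_of_le (by norm_num) (by linarith [one_le_κ hP hd])
  have hB : B = ∫ ω, P.lyap 𝒜 (S 0 ω) ∂Pr + ∫ ω, P.sErr (S 1 ω) ∂Pr := by
    have h0 : ∀ ω, S 0 ω = S 0 ω₀ := fun _ => rfl
    have h1 : ∀ ω, P.sErr (S 1 ω) = P.sErr (S 1 ω₀) := fun _ => sErr_estState_one 𝒜 K ha _ _
    simp only [h0, h1, integral_const, probReal_univ, one_smul, B]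
  rw [hB]
  have hρδ : ρ ≤ δ / 41 := by rw [div_eq_inv_mul, ← one_div]; exact hρ
  exact estState_bounds 𝒜 K a₀ hP hξ hind hwt
    (consensusSq_fastMix_le hP.m_pos hP.W_nonneg hP.W_le_one hP.W_one hP.W_null hρ0
      (by linarith) hK) (sq_nonneg ρ) hδ0 hδ (pow_le_pow_left₀ hρ0.le hρδ 2) (min_le_left _ _)
      (min_le_right _ _) t

end Random

end Problem

/-! ### Arithmetic of iteration and communication counts -/

section Complexity

lemma log_one_div_half_le {ε : ℝ} (h0 : 0 < ε) (h1 : ε ≤ 1 / 2) : 1 / 2 ≤ Real.log (1 / ε) := by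
  have h2 : Real.log 2 ≤ Real.log (1 / ε) :=
    Real.log_le_log (by norm_num) (by rw [le_div_iff₀ h0]; linarith)
  linarith [Real.log_two_gt_d9]

/-- `146 = 24 · 6 + 2`: the rounding up costs `1 ≤ 2 N log(1/ε)`, since `ε ≤ 1/2`. -/
lemma iterations_le {A N ε : ℝ} (hN : 1 ≤ N) (hA0 : 0 ≤ A) (hA : A ≤ 24 * N) (h0 : 0 < ε)
    (h1 : ε ≤ 1 / 2) :
    (⌈A * Real.log (4 / ε ^ 2)⌉₊ : ℝ) ≤ 146 * N * Real.log (1 / ε) := by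
  have hl := log_one_div_half_le h0 h1
  have h2 : Real.log (4 / ε ^ 2) = 2 * Real.log 2 + 2 * Real.log (1 / ε) := by
    rw [show 4 / ε ^ 2 = 2 ^ 2 * (1 / ε) ^ 2 by field_simp; norm_num,
      Real.log_mul (by norm_num) (by positivity), Real.log_pow, Real.log_pow]
    norm_num
  have h3 : Real.log (4 / ε ^ 2) ≤ 6 * Real.log (1 / ε) := by
    have := Real.log_two_lt_d9
    linarith
  have h4 : 0 ≤ Real.log (4 / ε ^ 2) := by
    have := Real.log_two_gt_d9
    linarith
  have h5 := (Nat.ceil_lt_add_one (mul_nonneg hA0 h4)).le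
  have h6 : A * Real.log (4 / ε ^ 2) ≤ 24 * N * (6 * Real.log (1 / ε)) :=
    mul_le_mul hA h3 h4 (by linarith)
  nlinarith

lemma pow_rate_le {δ ε : ℝ} (hδ0 : 0 < δ) (hδ1 : δ ≤ 1) (hε : 0 < ε) {t : ℕ}
    (ht : ⌈1 / δ * Real.log (4 / ε ^ 2)⌉₊ ≤ t) : (1 - δ) ^ t ≤ ε ^ 2 / 4 := by
  have h1 : 1 / δ * Real.log (4 / ε ^ 2) ≤ t := (Nat.le_ceil _).trans (Nat.cast_le.2 ht)
  rw [one_div, inv_mul_le_iff₀ hδ0] at h1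
  calc (1 - δ) ^ t ≤ Real.exp (-δ) ^ t :=
        pow_le_pow_left₀ (by linarith) (by linarith [Real.add_one_le_exp (-δ)]) t
    _ = Real.exp (-(δ * t)) := by rw [← Real.exp_nat_mul]; ring_nf
    _ ≤ Real.exp (-Real.log (4 / ε ^ 2)) := Real.exp_le_exp.2 (by linarith)
    _ = ε ^ 2 / 4 := by
      rw [← Real.log_inv, Real.exp_log (by positivity), inv_div]

lemma log_984_le : Real.log 984 ≤ 7 := by
  rw [Real.log_le_iff_le_exp (by norm_num)]
  have h : Real.exp 7 = Real.exp 1 ^ 7 := by rw [← Real.exp_nat_mul]; norm_num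
  rw [h]
  calc (984 : ℝ) ≤ 2.718 ^ 7 := by norm_num
    _ ≤ _ := pow_le_pow_left₀ (by norm_num) (by linarith [Real.exp_one_gt_d9]) 7

/-- `8` is `7 ≥ log 984` plus `1` for rounding up, which `1/√(1-l) ≥ 1` absorbs. -/
lemma rounds_le {l N ρ : ℝ} (hl0 : 0 ≤ l) (hl1 : l < 1) (hN : 1 ≤ N) (hρ0 : 0 < ρ) (hρ1 : ρ ≤ 1)
    (hρ : 1 / ρ ≤ 984 * N) :
    (⌈1 / √(1 - l) * Real.log (1 / ρ)⌉₊ : ℝ) ≤ 1 / √(1 - l) * (8 + Real.log N) := by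
  have hu : 0 < √(1 - l) := Real.sqrt_pos.2 (by linarith)
  have hu1 : √(1 - l) ≤ 1 := Real.sqrt_le_one.2 (by linarith)
  have hu2 : 1 ≤ 1 / √(1 - l) := by rwa [one_le_div hu]
  have h1 : Real.log (1 / ρ) ≤ 7 + Real.log N := by
    refine (Real.log_le_log (by positivity) hρ).trans ?_
    rw [Real.log_mul (by norm_num) (by linarith)]
    linarith [log_984_le]
  have h2 : 0 ≤ Real.log (1 / ρ) := Real.log_nonneg (by rwa [le_div_iff₀ hρ0, one_mul])
  have h3 := (Nat.ceil_lt_add_one (mul_nonneg (by positivity) h2)).le.trans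
    (add_le_add_left (mul_le_mul_of_nonneg_left h1 (by positivity : 0 ≤ 1 / √(1 - l))) 1)
  nlinarith

/-- Either `N ≤ 3` or `log N ≥ 1`, so `N ≤ 3T` in all cases, and `25 = 8 · 3 + 1`. -/
lemma max_mul_log_le {κ ν : ℝ} (hν : 1 ≤ ν) :
    max κ ν * (8 + Real.log (max κ ν)) ≤
      25 * max 1 (max (ν * Real.log ν) (κ * Real.log κ)) := by
  set N := max κ ν with hN
  set T := max 1 (max (ν * Real.log ν) (κ * Real.log κ)) with hT
  have hN1 : 1 ≤ N := hν.trans (le_max_right _ _)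
  have hT1 : 1 ≤ T := le_max_left _ _
  have h1 : N * Real.log N ≤ T := by
    refine le_trans ?_ (le_max_right _ _)
    rcases le_total κ ν with h | h
    · rw [hN, max_eq_right h]; exact le_max_left _ _
    · rw [hN, max_eq_left h]; exact le_max_right _ _
  have h2 : N ≤ 3 * T := by
    rcases le_or_gt N 3 with h | h
    · linarith
    · have : 1 ≤ Real.log N := by
        rw [Real.le_log_iff_exp_le (by linarith)]
        linarith [Real.exp_one_lt_d9]
      nlinarith
  nlinarith

end Complexity

/-! ### Convergence and complexity of a run -/

namespace Problem
variable {m n d : ℕ} {M E : Type} [Fintype E] {P : Problem m n d}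

/-- The rate `min(1/(24κ), 1/(4n))`. -/
def rate (P : Problem m n d) : ℝ := min (1 / (24 * P.κ)) (1 / (4 * (n : ℝ)))

lemma rate_pos (hP : P.Assumptions) : 0 < P.rate := by
  have hκ := κ_pos hP
  have hn : (0 : ℝ) < n := Nat.cast_pos.2 hP.n_pos
  exact lt_min (by positivity) (by positivity)

lemma rate_le (hP : P.Assumptions) : P.rate ≤ 1 / 4 := by
  have hn : (1 : ℝ) ≤ n := by exact_mod_cast hP.n_pos
  refine (min_le_right _ _).trans (one_div_le_one_div_of_le (by norm_num) (by linarith))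

lemma one_sub_rate (P : Problem m n d) :
    max (1 - 1 / (24 * P.κ)) (1 - 1 / (4 * (n : ℝ))) = 1 - P.rate :=
  max_sub_sub_left _ _ _

lemma one_div_rate_le (hP : P.Assumptions) : 1 / P.rate ≤ 24 * max P.κ n := by
  have hκ := κ_pos hP
  have hn : (0 : ℝ) < n := Nat.cast_pos.2 hP.n_pos
  have hN : 0 < max P.κ n := lt_max_of_lt_left hκ
  rw [one_div_le (rate_pos hP) (by positivity)]
  exact le_min (one_div_le_one_div_of_le (by positivity) (by linarith [le_max_left P.κ n]))
    (one_div_le_one_div_of_le (by positivity) (by linarith [le_max_right P.κ (n : ℝ)]))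

lemma consensus_constant_eq (hP : P.Assumptions) :
    1 / 45387 * min (1 / (36 * P.κ ^ 2)) (1 / (n : ℝ) ^ 2) = 16 * P.rate ^ 2 / 45387 := by
  have hκ := κ_pos hP
  have hn : (0 : ℝ) < n := Nat.cast_pos.2 hP.n_pos
  have e1 : 1 / (36 * P.κ ^ 2) = 16 * (1 / (24 * P.κ)) ^ 2 := by field_simp; norm_num
  have e2 : 1 / (n : ℝ) ^ 2 = 16 * (1 / (4 * (n : ℝ))) ^ 2 := by field_simp; norm_num
  have a0 : 0 < 1 / (24 * P.κ) := by positivity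
  have b0 : 0 < 1 / (4 * (n : ℝ)) := by positivity
  rw [e1, e2, rate]
  rcases le_total (1 / (24 * P.κ)) (1 / (4 * (n : ℝ))) with h | h
  · rw [min_eq_left h, min_eq_left (by nlinarith)]; ring
  · rw [min_eq_right h, min_eq_right (by nlinarith)]; ring

section Random
variable [Nonempty E] [MeasurableSpace E] [MeasurableSingletonClass E]
  {Ω : Type*} [MeasurableSpace Ω] {Pr : Measure Ω} [IsProbabilityMeasure Pr]
  {𝒜 : Estimator n d M E} {K : ℕ} {a₀ : M} {ξ : ℕ × Fin m → Ω → E} {R : Ω → Run m d}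

/-- Convergence and complexity for a general estimator. -/
theorem estRun_convergence (hP : P.Assumptions) {ρ : ℝ} (hρ0 : 0 < ρ)
    (hρ : ρ ≤ 1 / 41 * min (1 / (24 * P.κ)) (1 / (4 * (n : ℝ))))
    (hK : K = ⌈1 / √(1 - lambda2 P.W) * Real.log (1 / ρ)⌉₊)
    (ha : ∀ k, 𝒜.pt a₀ k = P.xinit) (hξ : ∀ q, Measurable (ξ q))
    (hind : iIndepFun ξ Pr) (hwt : ∀ q e, Pr.real {ω | ξ q ω = e} = 𝒜.wt e)
    (hR : ∀ ω, R ω = P.estRun 𝒜 K a₀ fun t i => ξ (t, i) ω) (ω₀ : Ω) :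
    (∀ t : ℕ,
      Integrable (fun ω => P.V (R ω) t) Pr ∧
      ∫ ω, P.V (R ω) t ∂Pr ≤
        max (1 - 1 / (24 * P.κ)) (1 - 1 / (4 * (n : ℝ))) ^ t *
          (P.V (R ω₀) 0 + ‖P.z (R ω₀) 0‖)) ∧
    (∀ t : ℕ,
      Integrable (fun ω =>
        max (1 / (m : ℝ) * consensusSq ((R ω).x t))
          (1 / (144 * (m : ℝ) * P.L ^ 2) * consensusSq ((R ω).s t))) Pr ∧
      ∫ ω, max (1 / (m : ℝ) * consensusSq ((R ω).x t))
          (1 / (144 * (m : ℝ) * P.L ^ 2) * consensusSq ((R ω).s t)) ∂Pr ≤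
        (1 / 45387 * min (1 / (36 * P.κ ^ 2)) (1 / (n : ℝ) ^ 2) + (1 / 2) ^ t) *
          max (1 - 1 / (24 * P.κ)) (1 - 1 / (4 * (n : ℝ))) ^ t *
          (P.V (R ω₀) 0 + ‖P.z (R ω₀) 0‖)) ∧
    (∀ ε : ℝ, 0 < ε → ε ≤ 1 / 2 → ε * (P.V (R ω₀) 0 + ‖P.z (R ω₀) 0‖) ≤ 1 →
      ∃ t₀ : ℕ,
        (∀ t, t₀ ≤ t →
          Integrable (fun ω => max (1 / (m : ℝ) * consensusSq ((R ω).x t))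
            (‖avg ((R ω).x t) - P.xstar‖ ^ 2)) Pr ∧
          ∫ ω, max (1 / (m : ℝ) * consensusSq ((R ω).x t))
            (‖avg ((R ω).x t) - P.xstar‖ ^ 2) ∂Pr < ε) ∧
        (∀ i, Integrable (fun ω => ((R ω).gradEvals t₀ i : ℝ)) Pr ∧
          ∫ ω, ((R ω).gradEvals t₀ i : ℝ) ∂Pr ≤ 7300 * max P.κ n * Real.log (1 / ε)) ∧
        (ρ = 1 / 41 * min (1 / (24 * P.κ)) (1 / (4 * (n : ℝ))) →
          ∀ ω, ((R ω).comms t₀ : ℝ) ≤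
            7300 * max 1 (max (n * Real.log n) (P.κ * Real.log P.κ)) *
              (1 / √(1 - lambda2 P.W)) * Real.log (1 / ε))) := by
  obtain ⟨hl1, hl0, -⟩ := exists_gossip_basis hP.m_pos hP.W_nonneg hP.W_le_one hP.W_one hP.W_null
  have hmain := estState_linear_convergence (Pr := Pr) 𝒜 hP ha hξ hind hwt hρ0 hρ
    (hK ▸ Nat.le_ceil _) ω₀
  have hδ0 := rate_pos hP
  have hδ1 := rate_le hP
  rw [one_sub_rate, consensus_constant_eq hP]
  set S : ℕ → Ω → State m d M := fun t ω => P.estState 𝒜 K a₀ (fun s i => ξ (s, i) ω) t with hS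
  change ∀ t, _ ≤ (1 - P.rate) ^ t * (P.lyap 𝒜 (S 0 ω₀) + P.sErr (S 1 ω₀)) ∧
    _ ≤ (16 * P.rate ^ 2 / 45387 + (1 / 2) ^ t) * (1 - P.rate) ^ t *
      (P.lyap 𝒜 (S 0 ω₀) + P.sErr (S 1 ω₀)) at hmain
  have int : ∀ t (g : State m d M → ℝ), Integrable (fun ω => g (S t ω)) Pr := fun t g =>
    integrable_estState 𝒜 K a₀ hξ t g
  have hV : ∀ t ω, P.V (R ω) t = P.lyap 𝒜 (S t ω) := fun t ω => by rw [hR]; rfl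
  have hx : ∀ t ω, (R ω).x t = (S t ω).x := fun t ω => by rw [hR]; rfl
  have hs : ∀ t ω, 1 / (144 * (m : ℝ) * P.L ^ 2) * consensusSq ((R ω).s t) =
      P.sErr (S (t + 1) ω) := fun t ω => by
    have hL := hP.L_pos
    have hm : (0 : ℝ) < m := Nat.cast_pos.2 hP.m_pos
    have e : 1 / (144 * (m : ℝ) * P.L ^ 2) = P.η ^ 2 / m := by
      unfold η; field_simp; norm_num
    rw [hR, e]; rfl
  set B := P.V (R ω₀) 0 + ‖P.z (R ω₀) 0‖ with hB
  -- The recursion produces only the `s` component of `z^0`, which is at most its Euclidean norm.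
  have hBle : P.lyap 𝒜 (S 0 ω₀) + P.sErr (S 1 ω₀) ≤ B := by
    rw [hB, hV]
    refine add_le_add_right ?_ _
    have h1 := PiLp.norm_apply_le (P.z (R ω₀) 0) 1
    have h2 : P.z (R ω₀) 0 1 = P.sErr (S 1 ω₀) := by rw [hR]; rfl
    rw [h2] at h1
    exact (le_abs_self _).trans h1
  have hγ : ∀ t : ℕ, 0 ≤ (1 - P.rate) ^ t := fun t => pow_nonneg (by linarith) t
  have hlyap : ∀ t, ∫ ω, P.lyap 𝒜 (S t ω) ∂Pr ≤ (1 - P.rate) ^ t * B := fun t =>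
    (hmain t).1.trans (mul_le_mul_of_nonneg_left hBle (hγ t))
  have hcons : ∀ t, ∫ ω, xErr (S t ω) ∂Pr + ∫ ω, P.sErr (S (t + 1) ω) ∂Pr ≤
      (16 * P.rate ^ 2 / 45387 + (1 / 2) ^ t) * (1 - P.rate) ^ t * B := fun t =>
    (hmain t).2.trans (mul_le_mul_of_nonneg_left hBle (mul_nonneg (by positivity) (hγ t)))
  refine ⟨fun t => ?_, fun t => ?_, fun ε hε0 hε1 hεB => ?_⟩
  · simp only [hV]
    exact ⟨int t _, hlyap t⟩
  · simp only [hx, hs]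
    have hi : Integrable (fun ω => max (xErr (S t ω)) (P.sErr (S (t + 1) ω))) Pr :=
      (int t xErr).sup (int (t + 1) P.sErr)
    refine ⟨hi, ?_⟩
    refine le_trans ?_ (hcons t)
    rw [← integral_add (int t xErr) (int (t + 1) P.sErr)]
    exact integral_mono hi ((int t xErr).add (int (t + 1) P.sErr)) fun ω =>
      max_le_add_of_nonneg (xErr_nonneg _) (sErr_nonneg _)
  · have hn1 : (1 : ℝ) ≤ n := by exact_mod_cast hP.n_pos
    have hN1 : 1 ≤ max P.κ n := hn1.trans (le_max_right _ _)
    have hlog := log_one_div_half_le hε0 hε1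
    have ht₀ := iterations_le hN1 (one_div_pos.2 hδ0).le (one_div_rate_le hP) hε0 hε1
    -- From this time on `(1-δ)^t ≤ ε²/4`. One factor `ε` is spent on the initial constant through
    -- `ε B ≤ 1`; what remains is `ε/4` for `V` and at most `2 · ε/4` for the consensus error, in
    -- total `3ε/4 < ε`.
    refine ⟨⌈1 / P.rate * Real.log (4 / ε ^ 2)⌉₊, fun t ht => ?_, fun i => ?_, fun hρe ω => ?_⟩
    · simp only [hx]
      have hi : Integrable (fun ω => max (xErr (S t ω)) (‖avg (S t ω).x - P.xstar‖ ^ 2)) Pr :=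
        int t fun s => max (xErr s) (‖avg s.x - P.xstar‖ ^ 2)
      refine ⟨hi, ?_⟩
      have h1 : ∫ ω, max (xErr (S t ω)) (‖avg (S t ω).x - P.xstar‖ ^ 2) ∂Pr ≤
          ∫ ω, xErr (S t ω) ∂Pr + ∫ ω, P.lyap 𝒜 (S t ω) ∂Pr := by
        rw [← integral_add (int t xErr) (int t (P.lyap 𝒜))]
        exact integral_mono hi ((int t xErr).add (int t (P.lyap 𝒜))) fun ω =>
          (max_le_max le_rfl (norm_sq_le_lyap 𝒜 _)).trans
            (max_le_add_of_nonneg (xErr_nonneg _) (lyap_nonneg _ _))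
      have h2 : 0 ≤ ∫ ω, P.sErr (S (t + 1) ω) ∂Pr := integral_nonneg fun ω => sErr_nonneg _
      have h3 := pow_rate_le hδ0 (by linarith) hε0 ht
      have hB0 : 0 ≤ B := by
        rw [hB, hV]; exact add_nonneg (lyap_nonneg _ _) (norm_nonneg _)
      have h4 : (16 * P.rate ^ 2 / 45387 + (1 / 2) ^ t : ℝ) ≤ 2 := by
        have : ((1 : ℝ) / 2) ^ t ≤ 1 := pow_le_one₀ (by norm_num) (by norm_num)
        nlinarith
      have h5 : (1 - P.rate) ^ t * B ≤ ε / 4 := by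
        calc (1 - P.rate) ^ t * B ≤ ε ^ 2 / 4 * B := mul_le_mul_of_nonneg_right h3 hB0
          _ = ε / 4 * (ε * B) := by ring
          _ ≤ ε / 4 * 1 := mul_le_mul_of_nonneg_left hεB (by positivity)
          _ = ε / 4 := mul_one _
      have h6 := mul_le_mul_of_nonneg_right h4 (mul_nonneg (hγ t) hB0)
      have h7 := hcons t
      have h8 := hlyap t
      rw [mul_assoc] at h7
      refine lt_of_le_of_lt h1 ?_
      linarith
    · have hg : ∀ t ω, (R ω).gradEvals t = (S t ω).gradEvals := fun t ω => by rw [hR]; rfl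
      simp only [hg]
      refine ⟨int _ fun s => (s.gradEvals i : ℝ), ?_⟩
      refine (integral_gradEvals_le 𝒜 hξ hind hwt i _).trans ?_
      have h1 : (n : ℝ) ≤ max P.κ n := le_max_right _ _
      nlinarith
    · have hc : ∀ t, (R ω).comms t = 2 * K * t := fun t => by
        rw [hR]; exact comms_estState 𝒜 K a₀ _ t
      rw [hc]
      push_cast
      have hρ1 : ρ ≤ 1 := by rw [hρe]; change 1 / 41 * P.rate ≤ 1; linarith
      have hρ2 : 1 / ρ ≤ 984 * max P.κ n := by
        have e : 1 / ρ = 41 * (1 / P.rate) := by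
          rw [hρe]; change 1 / (1 / 41 * P.rate) = _; field_simp
        have := one_div_rate_le hP
        rw [e]; linarith
      have hKle := rounds_le hl0 hl1 hN1 hρ0 hρ1 hρ2
      rw [← hK] at hKle
      have hT := max_mul_log_le (κ := P.κ) hn1
      have hu : 0 ≤ 1 / √(1 - lambda2 P.W) := by positivity
      set T := max 1 (max (n * Real.log n) (P.κ * Real.log P.κ))
      set N := max P.κ (n : ℝ)
      calc 2 * (K : ℝ) * (⌈1 / P.rate * Real.log (4 / ε ^ 2)⌉₊ : ℝ)
          ≤ 2 * (1 / √(1 - lambda2 P.W) * (8 + Real.log N)) * (146 * N * Real.log (1 / ε)) := by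
            refine mul_le_mul (by linarith) ht₀ (Nat.cast_nonneg _) ?_
            have := Real.log_nonneg hN1
            positivity
        _ = 292 * (1 / √(1 - lambda2 P.W) * Real.log (1 / ε)) * (N * (8 + Real.log N)) := by ring
        _ ≤ 292 * (1 / √(1 - lambda2 P.W) * Real.log (1 / ε)) * (25 * T) :=
            mul_le_mul_of_nonneg_left hT
              (mul_nonneg (by norm_num) (mul_nonneg hu (by linarith)))
        _ = _ := by ring

end Random

/-! ### The two algorithms as instances -/

/-- The SAGA estimator. -/
def sagaEst (n d : ℕ) : Estimator n d (Fin n → Vec d) (Fin n) where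
  wt _ := 1 / (n : ℝ)
  idx := id
  pt := id
  upd φ x k := Function.update φ k x
  cost _ := 1
  sum_idx F := by rw [Finset.mul_sum]; rfl
  sum_upd g φ x k := by
    have hn : (n : ℝ) ≠ 0 := by have := k.pos; positivity
    have h : ∀ e, 1 / (n : ℝ) * g (Function.update φ e x k) =
        1 / (n : ℝ) * g (φ k) + if k = e then 1 / (n : ℝ) * (g x - g (φ k)) else 0 := by
      intro e
      by_cases he : k = e
      · subst he; simp; ring
      · simp [he]
    simp only [id, h, Finset.sum_add_distrib, Finset.sum_ite_eq, Finset.mem_univ, if_true,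
      Finset.sum_const, Finset.card_univ, Fintype.card_fin, nsmul_eq_mul]
    field_simp
    ring
  sum_cost := by
    simp only [Finset.sum_const, Finset.card_univ, Fintype.card_fin, nsmul_eq_mul]
    rcases Nat.eq_zero_or_pos n with rfl | h
    · norm_num
    · have : (n : ℝ) ≠ 0 := by positivity
      field_simp
      norm_num

/-- The loopless SVRG estimator with replacement probability `1 / n`. -/
def lsvrgEst (n d : ℕ) : Estimator n d (Vec d) (Fin n × Bool) where
  wt e := 1 / (n : ℝ) * if e.2 then 1 / (n : ℝ) else 1 - 1 / (n : ℝ)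
  idx := Prod.fst
  pt w _ := w
  upd w x e := if e.2 then x else w
  cost e := 2 + if e.2 then n else 0
  sum_idx F := by
    rw [Fintype.sum_prod_type, Finset.mul_sum]
    refine Finset.sum_congr rfl fun k _ => ?_
    simp
    ring
  sum_upd g w x k := by
    have hn : (n : ℝ) ≠ 0 := by have := k.pos; positivity
    rw [Fintype.sum_prod_type]
    simp
    field_simp
    ring
  sum_cost := by
    rw [Fintype.sum_prod_type]
    rcases Nat.eq_zero_or_pos n with rfl | h
    · simp
    · have : (n : ℝ) ≠ 0 := by positivity
      simp
      field_simp
      ring_nf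
      norm_num

lemma sagaState_eq (P : Problem m n d) (K : ℕ) (j : ℕ → Fin m → Fin n) (t : ℕ) :
    P.sagaState K j t = P.estState (sagaEst n d) K (fun _ => P.xinit) j t := by
  induction t with
  | zero => rfl
  | succ t ih =>
    rw [sagaState, estState, ih]
    simp [sagaStep, estStep, sagaEst, vEst]

lemma lsvrgState_eq (hP : P.Assumptions) (K : ℕ) (j : ℕ → Fin m → Fin n) (c : ℕ → Fin m → Bool)
    (t : ℕ) :
    P.lsvrgState K j c t = P.estState (lsvrgEst n d) K P.xinit (fun t i => (j t i, c t i)) t := by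
  induction t with
  | zero => rfl
  | succ t ih =>
    rw [lsvrgState, estState, ih]
    simp [lsvrgStep, estStep, lsvrgEst, vEst, gradient_fi hP]

lemma mean_gradDist_eq (P : Problem m n d) (p : Fin m → Fin n → Vec d) :
    1 / ((m : ℝ) * n) * ∑ i, ∑ k,
      ‖gradient (P.f i k) (p i k) - gradient (P.f i k) P.xstar‖ ^ 2 =
    1 / (m : ℝ) * ∑ i, P.gradDist i (p i) := by
  simp only [gradDist, ← Finset.mul_sum]
  rw [← mul_assoc, one_div_mul_one_div]

lemma sagaRun_eq (P : Problem m n d) (K : ℕ) (j : ℕ → Fin m → Fin n) :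
    P.sagaRun K j = P.estRun (sagaEst n d) K (fun _ => P.xinit) j := by
  simp only [sagaRun, estRun, sagaState_eq, mean_gradDist_eq P]
  rfl

lemma lsvrgRun_eq (hP : P.Assumptions) (K : ℕ) (j : ℕ → Fin m → Fin n) (c : ℕ → Fin m → Bool) :
    P.lsvrgRun K j c = P.estRun (lsvrgEst n d) K P.xinit (fun t i => (j t i, c t i)) := by
  simp only [lsvrgRun, estRun, lsvrgState_eq hP]
  congr 1
  funext t
  exact mean_gradDist_eq P fun i _ => _

lemma measureReal_lsvrg_pick {Ω : Type*} [MeasurableSpace Ω] {Pr : Measure Ω}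
    [IsProbabilityMeasure Pr] {J : Ω → Fin n} {c : Ω → Bool} (hc : Measurable c)
    (hJu : ∀ k, Pr.real {ω | J ω = k} = 1 / (n : ℝ))
    (hcp : Pr.real {ω | c ω = true} = 1 / (n : ℝ)) (hind : IndepFun J c Pr) (e : Fin n × Bool) :
    Pr.real {ω | (J ω, c ω) = e} = (lsvrgEst n d).wt e := by
  obtain ⟨k, b⟩ := e
  have h1 : {ω | (J ω, c ω) = (k, b)} = J ⁻¹' {k} ∩ c ⁻¹' {b} := by ext ω; simp
  have h2 := hind.measure_inter_preimage_eq_mul {k} {b} (measurableSet_singleton k)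
    (measurableSet_singleton b)
  have h3 : Pr.real (c ⁻¹' {b}) = if b then 1 / (n : ℝ) else 1 - 1 / (n : ℝ) := by
    have ht : c ⁻¹' {true} = {ω | c ω = true} := rfl
    cases b
    · have : c ⁻¹' {false} = (c ⁻¹' {true})ᶜ := by ext ω; simp
      rw [this, measureReal_compl (hc (measurableSet_singleton true)), ht, hcp, probReal_univ]
      simp
    · rw [ht, hcp]; simp
  rw [h1, measureReal_def, h2, ENNReal.toReal_mul]
  change Pr.real {ω | J ω = k} * Pr.real (c ⁻¹' {b}) = _
  rw [hJu, h3]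
  rfl

end Problem
end PMGT
end

theorem theorem1 :
    ∃ C : ℝ, 0 < C ∧
    ∀ (m n d : ℕ) (P : PMGT.Problem m n d), P.Assumptions →
    ∀ (ρ : ℝ), 0 < ρ → ρ ≤ 1 / 41 * min (1 / (24 * P.κ)) (1 / (4 * (n : ℝ))) →
    ∀ (K : ℕ), K = ⌈1 / √(1 - PMGT.lambda2 P.W) * Real.log (1 / ρ)⌉₊ →
    ∀ (Ω : Type*) [MeasurableSpace Ω] (Pr : MeasureTheory.Measure Ω)
      [MeasureTheory.IsProbabilityMeasure Pr] (R : Ω → PMGT.Problem.Run m d),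
      (P.IsSaga Pr K R ∨ P.IsLsvrg Pr (1 / (n : ℝ)) K R) →
    ∀ ω₀ : Ω,
      (∀ t : ℕ,
        MeasureTheory.Integrable (fun ω => P.V (R ω) t) Pr ∧
        ∫ ω, P.V (R ω) t ∂Pr ≤
          max (1 - 1 / (24 * P.κ)) (1 - 1 / (4 * (n : ℝ))) ^ t *
            (P.V (R ω₀) 0 + ‖P.z (R ω₀) 0‖)) ∧
      (∀ t : ℕ,
        MeasureTheory.Integrable (fun ω =>
          max (1 / (m : ℝ) * PMGT.consensusSq ((R ω).x t))
            (1 / (144 * (m : ℝ) * P.L ^ 2) * PMGT.consensusSq ((R ω).s t))) Pr ∧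
        ∫ ω, max (1 / (m : ℝ) * PMGT.consensusSq ((R ω).x t))
            (1 / (144 * (m : ℝ) * P.L ^ 2) * PMGT.consensusSq ((R ω).s t)) ∂Pr ≤
          (1 / 45387 * min (1 / (36 * P.κ ^ 2)) (1 / (n : ℝ) ^ 2) + (1 / 2) ^ t) *
            max (1 - 1 / (24 * P.κ)) (1 - 1 / (4 * (n : ℝ))) ^ t *
            (P.V (R ω₀) 0 + ‖P.z (R ω₀) 0‖)) ∧
      (∀ ε : ℝ, 0 < ε → ε ≤ 1 / 2 → ε * (P.V (R ω₀) 0 + ‖P.z (R ω₀) 0‖) ≤ 1 →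
        ∃ t₀ : ℕ,
          (∀ t, t₀ ≤ t →
            MeasureTheory.Integrable (fun ω => max (1 / (m : ℝ) * PMGT.consensusSq ((R ω).x t))
              (‖PMGT.avg ((R ω).x t) - P.xstar‖ ^ 2)) Pr ∧
            ∫ ω, max (1 / (m : ℝ) * PMGT.consensusSq ((R ω).x t))
              (‖PMGT.avg ((R ω).x t) - P.xstar‖ ^ 2) ∂Pr < ε) ∧
          (∀ i, MeasureTheory.Integrable (fun ω => ((R ω).gradEvals t₀ i : ℝ)) Pr ∧
            ∫ ω, ((R ω).gradEvals t₀ i : ℝ) ∂Pr ≤ C * max P.κ n * Real.log (1 / ε)) ∧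
          (ρ = 1 / 41 * min (1 / (24 * P.κ)) (1 / (4 * (n : ℝ))) →
            ∀ ω, ((R ω).comms t₀ : ℝ) ≤
              C * max 1 (max (n * Real.log n) (P.κ * Real.log P.κ)) *
                (1 / √(1 - PMGT.lambda2 P.W)) * Real.log (1 / ε))) := by
  -- `7300 = 2 · 146 · 25`: two FastMix calls per iteration, the iteration count, and the bound for
  -- `N (8 + log N)`. The gradient count needs far less.
  refine ⟨7300, by norm_num, ?_⟩
  intro m n d P hP ρ hρ0 hρ K hK Ω _ Pr _ R hR ω₀
  have : Nonempty (Fin n) := ⟨⟨0, hP.n_pos⟩⟩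
  rcases hR with ⟨J, hJ, hJu, hind, hR⟩ | ⟨J, c, hJ, hc, hJu, hcp, hJc, hind, hR⟩
  · exact PMGT.Problem.estRun_convergence (𝒜 := PMGT.Problem.sagaEst n d) hP hρ0 hρ hK
      (fun _ => rfl) hJ hind hJu (fun ω => (hR ω).trans (PMGT.Problem.sagaRun_eq P K _)) ω₀
  · exact PMGT.Problem.estRun_convergence (𝒜 := PMGT.Problem.lsvrgEst n d) hP hρ0 hρ hK
      (fun _ => rfl) (fun q => (hJ q).prodMk (hc q)) hind
      (fun q => PMGT.Problem.measureReal_lsvrg_pick (hc q) (hJu q) (hcp q) (hJc q))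
      (fun ω => (hR ω).trans (PMGT.Problem.lsvrgRun_eq hP K _ _)) ω₀
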